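/- Let $Q$ be a smooth $n$-dimensional manifold (Hausdorff, second countable, without boundary) with a fixed smooth volume $d\mathbf q$. Let $\mathfrak T^kQ$ be the space of smooth symmetric contravariant tensor fields of order $k$, and $\mathfrak T^*_kQ$ the space of smooth compactly supported symmetric covariant tensor fields of order $k$. Elements of $\mathfrak TQ$ are sums $\mathbb X=\sum_{k\ge 0}\mathbb X^k$, elements of $\mathfrak T^*Q$ are sums $\mathbb A=\bigoplus_{m\ge0}\mathbb A_m$, and $\langle \mathbb A,\mathbb X\rangle=\sum_k\int_Q \mathbb A_{i_1\dots i_k}\mathbb X^{i_1\dots i_k}\,d\mathbf q$. The bracket of $\mathfrak TQ$ is the symmetric Schouten concomitant: $[\mathbb X,\mathbb Y]^r=\sum_{k+m=r+1}[\mathbb X^k,\mathbb Y^m]$, where $[\mathbb X^k,\mathbb Y^m]$ has in every chart the components obtained by symmetrizing $$k\,\mathbb X^{i_{m+1}\dots i_{m+k-1}\ell}\,\partial_\ell\mathbb Y^{i_1\dots i_m}-m\,\mathbb Y^{i_{k+1}\dots i_{k+m-1}\ell}\,\partial_\ell\mathbb X^{i_1\dots i_k}$$ over all free indices. Write $\mathfrak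 s=\mathfrak T^0Q\oplus\mathfrak T^1Q\ni(\sigma,Y)$ and $\mathfrak n=\sum_{k\ge2}\mathfrak T^kQ\ni\mathbf X=\sum_{k\ge 2}\mathbb X^k$, and similarly $\mathfrak s^*\ni(\rho,M)$, $\mathfrak n^*\ni\mathbf A=\bigoplus_{m\ge2}\mathbb A_m$. In a chart in which $d\mathbf q=w\,dq^1\cdots dq^n$ put - $\mathbb A_{m+k-1}\star\mathbb X^k$: the symmetrization of $m\,\mathbb A_{i_1\dots i_{m-1}j_1\dots j_k}\,\partial_{i_m}\mathbb X^{j_1\dots j_k}$; - $\mathbb X^k*\mathbb A_{m+k-1}=k\,\mathbb X^{j_1\dots j_{k-1}\ell}\,\partial_\ell\mathbb A_{i_1\dots i_mj_1\dots j_{k-1}}$; - $\mathrm L_{\mathbb X^k}\mathbb A_{m+k-1}=\mathbb A_{m+k-1}\star\mathbb X^k+\mathbb X^k*\mathbb A_{m+k-1}$ (for $k=1$ the Lie derivative $\mathcal L_Y$); - $(\operatorname{div}\mathbb X^k)^{i_2\dots i_k}=k\,w^{-1}\partial_\ell(w\,\mathbb X^{\ell i_2\dots i_k})$, and $\operatorname{div}\mathbb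 X^k\lrcorner\,\mathbb A_{m+k-1}=(\operatorname{div}\mathbb X^k)^{j_1\dots j_{k-1}}\mathbb A_{i_1\dots i_mj_1\dots j_{k-1}}$. (a) The concomitant is well defined, i.e. the chart expressions define a smooth symmetric tensor field. $\mathfrak s$ and $\mathfrak n$ are complementary and closed under the bracket. With $\eta\vartriangleright\xi$ and $\eta\vartriangleleft\xi$ the $\mathfrak s$- and $\mathfrak n$-parts of $[\eta,\xi]$ ($\eta\in\mathfrak n$, $\xi\in\mathfrak s$), one has $$[\xi\oplus\eta,\xi'\oplus\eta']=([\xi,\xi']+\eta\vartriangleright\xi'-\eta'\vartriangleright\xi)\oplus([\eta,\eta']+\eta\vartriangleleft\xi'-\eta'\vartriangleleft\xi),$$ $$\mathbf X\vartriangleright(\sigma,Y)=(0,[\mathbb X^2,\sigma]),\qquad \mathbf X\vartriangleleft(\sigma,Y)=\sum_{k\ge2}\big([\mathbb X^{k+1},\sigma]-[Y,\mathbb X^k]\big).$$ (b) Let $\mathbb X=(\sigma,Y)\oplus\mathbf X$ and $\mathbb A=(\rho,M)\oplus\mathbf A$, where $\mathbb X$ or $\mathbb A$ has only finitely many non-zero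 orders. Then there are unique $\mathrm{ad}^*_{\mathbb X}\mathbb A\in\mathfrak T^*Q$, $\mathrm{ad}^*_{(\sigma,Y)}(\rho,M)\in\mathfrak s^*$, $\mathrm{ad}^*_{\mathbf X}\mathbf A\in\mathfrak n^*$ with $\langle\mathrm{ad}^*_xa,y\rangle=\langle a,[y,x]\rangle$ for all $y$ with finitely many non-zero orders in $\mathfrak TQ$, $\mathfrak s$, $\mathfrak n$ respectively, and, in the same sense, unique $\mu\overset{*}{\vartriangleleft}\eta,\ \mathfrak a^*_\eta\nu\in\mathfrak s^*$ and $\xi\overset{*}{\vartriangleright}\nu,\ \mathfrak b^*_\xi\mu\in\mathfrak n^*$, where $\xi=(\sigma,Y)$, $\eta=\mathbf X$, $\mu=(\rho,M)$, $\nu=\mathbf A$, with $$\langle\mu\overset{*}{\vartriangleleft}\eta,\xi'\rangle=\langle\mu,\eta\vartriangleright\xi'\rangle,\quad \langle\mathfrak a^*_\eta\nu,\xi'\rangle=\langle\nu,\eta\vartriangleleft\xi'\rangle,\quad \langle\xi\overset{*}{\vartriangleright}\nu,\eta'\rangle=\langle\nu,\eta'\vartriangleleft\xi\rangle,\quad \langle\mathfrak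 b^*_\xi\mu,\eta'\rangle=\langle\mu,\eta'\vartriangleright\xi\rangle .$$ In every chart, with $w$ as above, they are given by - $\mathrm{ad}^*_{(\sigma,Y)}(\rho,M)=\big(\mathcal L_Y\rho+\operatorname{div}(Y)\rho,\ \mathcal L_YM+\operatorname{div}(Y)M+\rho\,d\sigma\big)$ (isentropic fluid); - $(\mathrm{ad}^*_{\mathbf X}\mathbf A)_m=\sum_{k\ge2}\big(\mathrm L_{\mathbb X^k}\mathbb A_{m+k-1}+\operatorname{div}\mathbb X^k\lrcorner\,\mathbb A_{m+k-1}\big)$ for $m\ge2$; - $(\rho,M)\overset{*}{\vartriangleleft}\mathbf X=\big(-\mathbb X^2*M-\operatorname{div}\mathbb X^2\lrcorner M,\ 0\big)$; - $((\sigma,Y)\overset{*}{\vartriangleright}\mathbf A)_2=\mathcal L_Y\mathbb A_2+\operatorname{div}(Y)\mathbb A_2$, and $((\sigma,Y)\overset{*}{\vartriangleright}\mathbf A)_m=\mathcal L_Y\mathbb A_m+\operatorname{div}(Y)\mathbb A_m+\mathbb A_{m-1}\star\sigma$ for $m\ge3$; - $\mathfrak a^*_{\mathbf X}\mathbf A=\Big(-\sum_{k\ge2}(\mathbb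 X^{k+1}*\mathbb A_k+\operatorname{div}\mathbb X^{k+1}\lrcorner\,\mathbb A_k),\ -\sum_{k\ge2}(\mathrm L_{\mathbb X^k}\mathbb A_k+\operatorname{div}\mathbb X^k\lrcorner\,\mathbb A_k)\Big)$; - $\mathfrak b^*_{(\sigma,Y)}(\rho,M)=M\star\sigma\in\mathfrak T^*_2Q$. (c) Let $\mathfrak L:\mathfrak TQ\to\mathbb R$, let $J\subseteq\mathbb R$ be open, and let $t\mapsto\mathbb X(t)=(\sigma,Y)\oplus\mathbf X$ be a curve along which $\mathfrak L$ has a variational derivative $\delta\mathfrak L/\delta\mathbb X\in\mathfrak T^*Q$ for all $t\in J$, i.e. $\frac{d}{d\varepsilon}\big|_{0}\mathfrak L(\mathbb X+\varepsilon\,\delta\mathbb X)=\langle\delta\mathfrak L/\delta\mathbb X,\delta\mathbb X\rangle$ for all $\delta\mathbb X$ with finitely many non-zero orders. Suppose that for each $t\in J$ the field $\mathbb X(t)$ or $\delta\mathfrak L/\delta\mathbb X$ has only finitely many non-zero orders. Then $\frac{\delta\mathfrak L}{\delta\mathbb X}=\big(\frac{\delta\mathfrak L}{\delta\sigma},\frac{\delta\mathfrak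 L}{\delta Y}\big)\oplus\frac{\delta\mathfrak L}{\delta\mathbf X}$, the two summands being the variational derivatives with respect to variations in $\mathfrak s$ and in $\mathfrak n$, and the Euler–Poincaré equation $\frac{d}{dt}\frac{\delta\mathfrak L}{\delta\mathbb X}=-\mathrm{ad}^*_{\mathbb X}\frac{\delta\mathfrak L}{\delta\mathbb X}$ holds on $J$ if and only if the matched Euler–Poincaré equations $$\frac{d}{dt}\Big(\frac{\delta\mathfrak L}{\delta\sigma},\frac{\delta\mathfrak L}{\delta Y}\Big)=-\mathrm{ad}^*_{(\sigma,Y)}\Big(\frac{\delta\mathfrak L}{\delta\sigma},\frac{\delta\mathfrak L}{\delta Y}\Big)+\Big(\frac{\delta\mathfrak L}{\delta\sigma},\frac{\delta\mathfrak L}{\delta Y}\Big)\overset{*}{\vartriangleleft}\mathbf X+\mathfrak a^*_{\mathbf X}\frac{\delta\mathfrak L}{\delta\mathbf X},$$ $$\frac{d}{dt}\frac{\delta\mathfrak L}{\delta\mathbf X}=-\mathrm{ad}^*_{\mathbf X}\frac{\delta\mathfrak L}{\delta\mathbf X}-(\sigma,Y)\overset{*}{\vartriangleright}\frac{\delta\mathfrak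 L}{\delta\mathbf X}-\mathfrak b^*_{(\sigma,Y)}\Big(\frac{\delta\mathfrak L}{\delta\sigma},\frac{\delta\mathfrak L}{\delta Y}\Big)$$ hold on $J$ (time derivatives are taken pointwise on $Q$, order by order). -/

import Mathlib

open MeasureTheory
open scoped Manifold ContDiff

noncomputable section

namespace SymTensor

/-! ### Coordinate expressions

Component functions of symmetric tensors in one chart, and the operations on them. -/

/-- The coordinate space of an `n`-dimensional manifold. -/
abbrev Coord (n : ℕ) := EuclideanSpace ℝ (Fin n)

/-- Component functions with `k` indices, `(i₁, …, i_k) ↦ c_{i₁ … i_k}(y)`. -/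
abbrev Comp (n k : ℕ) := (Fin k → Fin n) → Coord n → ℝ

variable {n : ℕ}

/-- The partial derivative `∂f/∂y^ℓ`. -/
def partialD (ℓ : Fin n) (f : Coord n → ℝ) (y : Coord n) : ℝ :=
  fderiv ℝ f y (EuclideanSpace.single ℓ 1)

/-- Symmetrization over all indices. -/
def symmetrize {r : ℕ} (c : Comp n r) : Comp n r := fun I y =>
  (r.factorial : ℝ)⁻¹ * ∑ π : Equiv.Perm (Fin r), c (I ∘ π) y

/-- `k X^{i_{m+1} … i_{m+k-1} ℓ} ∂_ℓ Y^{i_1 … i_m}` with `r = m + k - 1` free indices `i_1, …, i_r`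
(zero for `k = 0`). -/
def transportC (r : ℕ) : {k m : ℕ} → Comp n k → Comp n m → Comp n r
  | 0, _, _, _ => 0
  | a + 1, m, X, Y => fun I y =>
      if h : m + a = r then
        ((a + 1 : ℕ) : ℝ) * ∑ ℓ : Fin n,
          X (Fin.snoc (α := fun _ => Fin n) (fun j : Fin a => I (Fin.cast h (Fin.natAdd m j))) ℓ) y
            * partialD ℓ (Y (fun j : Fin m => I (Fin.cast h (Fin.castAdd a j)))) y
      else 0

/-- Components of the symmetric Schouten concomitant of tensors of orders `k` and `m`; it has order
`r = k + m - 1`. -/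
def schoutenC (r : ℕ) {k m : ℕ} (X : Comp n k) (Y : Comp n m) : Comp n r :=
  symmetrize (fun I y => transportC r X Y I y - transportC r Y X I y)

/-- `A ⋆ X`: the symmetrization of `m A_{i_1 … i_{m-1} j_1 … j_k} ∂_{i_m} X^{j_1 … j_k}`, where `A`
has order `p = m + k - 1` (zero for `m = 0`). -/
def starC : (m : ℕ) → {p k : ℕ} → Comp n p → Comp n k → Comp n m
  | 0, _, _, _, _ => 0
  | b + 1, p, k, A, X => symmetrize (fun I y =>
      if h : p = b + k then
        ((b + 1 : ℕ) : ℝ) * ∑ J : Fin k → Fin n,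
          A (Fin.append (Fin.init (α := fun _ => Fin n) I) J ∘ Fin.cast h) y
            * partialD (I (Fin.last b)) (X J) y
      else 0)

/-- `X ∗ A`: `k X^{j_1 … j_{k-1} ℓ} ∂_ℓ A_{i_1 … i_m j_1 … j_{k-1}}`, where `A` has order
`p = m + k - 1` (zero for `k = 0`). -/
def astC (m : ℕ) : {k p : ℕ} → Comp n k → Comp n p → Comp n m
  | 0, _, _, _ => 0
  | a + 1, p, X, A => fun I y =>
      if h : p = m + a then
        ((a + 1 : ℕ) : ℝ) * ∑ J : Fin a → Fin n, ∑ ℓ : Fin n,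
          X (Fin.snoc (α := fun _ => Fin n) J ℓ) y
            * partialD ℓ (A (Fin.append I J ∘ Fin.cast h)) y
      else 0

/-- `L_X A = A ⋆ X + X ∗ A`; for `X` of order one this is the Lie derivative. -/
def lieC (m : ℕ) {k p : ℕ} (X : Comp n k) (A : Comp n p) : Comp n m := fun I y =>
  starC m A X I y + astC m X A I y

/-- The divergence with respect to the volume `w dy¹ … dyⁿ`:
`(div X)^{i_2 … i_k} = k w⁻¹ ∂_ℓ (w X^{ℓ i_2 … i_k})`, which is `k ∂_ℓ X^{ℓ i_2 … i_k}` in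
coordinates with `w = 1`; it is zero for `k = 0`. -/
def divC (w : Coord n → ℝ) : {k : ℕ} → Comp n k → Comp n (k - 1)
  | 0, _ => 0
  | a + 1, X => fun J y =>
      ((a + 1 : ℕ) : ℝ) * ∑ ℓ : Fin n,
        partialD ℓ (fun z => w z * X (Fin.cons (α := fun _ => Fin n) ℓ J) z) y / w y

/-- The contraction `(X ⌟ A)_{i_1 … i_m} = X^{j_1 … j_a} A_{i_1 … i_m j_1 … j_a}` of a contravariant
tensor of order `a` with a covariant one of order `p = m + a`. -/
def contractC (m : ℕ) {a p : ℕ} (X : Comp n a) (A : Comp n p) : Comp n m := fun I y =>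
  if h : p = m + a then ∑ J : Fin a → Fin n, X J y * A (Fin.append I J ∘ Fin.cast h) y else 0

/-- `L_X A + div X ⌟ A`, of order `m`, for `X` of order `k` and `A` of order `m + k - 1`. -/
def lieDivC (m : ℕ) (w : Coord n → ℝ) {k p : ℕ} (X : Comp n k) (A : Comp n p) : Comp n m :=
  fun I y => lieC m X A I y + contractC m (divC w X) A I y

/-! ### Tensor fields on a manifold -/

section Manifold

variable (n) (Q : Type*) [TopologicalSpace Q] [ChartedSpace (EuclideanSpace ℝ (Fin n)) Q]

/-- Charts on `Q` with values in `ℝⁿ`. -/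
abbrev Chart := OpenPartialHomeomorph Q (EuclideanSpace ℝ (Fin n))

variable {Q}

/-- The cotangent space of `Q` at `q`. -/
abbrev Cotangent (q : Q) := TangentSpace (𝓡 n) q →L[ℝ] ℝ

variable {n}

/-- The differential of a chart at `q`. -/
def dChart (e : Chart n Q) (q : Q) : TangentSpace (𝓡 n) q →L[ℝ] Coord n :=
  mfderiv (𝓡 n) 𝓘(ℝ, EuclideanSpace ℝ (Fin n)) e q

/-- The coordinate covectors `dq^i` at `q`. -/
def coframe (e : Chart n Q) (q : Q) (i : Fin n) : Cotangent n q :=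
  (EuclideanSpace.proj i : Coord n →L[ℝ] ℝ).comp (dChart e q)

/-- The coordinate vectors `∂/∂q^i` at `q`. -/
def frame (e : Chart n Q) (q : Q) (i : Fin n) : TangentSpace (𝓡 n) q :=
  (dChart e q).inverse (EuclideanSpace.single i 1)

variable (n Q)

/-- (Not necessarily smooth or symmetric) contravariant tensor fields of order `k`. -/
abbrev RawContra (k : ℕ) := ∀ q : Q, MultilinearMap ℝ (fun _ : Fin k => Cotangent n q) ℝ

/-- (Not necessarily smooth or symmetric) covariant tensor fields of order `k`. -/
abbrev RawCo (k : ℕ) := ∀ q : Q, MultilinearMap ℝ (fun _ : Fin k => TangentSpace (𝓡 n) q) ℝ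

variable {n Q}

/-- Components `X^{i_1 … i_k} = X(dq^{i_1}, …, dq^{i_k})` in a chart, on the chart's target. -/
def contraComp (e : Chart n Q) {k : ℕ} (X : RawContra n Q k) : Comp n k := fun I y =>
  X (e.symm y) (fun j => coframe e (e.symm y) (I j))

/-- Components `A_{i_1 … i_k} = A(∂_{i_1}, …, ∂_{i_k})` in a chart, on the chart's target. -/
def coComp (e : Chart n Q) {k : ℕ} (A : RawCo n Q k) : Comp n k := fun I y =>
  A (e.symm y) (fun j => frame e (e.symm y) (I j))

variable (n Q)

/-- `𝔗^k Q`: smooth symmetric contravariant tensor fields of order `k`. -/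
def Contra (k : ℕ) : Submodule ℝ (RawContra n Q k) where
  carrier := {X | (∀ q (π : Equiv.Perm (Fin k)) (α : Fin k → Cotangent n q), X q (α ∘ π) = X q α) ∧
    ∀ e ∈ IsManifold.maximalAtlas (𝓡 n) ∞ Q, ∀ I, ContDiffOn ℝ ∞ (contraComp e X I) e.target}
  add_mem' {X Y} hX hY :=
    ⟨fun q π α => by simp [hX.1 q π α, hY.1 q π α], fun e he I => (hX.2 e he I).add (hY.2 e he I)⟩
  zero_mem' := ⟨fun q π α => by simp, fun e he I => contDiffOn_const⟩
  smul_mem' c X hX :=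
    ⟨fun q π α => by simp [hX.1 q π α], fun e he I => (hX.2 e he I).const_smul c⟩

/-- `𝔗*_k Q`: smooth compactly supported symmetric covariant tensor fields of order `k`. -/
def Co (k : ℕ) : Submodule ℝ (RawCo n Q k) where
  carrier := {A | (∀ q (π : Equiv.Perm (Fin k)) (v : Fin k → TangentSpace (𝓡 n) q),
      A q (v ∘ π) = A q v) ∧
    (∀ e ∈ IsManifold.maximalAtlas (𝓡 n) ∞ Q, ∀ I, ContDiffOn ℝ ∞ (coComp e A I) e.target) ∧
    ∃ K : Set Q, IsCompact K ∧ ∀ q ∉ K, A q = 0}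
  add_mem' {A B} hA hB := by
    obtain ⟨hA1, hA2, K, hK, hAK⟩ := hA
    obtain ⟨hB1, hB2, K', hK', hBK⟩ := hB
    refine ⟨fun q π α => by simp [hA1 q π α, hB1 q π α],
      fun e he I => (hA2 e he I).add (hB2 e he I), K ∪ K', hK.union hK', fun q hq => ?_⟩
    rw [Set.mem_union, not_or] at hq
    simp [hAK q hq.1, hBK q hq.2]
  zero_mem' := ⟨fun q π α => by simp, fun e he I => contDiffOn_const, ∅, isCompact_empty,
    fun q _ => rfl⟩
  smul_mem' c A hA := by
    obtain ⟨hA1, hA2, K, hK, hAK⟩ := hA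
    exact ⟨fun q π α => by simp [hA1 q π α], fun e he I => (hA2 e he I).const_smul c, K, hK,
      fun q hq => by simp [hAK q hq]⟩

/-- `𝔗Q`: sums `X = ∑_k X^k` of symmetric contravariant tensor fields of all orders. -/
abbrev TQ := ∀ k : ℕ, Contra n Q k

/-- `𝔗*Q`: sums `A = ⨁_m A_m` of symmetric covariant tensor fields of all orders. -/
abbrev TQDual := ∀ m : ℕ, Co n Q m

variable {n Q}

/-- Components in a chart of the order `k` part of `X`. -/
def TQ.comp (X : TQ n Q) (e : Chart n Q) (k : ℕ) : Comp n k := contraComp e (X k).1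

/-- Components in a chart of the order `m` part of `A`. -/
def TQDual.comp (A : TQDual n Q) (e : Chart n Q) (m : ℕ) : Comp n m := coComp e (A m).1

/-! ### The bracket -/

/-- The contravariant tensor at `q` with components `c` in the chart `e`. -/
def ofComponents (e : Chart n Q) (q : Q) {r : ℕ} (c : (Fin r → Fin n) → ℝ) :
    MultilinearMap ℝ (fun _ : Fin r => Cotangent n q) ℝ :=
  ∑ I : Fin r → Fin n, c I • (MultilinearMap.mkPiAlgebra ℝ (Fin r) ℝ).compLinearMap
    (fun j => ({ toFun := fun α => α (frame e q (I j))
                 map_add' := fun _ _ => rfl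
                 map_smul' := fun _ _ => rfl } : Cotangent n q →ₗ[ℝ] ℝ))

/-- The tensor field whose value at `q` has the Schouten components in the preferred chart at
`q`. -/
def rawSchouten (r : ℕ) {k m : ℕ} (X : RawContra n Q k) (Y : RawContra n Q m) : RawContra n Q r :=
  fun q => ofComponents (chartAt (EuclideanSpace ℝ (Fin n)) q) q
    (fun I => schoutenC r (contraComp (chartAt (EuclideanSpace ℝ (Fin n)) q) X)
      (contraComp (chartAt (EuclideanSpace ℝ (Fin n)) q) Y) I
      (chartAt (EuclideanSpace ℝ (Fin n)) q q))

open Classical in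
/-- The symmetric Schouten concomitant of homogeneous tensor fields, of order `r = k + m - 1`. -/
def schouten (r : ℕ) {k m : ℕ} (X : Contra n Q k) (Y : Contra n Q m) : Contra n Q r :=
  if h : rawSchouten r X.1 Y.1 ∈ Contra n Q r then ⟨rawSchouten r X.1 Y.1, h⟩ else 0

/-- The bracket of `𝔗Q`: `[X, Y]^r = ∑_{k + m = r + 1} [X^k, Y^m]`; the bracket of two functions is
zero. -/
def bracket (X Y : TQ n Q) : TQ n Q := fun r =>
  ∑ p ∈ Finset.HasAntidiagonal.antidiagonal (r + 1), schouten r (X p.1) (Y p.2)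

/-! ### Graded parts -/

/-- Elements of `𝔗Q` concentrated in the orders belonging to `S`. -/
def part (S : Set ℕ) : Submodule ℝ (TQ n Q) where
  carrier := {X | ∀ k ∉ S, X k = 0}
  add_mem' hX hY k hk := by simp [hX k hk, hY k hk]
  zero_mem' _ _ := rfl
  smul_mem' c X hX k hk := by simp [hX k hk]

/-- Elements of `𝔗*Q` concentrated in the orders belonging to `S`: the dual of `part S`. -/
def dualPart (S : Set ℕ) : Submodule ℝ (TQDual n Q) where
  carrier := {A | ∀ k ∉ S, A k = 0}
  add_mem' hX hY k hk := by simp [hX k hk, hY k hk]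
  zero_mem' _ _ := rfl
  smul_mem' c X hX k hk := by simp [hX k hk]

/-- The orders of `𝔰 = 𝔗⁰Q ⊕ 𝔗¹Q`. -/
def sOrders : Set ℕ := {k | k ≤ 1}

/-- The orders of `𝔫 = ∑_{k ≥ 2} 𝔗^k Q`. -/
def nOrders : Set ℕ := {k | 2 ≤ k}

open Classical in
/-- The projection of `𝔗Q` to the part of orders in `S`. -/
def TQ.proj (S : Set ℕ) (X : TQ n Q) : TQ n Q := fun k => if k ∈ S then X k else 0

open Classical in
/-- The projection of `𝔗*Q` to the part of orders in `S`. -/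
def TQDual.proj (S : Set ℕ) (A : TQDual n Q) : TQDual n Q := fun k => if k ∈ S then A k else 0

/-- Only finitely many orders occur in `X`. -/
def TQ.IsFinite (X : TQ n Q) : Prop := {k | X k ≠ 0}.Finite

/-- Only finitely many orders occur in `A`. -/
def TQDual.IsFinite (A : TQDual n Q) : Prop := {k | A k ≠ 0}.Finite

/-- The left action `η ▷ ξ` of `𝔫` on `𝔰`: the `𝔰`-part of `[η, ξ]`. -/
def leftAct (η ξ : TQ n Q) : TQ n Q := (bracket η ξ).proj sOrders

/-- The right action `η ◁ ξ` of `𝔰` on `𝔫`: the `𝔫`-part of `[η, ξ]`. -/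
def rightAct (η ξ : TQ n Q) : TQ n Q := (bracket η ξ).proj nOrders

/-! ### Volume, pairing and dual operations -/

section Volume

variable [MeasurableSpace Q]

/-- In the chart `e`, the volume `μ` is `w dy¹ … dyⁿ` with `w` smooth and positive. -/
def IsDensity (μ : Measure Q) (e : Chart n Q) (w : Coord n → ℝ) : Prop :=
  ContDiffOn ℝ ∞ w e.target ∧ (∀ y ∈ e.target, 0 < w y) ∧
    ∀ U ⊆ e.source, MeasurableSet U → μ U = ∫⁻ y in e '' U, ENNReal.ofReal (w y)

/-- `μ` is the measure of a smooth volume form (or density) on `Q`. -/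
def IsVolume (n : ℕ) {Q : Type*} [TopologicalSpace Q] [ChartedSpace (EuclideanSpace ℝ (Fin n)) Q]
    [MeasurableSpace Q] (μ : Measure Q) : Prop :=
  ∀ e ∈ IsManifold.maximalAtlas (𝓡 n) ∞ Q, ∃ w, IsDensity (n := n) μ e w

/-- The function `A_{i_1 … i_k} X^{i_1 … i_k}` on `Q`. -/
def fullContraction {k : ℕ} (A : RawCo n Q k) (X : RawContra n Q k) (q : Q) : ℝ :=
  ∑ I : Fin k → Fin n,
    A q (fun j => frame (chartAt (EuclideanSpace ℝ (Fin n)) q) q (I j)) *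
      X q (fun j => coframe (chartAt (EuclideanSpace ℝ (Fin n)) q) q (I j))

/-- The pairing `⟨A, X⟩ = ∑_k ∫_Q A_{i_1 … i_k} X^{i_1 … i_k} dq`. -/
def pairing (μ : Measure Q) (A : TQDual n Q) (X : TQ n Q) : ℝ :=
  ∑ᶠ k : ℕ, ∫ q, fullContraction (A k).1 (X k).1 q ∂μ

/-- `B` is the element of the dual of `part S` with `⟨B, Y⟩ = F Y` for all `Y` in `part S` (with
finitely many non-zero orders, so that the pairing is a finite sum). -/
def Represents (μ : Measure Q) (S : Set ℕ) (F : TQ n Q → ℝ) (B : TQDual n Q) : Prop :=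
  B ∈ dualPart S ∧ ∀ Y ∈ part S, Y.IsFinite → pairing μ B Y = F Y

open Classical in
/-- The element of the dual of `part S` representing `F`. -/
def representer (μ : Measure Q) (S : Set ℕ) (F : TQ n Q → ℝ) : TQDual n Q :=
  if h : ∃ B, Represents μ S F B then h.choose else 0

/-- The functional `Y ↦ ⟨A, [Y, X]⟩`. -/
def coadFun (μ : Measure Q) (X : TQ n Q) (A : TQDual n Q) (Y : TQ n Q) : ℝ :=
  pairing μ A (bracket Y X)

/-- The coadjoint action `ad*_X A` of the subalgebra `part S` on its dual. -/
def coad (μ : Measure Q) (S : Set ℕ) (X : TQ n Q) (A : TQDual n Q) : TQDual n Q :=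
  representer μ S (coadFun μ X A)

/-- The functional `ξ ↦ ⟨B, η ▷ ξ⟩` on `𝔰`. -/
def dualLeftFun (μ : Measure Q) (B : TQDual n Q) (η ξ : TQ n Q) : ℝ := pairing μ B (leftAct η ξ)

/-- The dual action of `𝔫` on `𝔰*`: `⟨B ◁* η, ξ⟩ = ⟨B, η ▷ ξ⟩`. -/
def dualLeft (μ : Measure Q) (B : TQDual n Q) (η : TQ n Q) : TQDual n Q :=
  representer μ sOrders (dualLeftFun μ B η)

/-- The functional `η ↦ ⟨A, η ◁ ξ⟩` on `𝔫`. -/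
def dualRightFun (μ : Measure Q) (ξ : TQ n Q) (A : TQDual n Q) (η : TQ n Q) : ℝ :=
  pairing μ A (rightAct η ξ)

/-- The dual action of `𝔰` on `𝔫*`: `⟨ξ ▷* A, η⟩ = ⟨A, η ◁ ξ⟩`. -/
def dualRight (μ : Measure Q) (ξ : TQ n Q) (A : TQDual n Q) : TQDual n Q :=
  representer μ nOrders (dualRightFun μ ξ A)

/-- The functional `ξ ↦ ⟨A, 𝔞_η ξ⟩ = ⟨A, η ◁ ξ⟩` on `𝔰`. -/
def crossAFun (μ : Measure Q) (η : TQ n Q) (A : TQDual n Q) (ξ : TQ n Q) : ℝ :=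
  pairing μ A (rightAct η ξ)

/-- The cross action `𝔞*_η : 𝔫* → 𝔰*`, `⟨𝔞*_η A, ξ⟩ = ⟨A, η ◁ ξ⟩`. -/
def crossA (μ : Measure Q) (η : TQ n Q) (A : TQDual n Q) : TQDual n Q :=
  representer μ sOrders (crossAFun μ η A)

/-- The functional `η ↦ ⟨B, 𝔟_ξ η⟩ = ⟨B, η ▷ ξ⟩` on `𝔫`. -/
def crossBFun (μ : Measure Q) (ξ : TQ n Q) (B : TQDual n Q) (η : TQ n Q) : ℝ :=
  pairing μ B (leftAct η ξ)

/-- The cross action `𝔟*_ξ : 𝔰* → 𝔫*`, `⟨𝔟*_ξ B, η⟩ = ⟨B, η ▷ ξ⟩`. -/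
def crossB (μ : Measure Q) (ξ : TQ n Q) (B : TQDual n Q) : TQDual n Q :=
  representer μ nOrders (crossBFun μ ξ B)

/-! ### Euler–Poincaré equations -/

/-- `B = δ𝔏/δX` at `X` with respect to variations in `part S`:
`d/dε 𝔏(X + ε δX) |_{ε = 0} = ⟨B, δX⟩`. -/
def IsVarDeriv (μ : Measure Q) (S : Set ℕ) (𝔏 : TQ n Q → ℝ) (X : TQ n Q) (B : TQDual n Q) : Prop :=
  B ∈ dualPart S ∧ ∀ δX : TQ n Q, δX ∈ part S → δX.IsFinite →
    HasDerivAt (fun ε : ℝ => 𝔏 (X + ε • δX)) (pairing μ B δX) 0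

/-- `dA/dt = B` at time `t`, pointwise on `Q` and in each order. -/
def HasTimeDeriv (A : ℝ → TQDual n Q) (B : TQDual n Q) (t : ℝ) : Prop :=
  ∀ (m : ℕ) (q : Q) (v : Fin m → TangentSpace (𝓡 n) q),
    HasDerivAt (fun s => (A s m).1 q v) ((B m).1 q v) t

/-- The Euler–Poincaré equation `dA/dt = - ad*_X A` on `𝔗Q`, for times in `J`; here `A` is the curve
`δ𝔏/δX`. -/
def EulerPoincare (μ : Measure Q) (J : Set ℝ) (X : ℝ → TQ n Q) (A : ℝ → TQDual n Q) : Prop :=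
  ∀ t ∈ J, HasTimeDeriv A (-coad μ Set.univ (X t) (A t)) t

/-- The matched Euler–Poincaré equations, for times in `J`; here `ξ` and `η` are the curves in `𝔰`
and `𝔫`, and `B = δ𝔏/δξ`, `C = δ𝔏/δη`. -/
def MatchedEulerPoincare (μ : Measure Q) (J : Set ℝ) (ξ η : ℝ → TQ n Q) (B C : ℝ → TQDual n Q) :
    Prop :=
  ∀ t ∈ J,
    HasTimeDeriv B (-coad μ sOrders (ξ t) (B t) + dualLeft μ (B t) (η t) + crossA μ (η t) (C t)) t ∧
    HasTimeDeriv C (-coad μ nOrders (η t) (C t) - dualRight μ (ξ t) (C t) - crossB μ (ξ t) (B t)) t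

end Volume

end Manifold

end SymTensor

end

open SymTensor

/-!
The coadjoint action and the four dual mutual actions are, up to sign, one and the same object:
the functional `Y ↦ ⟨A, [Y, X]⟩`, with `X` and `A` restricted to some orders and tested on the
others. So everything reduces to representing this functional by a tensor field and computing the
components of the representer; the matched Euler–Poincaré equations are then the decomposition of
the components of `ad*_X A` according to the orders of `X` and of `A`
(`finsum_coadTerm_split`, `eulerPoincare_iff_matched`).

*The concomitant is well defined.* A symmetric tensor is determined by its contractions with powers
of covectors, and every covector at a point is the differential of a function `u`. Contracted with
`du`, the Schouten expression becomes a Poisson bracket of the two polynomials, in which the second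
derivatives of `u` cancel (`schoutenC_along_diff`); the remaining terms do not depend on the chart.
Polarization (`eq_zero_of_diagonal`) recovers the components (`schoutenC_tensor_eq`).

*The chart formula for the representer.* For fields supported in a chart domain, integration by
parts moves the derivatives off the test field: `A · [Y, X] w` differs from
`(L_X A + div X ⌟ A) · Y w` by a divergence (`exists_flux`, `setIntegral_schoutenC`). Testing against
all `Y` supported in the chart shows that any representer has these components
(`eq_zero_of_forall_setIntegral`, `coComp_eq_lieDivC_of_dual`). This nondegeneracy also replaces the
transformation law of `L_X A + div X ⌟ A`: in two charts the same local representer is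
described, so no direct change-of-coordinates computation is needed.

*Existence.* A finite smooth partition of unity on the compact support of `A` writes `A` as a sum of
fields supported in charts. Each summand has a representer defined by the chart formula, and these
add up (`exists_dual`). Summing over the orders of `X`, of which only finitely many contribute at
each order by the finiteness hypothesis, gives `exists_represents_coadFun`.
-/

set_option linter.unusedSectionVars false

namespace SymTensor

/-! ### Symmetric multilinear forms and sums over multi-indices -/

/-- The signed number of subsets of `Fin r` (encoded by their indicator) containing the range of
`g`: it detects whether `g` is a permutation. -/
theorem sum_signed_subsets {r : ℕ} (g : Fin r → Fin r) :
    ∑ ε : Fin r → Bool, (∏ i, (if ε i then (1 : ℝ) else -1)) * ∏ j, (if ε (g j) then (1 : ℝ) else 0)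
      = if Function.Bijective g then 1 else 0 := by
  split_ifs with hg
  · rw [Finset.sum_eq_single (fun _ => true)]
    · simp
    · intro ε _ hε
      obtain ⟨i, hi⟩ := Function.ne_iff.1 hε
      obtain ⟨j, rfl⟩ := hg.2 i
      rw [Finset.prod_eq_zero (f := fun j => if ε (g j) then (1 : ℝ) else 0) (Finset.mem_univ j)
        (by simpa using hi), mul_zero]
    · simp
  · have hs : ¬ Function.Surjective g := fun h => hg (Finite.surjective_iff_bijective.1 h)
    simp only [Function.Surjective, not_forall] at hs
    obtain ⟨i, hi⟩ := hs
    have hi' : ∀ j, g j ≠ i := fun j hj => hi ⟨j, hj⟩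
    refine Finset.sum_involution (fun ε _ => Function.update ε i (!ε i)) ?_ ?_ ?_ ?_
    · intro ε _
      have h1 : ∏ j, (if Function.update ε i (!ε i) (g j) then (1 : ℝ) else 0)
          = ∏ j, (if ε (g j) then (1 : ℝ) else 0) :=
        Finset.prod_congr rfl fun j _ => by rw [Function.update_of_ne (hi' j)]
      rw [h1, ← add_mul, ← Finset.mul_prod_erase _ _ (Finset.mem_univ i),
        ← Finset.mul_prod_erase (Finset.univ) (fun j => if Function.update ε i (!ε i) j then (1 : ℝ) else -1)
          (Finset.mem_univ i)]
      have h2 : ∏ j ∈ Finset.univ.erase i, (if Function.update ε i (!ε i) j then (1 : ℝ) else -1)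
          = ∏ j ∈ Finset.univ.erase i, (if ε j then (1 : ℝ) else -1) :=
        Finset.prod_congr rfl fun j hj => by rw [Function.update_of_ne (Finset.ne_of_mem_erase hj)]
      rw [h2, Function.update_self]
      cases ε i <;> simp
    · intro ε _ _ h
      have := congrFun h i
      simp at this
    · simp
    · intro ε _
      simp

/-- Polarization: a symmetric multilinear form that vanishes on the diagonal is zero. -/
theorem eq_zero_of_diagonal {V : Type*} [AddCommGroup V] [Module ℝ V] {r : ℕ}
    (f : MultilinearMap ℝ (fun _ : Fin r => V) ℝ)
    (hs : ∀ (π : Equiv.Perm (Fin r)) (v : Fin r → V), f (v ∘ π) = f v)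
    (h0 : ∀ v : V, f (fun _ => v) = 0) : f = 0 := by
  ext v
  have h1 : ∑ ε : Fin r → Bool, (∏ i, (if ε i then (1 : ℝ) else -1)) *
      f (fun _ => ∑ i, (if ε i then (1 : ℝ) else 0) • v i) = 0 :=
    Finset.sum_eq_zero fun ε _ => by rw [h0, mul_zero]
  have h2 : ∀ ε : Fin r → Bool, f (fun _ => ∑ i, (if ε i then (1 : ℝ) else 0) • v i) =
      ∑ g : Fin r → Fin r, (∏ j, (if ε (g j) then (1 : ℝ) else 0)) * f (v ∘ g) := by
    intro ε
    rw [f.map_sum]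
    refine Finset.sum_congr rfl fun g _ => ?_
    rw [f.map_smul_univ (fun j => if ε (g j) then (1 : ℝ) else 0), smul_eq_mul]
    rfl
  simp_rw [h2, Finset.mul_sum] at h1
  rw [Finset.sum_comm] at h1
  simp_rw [← mul_assoc, ← Finset.sum_mul, sum_signed_subsets, ite_mul, one_mul, zero_mul] at h1
  rw [← Finset.sum_filter] at h1
  have h3 : ∀ g ∈ Finset.univ.filter (fun g : Fin r → Fin r => Function.Bijective g),
      f (v ∘ g) = f v := by
    intro g hg
    exact hs (Equiv.ofBijective g (Finset.mem_filter.1 hg).2) v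
  rw [Finset.sum_congr rfl h3, Finset.sum_const, smul_eq_zero] at h1
  rcases h1 with h1 | h1
  · rw [Finset.card_eq_zero] at h1
    exact absurd (Finset.mem_filter.2 ⟨Finset.mem_univ id, Function.bijective_id⟩)
      (h1 ▸ Finset.notMem_empty _)
  · simpa using h1

/-- Expansion of a multilinear form evaluated on linear combinations of the vectors `b i`. -/
theorem multilinear_expand {V : Type*} [AddCommGroup V] [Module ℝ V] {n r : ℕ}
    (f : MultilinearMap ℝ (fun _ : Fin r => V) ℝ) (b : Fin n → V) (c : Fin r → Fin n → ℝ) :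
    f (fun j => ∑ i, c j i • b i) =
      ∑ I : Fin r → Fin n, f (fun j => b (I j)) * ∏ j, c j (I j) := by
  rw [f.map_sum]
  refine Finset.sum_congr rfl fun I _ => ?_
  rw [f.map_smul_univ (fun j => c j (I j)), smul_eq_mul, mul_comm]

/-- A sum over multi-indices of length `m + a` is an iterated sum over their two blocks. -/
theorem sum_append {n m a : ℕ} {M : Type*} [AddCommMonoid M] (F : (Fin (m + a) → Fin n) → M) :
    ∑ K, F K = ∑ I : Fin m → Fin n, ∑ J : Fin a → Fin n, F (Fin.append I J) := by
  rw [← Fintype.sum_prod_type' (f := fun I J => F (Fin.append I J))]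
  exact (Fintype.sum_equiv (Fin.appendEquiv m a) _ _ fun _ => rfl).symm

/-- A sum over multi-indices of length `a + 1`, the last index being split off. -/
theorem sum_snoc {n a : ℕ} {M : Type*} [AddCommMonoid M] (F : (Fin (a + 1) → Fin n) → M) :
    ∑ K, F K = ∑ J : Fin a → Fin n, ∑ ℓ : Fin n, F (Fin.snoc (α := fun _ => Fin n) J ℓ) := by
  rw [Finset.sum_comm, ← Fintype.sum_prod_type' (f := fun ℓ J => F (Fin.snoc (α := fun _ => Fin n) J ℓ))]
  exact (Fintype.sum_equiv (Fin.snocEquiv (fun _ => Fin n)) _ _ fun _ => rfl).symm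

/-- Relabelling the positions in a sum over multi-indices. -/
theorem sum_comp_perm {n r s : ℕ} {M : Type*} [AddCommMonoid M] (π : Fin r ≃ Fin s)
    (F : (Fin r → Fin n) → M) : ∑ I : Fin s → Fin n, F (I ∘ π) = ∑ I, F I :=
  Fintype.sum_equiv (π.symm.arrowCongr (Equiv.refl (Fin n))) _ _ fun _ => rfl

/-- Invariance under all permutations of the indices. -/
def IsSymm {n r : ℕ} (c : (Fin r → Fin n) → ℝ) : Prop :=
  ∀ (π : Equiv.Perm (Fin r)) (I : Fin r → Fin n), c (I ∘ π) = c I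

theorem isSymm_prod {n r : ℕ} (p : Fin n → ℝ) : IsSymm (fun I : Fin r → Fin n => ∏ j, p (I j)) :=
  fun π I => Equiv.prod_comp π (fun j => p (I j))

theorem isSymm_symmetrize {n r : ℕ} (c : Comp n r) (y : Coord n) :
    IsSymm (fun I => symmetrize c I y) := by
  intro π I
  simp only [symmetrize]
  congr 1
  exact Fintype.sum_equiv (Equiv.mulLeft π) _ _ fun σ => rfl

/-- Against a symmetric family of coefficients, symmetrization has no effect. -/
theorem sum_mul_symmetrize {n r : ℕ} (c : Comp n r) (y : Coord n) (a : (Fin r → Fin n) → ℝ)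
    (ha : IsSymm a) : ∑ I, a I * symmetrize c I y = ∑ I, a I * c I y := by
  have h : ∀ π : Equiv.Perm (Fin r), ∑ I : Fin r → Fin n, a I * c (I ∘ π) y = ∑ I, a I * c I y := by
    intro π
    rw [← sum_comp_perm π (fun I => a I * c I y)]
    exact Finset.sum_congr rfl fun I _ => by rw [ha π I]
  simp only [symmetrize, Finset.mul_sum]
  rw [Finset.sum_comm]
  simp_rw [mul_left_comm (a _), ← Finset.mul_sum, h, Finset.sum_const, Finset.card_univ,
    Fintype.card_perm, Fintype.card_fin, nsmul_eq_mul]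
  rw [← mul_assoc, inv_mul_cancel₀ (by positivity), one_mul]

end SymTensor

noncomputable section
namespace SymTensor

/-! ### Calculus in charts -/

variable {n : ℕ} {Q : Type*} [TopologicalSpace Q] [ChartedSpace (EuclideanSpace ℝ (Fin n)) Q]
  [IsManifold (𝓡 n) ∞ Q]

/-- The differential of a function at `q`, as a cotangent vector. -/
def dFun (g : Q → ℝ) (q : Q) : Cotangent n q := mfderiv (𝓡 n) 𝓘(ℝ, ℝ) g q

theorem mem_maximalAtlas_one {e : Chart n Q} (he : e ∈ IsManifold.maximalAtlas (𝓡 n) ∞ Q) :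
    e ∈ IsManifold.maximalAtlas (𝓡 n) 1 Q :=
  IsManifold.maximalAtlas_subset_of_le (by norm_num) he

theorem chart_mdifferentiable {e : Chart n Q} (he : e ∈ IsManifold.maximalAtlas (𝓡 n) ∞ Q) :
    e.MDifferentiable (𝓡 n) 𝓘(ℝ, EuclideanSpace ℝ (Fin n)) :=
  haveI : IsManifold (𝓡 n) 1 Q := IsManifold.of_le (n := ∞) (by norm_num)
  ⟨fun _ hx => (mdifferentiableAt_of_mem_maximalAtlas (mem_maximalAtlas_one he)
      hx).mdifferentiableWithinAt,
    fun _ hx => (mdifferentiableAt_symm_of_mem_maximalAtlas (mem_maximalAtlas_one he)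
      hx).mdifferentiableWithinAt⟩

theorem exists_equiv_dChart {e : Chart n Q} (he : e ∈ IsManifold.maximalAtlas (𝓡 n) ∞ Q) {q : Q}
    (hq : q ∈ e.source) :
    ∃ L : TangentSpace (𝓡 n) q ≃L[ℝ] Coord n, (L : TangentSpace (𝓡 n) q →L[ℝ] Coord n) = dChart e q :=
  ⟨(chart_mdifferentiable he).mfderiv hq, rfl⟩

theorem dChart_frame {e : Chart n Q} (he : e ∈ IsManifold.maximalAtlas (𝓡 n) ∞ Q) {q : Q}
    (hq : q ∈ e.source) (i : Fin n) : dChart e q (frame e q i) = EuclideanSpace.single i 1 := by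
  obtain ⟨L, hL⟩ := exists_equiv_dChart he hq
  rw [frame, ← hL, ContinuousLinearMap.inverse_equiv]
  exact L.apply_symm_apply _

theorem coframe_frame {e : Chart n Q} (he : e ∈ IsManifold.maximalAtlas (𝓡 n) ∞ Q) {q : Q}
    (hq : q ∈ e.source) (i j : Fin n) :
    coframe e q i (frame e q j) = if i = j then 1 else 0 := by
  rw [coframe, ContinuousLinearMap.comp_apply, dChart_frame he hq]
  simp

theorem tangent_expand {e : Chart n Q} (he : e ∈ IsManifold.maximalAtlas (𝓡 n) ∞ Q) {q : Q}
    (hq : q ∈ e.source) (v : TangentSpace (𝓡 n) q) :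
    v = ∑ i, coframe e q i v • frame e q i := by
  obtain ⟨L, hL⟩ := exists_equiv_dChart he hq
  apply L.injective
  have h1 : ∀ u, L u = dChart e q u := fun u => by rw [← hL]; rfl
  rw [h1, h1, map_sum]
  simp_rw [map_smul, dChart_frame he hq]
  ext j
  simp [coframe, Pi.single_apply]

theorem cotangent_expand {e : Chart n Q} (he : e ∈ IsManifold.maximalAtlas (𝓡 n) ∞ Q) {q : Q}
    (hq : q ∈ e.source) (α : Cotangent n q) :
    α = ∑ i, α (frame e q i) • coframe e q i := by
  ext v
  conv_lhs => rw [tangent_expand he hq v]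
  simp [map_sum, mul_comm]

theorem dFun_eq {e : Chart n Q} (he : e ∈ IsManifold.maximalAtlas (𝓡 n) ∞ Q) {q : Q}
    (hq : q ∈ e.source) {g : Q → ℝ} (hg : DifferentiableAt ℝ (g ∘ e.symm) (e q)) :
    dFun g q = (fderiv ℝ (g ∘ e.symm) (e q)).comp (dChart e q) := by
  have h1 : g =ᶠ[nhds q] (g ∘ e.symm) ∘ e := by
    filter_upwards [e.open_source.mem_nhds hq] with x hx
    simp [e.left_inv hx]
  have h2 := mfderiv_comp q (I := 𝓡 n) (I' := 𝓘(ℝ, EuclideanSpace ℝ (Fin n))) (I'' := 𝓘(ℝ, ℝ))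
    hg.mdifferentiableAt ((chart_mdifferentiable he).mdifferentiableAt hq)
  rw [dFun, h1.mfderiv_eq, h2, mfderiv_eq_fderiv]
  rfl

theorem dFun_frame {e : Chart n Q} (he : e ∈ IsManifold.maximalAtlas (𝓡 n) ∞ Q) {q : Q}
    (hq : q ∈ e.source) {g : Q → ℝ} (hg : DifferentiableAt ℝ (g ∘ e.symm) (e q)) (i : Fin n) :
    dFun g q (frame e q i) = partialD i (g ∘ e.symm) (e q) := by
  rw [dFun_eq he hq hg, ContinuousLinearMap.comp_apply, dChart_frame he hq]
  rfl

theorem contDiffAt_transition {e e' : Chart n Q} (he : e ∈ IsManifold.maximalAtlas (𝓡 n) ∞ Q)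
    (he' : e' ∈ IsManifold.maximalAtlas (𝓡 n) ∞ Q) {q : Q} (hq : q ∈ e.source)
    (hq' : q ∈ e'.source) : ContDiffAt ℝ ∞ (e' ∘ e.symm) (e q) := by
  have h1 := contMDiffAt_symm_of_mem_maximalAtlas he (e.map_source hq)
  have h2 := contMDiffAt_of_mem_maximalAtlas (x := e.symm (e q)) he' (by rwa [e.left_inv hq])
  exact (h2.comp (e q) h1).contDiffAt

theorem contDiffAt_transition_coord {e e' : Chart n Q}
    (he : e ∈ IsManifold.maximalAtlas (𝓡 n) ∞ Q) (he' : e' ∈ IsManifold.maximalAtlas (𝓡 n) ∞ Q)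
    {q : Q} (hq : q ∈ e.source) (hq' : q ∈ e'.source) (i : Fin n) :
    ContDiffAt ℝ ∞ (fun y => (e' (e.symm y)) i) (e q) :=
  ContDiffAt.comp (e q) (g := (EuclideanSpace.proj i : Coord n →L[ℝ] ℝ))
    (EuclideanSpace.proj i : Coord n →L[ℝ] ℝ).contDiff.contDiffAt
    (contDiffAt_transition he he' hq hq')

theorem eventually_mem_source {e e' : Chart n Q} {q : Q} (hq : q ∈ e.source) (hq' : q ∈ e'.source) :
    ∀ᶠ y in nhds (e q), y ∈ e.target ∧ e.symm y ∈ e'.source := by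
  have h := e.continuousAt_symm (e.map_source hq)
  filter_upwards [e.open_target.mem_nhds (e.map_source hq),
    h.preimage_mem_nhds (e'.open_source.mem_nhds (by rwa [e.left_inv hq]))] with y h1 h2
  exact ⟨h1, h2⟩

theorem coframe_eq_dFun {e : Chart n Q} (he : e ∈ IsManifold.maximalAtlas (𝓡 n) ∞ Q) {q : Q}
    (hq : q ∈ e.source) (i : Fin n) : coframe e q i = dFun (fun x => e x i) q := by
  have hee : ((fun x => e x i) ∘ e.symm) =ᶠ[nhds (e q)] fun y => y i := by
    filter_upwards [e.open_target.mem_nhds (e.map_source hq)] with y hy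
    simp [e.right_inv hy]
  have hd : HasFDerivAt (fun y : Coord n => y i)
      (EuclideanSpace.proj i : Coord n →L[ℝ] ℝ) (e q) :=
    (EuclideanSpace.proj i : Coord n →L[ℝ] ℝ).hasFDerivAt
  rw [dFun_eq he hq (hee.differentiableAt_iff.2 hd.differentiableAt), hee.fderiv_eq, hd.fderiv]
  rfl

/-- The Jacobian matrix of a change of charts. -/
theorem coframe_frame_transition {e e' : Chart n Q}
    (he : e ∈ IsManifold.maximalAtlas (𝓡 n) ∞ Q) (he' : e' ∈ IsManifold.maximalAtlas (𝓡 n) ∞ Q)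
    {q : Q} (hq : q ∈ e.source) (hq' : q ∈ e'.source) (i j : Fin n) :
    coframe e' q i (frame e q j) = partialD j (fun y => (e' (e.symm y)) i) (e q) := by
  rw [coframe_eq_dFun he' hq', dFun_frame he hq]
  · rfl
  · exact (contDiffAt_transition_coord he he' hq hq' i).differentiableAt (by norm_num)

theorem contDiffAt_partialD {f : Coord n → ℝ} {y : Coord n} {m k : WithTop ℕ∞}
    (hf : ContDiffAt ℝ k f y) (hmk : m + 1 ≤ k) (i : Fin n) :
    ContDiffAt ℝ m (partialD i f) y :=
  (hf.fderiv_right hmk).clm_apply contDiffAt_const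

theorem contDiffAt_coframe_frame {e e' : Chart n Q}
    (he : e ∈ IsManifold.maximalAtlas (𝓡 n) ∞ Q) (he' : e' ∈ IsManifold.maximalAtlas (𝓡 n) ∞ Q)
    {q : Q} (hq : q ∈ e.source) (hq' : q ∈ e'.source) (i j : Fin n) :
    ContDiffAt ℝ ∞ (fun y => coframe e' (e.symm y) i (frame e (e.symm y) j)) (e q) := by
  have h : ContDiffAt ℝ ∞ (partialD j (fun y => (e' (e.symm y)) i)) (e q) :=
    contDiffAt_partialD (contDiffAt_transition_coord he he' hq hq' i) (by simp) j
  refine h.congr_of_eventuallyEq ?_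
  filter_upwards [eventually_mem_source hq hq'] with y hy
  rw [coframe_frame_transition he he' (e.map_target hy.1) hy.2, e.right_inv hy.1]

/-! ### Components of tensors -/

theorem contraComp_apply {e : Chart n Q} {q : Q} (hq : q ∈ e.source) {k : ℕ} (X : RawContra n Q k)
    (I : Fin k → Fin n) : contraComp e X I (e q) = X q (fun j => coframe e q (I j)) :=
  congrArg (fun x => X x (fun j => coframe e x (I j))) (e.left_inv hq)

theorem coComp_apply {e : Chart n Q} {q : Q} (hq : q ∈ e.source) {k : ℕ} (A : RawCo n Q k)
    (I : Fin k → Fin n) : coComp e A I (e q) = A q (fun j => frame e q (I j)) :=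
  congrArg (fun x => A x (fun j => frame e x (I j))) (e.left_inv hq)

theorem contra_expand {e : Chart n Q} (he : e ∈ IsManifold.maximalAtlas (𝓡 n) ∞ Q) {q : Q}
    (hq : q ∈ e.source) {k : ℕ} (X : RawContra n Q k) (α : Fin k → Cotangent n q) :
    X q α = ∑ I, contraComp e X I (e q) * ∏ j, α j (frame e q (I j)) := by
  have h := multilinear_expand (X q) (coframe e q) (fun j i => α j (frame e q i))
  simp_rw [← cotangent_expand he hq] at h
  simp_rw [contraComp_apply hq]
  exact h

theorem co_expand {e : Chart n Q} (he : e ∈ IsManifold.maximalAtlas (𝓡 n) ∞ Q) {q : Q}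
    (hq : q ∈ e.source) {k : ℕ} (A : RawCo n Q k) (v : Fin k → TangentSpace (𝓡 n) q) :
    A q v = ∑ I, coComp e A I (e q) * ∏ j, coframe e q (I j) (v j) := by
  have h := multilinear_expand (A q) (frame e q) (fun j i => coframe e q i (v j))
  simp_rw [← tangent_expand he hq] at h
  simp_rw [coComp_apply hq]
  exact h

theorem contra_ext {e : Chart n Q} (he : e ∈ IsManifold.maximalAtlas (𝓡 n) ∞ Q) {q : Q}
    (hq : q ∈ e.source) {k : ℕ} {X Y : RawContra n Q k}
    (h : ∀ I, contraComp e X I (e q) = contraComp e Y I (e q)) : X q = Y q := by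
  ext α
  rw [contra_expand he hq X, contra_expand he hq Y]
  simp_rw [h]

theorem co_ext {e : Chart n Q} (he : e ∈ IsManifold.maximalAtlas (𝓡 n) ∞ Q) {q : Q}
    (hq : q ∈ e.source) {k : ℕ} {A B : RawCo n Q k}
    (h : ∀ I, coComp e A I (e q) = coComp e B I (e q)) : A q = B q := by
  ext v
  rw [co_expand he hq A, co_expand he hq B]
  simp_rw [h]

/-- Smoothness of the components in one chart around each point implies smoothness of the
components in all charts. -/
theorem contDiffOn_contraComp_of_local {k : ℕ} {X : RawContra n Q k}
    (h : ∀ q, ∃ e ∈ IsManifold.maximalAtlas (𝓡 n) ∞ Q, q ∈ e.source ∧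
      ∀ I, ContDiffAt ℝ ∞ (contraComp e X I) (e q)) {e' : Chart n Q}
    (he' : e' ∈ IsManifold.maximalAtlas (𝓡 n) ∞ Q) (I' : Fin k → Fin n) :
    ContDiffOn ℝ ∞ (contraComp e' X I') e'.target := by
  intro y hy
  obtain ⟨q, hq', rfl⟩ : ∃ q ∈ e'.source, e' q = y := ⟨e'.symm y, e'.map_target hy, e'.right_inv hy⟩
  obtain ⟨e, he, hq, hX⟩ := h q
  apply ContDiffAt.contDiffWithinAt
  have h1 : ContDiffAt ℝ ∞ (fun y => ∑ I, contraComp e X I ((e ∘ e'.symm) y) *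
      ∏ j, coframe e' (e.symm ((e ∘ e'.symm) y)) (I' j) (frame e (e.symm ((e ∘ e'.symm) y)) (I j)))
      (e' q) := by
    have ht := contDiffAt_transition he' he hq' hq
    have hte : (e ∘ e'.symm) (e' q) = e q := by simp [e'.left_inv hq']
    refine ContDiffAt.sum fun I _ => ContDiffAt.mul ?_ (contDiffAt_prod fun j _ => ?_)
    · exact ContDiffAt.comp (e' q) (by rw [hte]; exact hX I) ht
    · exact ContDiffAt.comp (e' q) (g := fun z => coframe e' (e.symm z) (I' j) (frame e (e.symm z) (I j)))
        (by rw [hte]; exact contDiffAt_coframe_frame he he' hq hq' _ _) ht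
  refine h1.congr_of_eventuallyEq ?_
  filter_upwards [eventually_mem_source hq' hq] with y hy
  have h2 : ∀ i j, coframe e' (e.symm ((e ∘ e'.symm) y)) i (frame e (e.symm ((e ∘ e'.symm) y)) j) =
      coframe e' (e'.symm y) i (frame e (e'.symm y) j) := fun i j =>
    congrArg (fun x => coframe e' x i (frame e x j)) (e.left_inv hy.2)
  simp_rw [h2]
  exact contra_expand he hy.2 X (fun j => coframe e' (e'.symm y) (I' j))

/-- Smoothness of the components in one chart around each point implies smoothness of the
components in all charts. -/
theorem contDiffOn_coComp_of_local {k : ℕ} {A : RawCo n Q k}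
    (h : ∀ q, ∃ e ∈ IsManifold.maximalAtlas (𝓡 n) ∞ Q, q ∈ e.source ∧
      ∀ I, ContDiffAt ℝ ∞ (coComp e A I) (e q)) {e' : Chart n Q}
    (he' : e' ∈ IsManifold.maximalAtlas (𝓡 n) ∞ Q) (I' : Fin k → Fin n) :
    ContDiffOn ℝ ∞ (coComp e' A I') e'.target := by
  intro y hy
  obtain ⟨q, hq', rfl⟩ : ∃ q ∈ e'.source, e' q = y := ⟨e'.symm y, e'.map_target hy, e'.right_inv hy⟩
  obtain ⟨e, he, hq, hA⟩ := h q
  apply ContDiffAt.contDiffWithinAt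
  have h1 : ContDiffAt ℝ ∞ (fun y => ∑ I, coComp e A I ((e ∘ e'.symm) y) *
      ∏ j, coframe e (e'.symm y) (I j) (frame e' (e'.symm y) (I' j))) (e' q) := by
    have ht := contDiffAt_transition he' he hq' hq
    have hte : (e ∘ e'.symm) (e' q) = e q := by simp [e'.left_inv hq']
    refine ContDiffAt.sum fun I _ => ContDiffAt.mul ?_ (contDiffAt_prod fun j _ => ?_)
    · exact ContDiffAt.comp (e' q) (by rw [hte]; exact hA I) ht
    · exact contDiffAt_coframe_frame he' he hq' hq _ _
  refine h1.congr_of_eventuallyEq ?_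
  filter_upwards [eventually_mem_source hq' hq] with y hy
  exact co_expand he hy.2 A (fun j => frame e' (e'.symm y) (I' j))

/-- The full contraction may be computed in any chart. -/
theorem fullContraction_eq {e : Chart n Q} (he : e ∈ IsManifold.maximalAtlas (𝓡 n) ∞ Q) {q : Q}
    (hq : q ∈ e.source) {k : ℕ} (A : RawCo n Q k) (X : RawContra n Q k) :
    fullContraction A X q = ∑ I, coComp e A I (e q) * contraComp e X I (e q) := by
  have he0 := IsManifold.chart_mem_maximalAtlas (I := 𝓡 n) (n := ∞) q
  have hq0 := mem_chart_source (EuclideanSpace ℝ (Fin n)) q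
  set e0 := chartAt (EuclideanSpace ℝ (Fin n)) q
  have h1 : ∀ J, contraComp e X J (e q) =
      ∑ I : Fin k → Fin n, X q (fun j => coframe e0 q (I j)) *
        ∏ j, coframe e q (J j) (frame e0 q (I j)) := by
    intro J
    have := contra_expand he0 hq0 X (fun j => coframe e q (J j))
    simp_rw [contraComp_apply hq0] at this
    rw [contraComp_apply hq, this]
  have h2 : ∀ I : Fin k → Fin n, A q (fun j => frame e0 q (I j)) =
      ∑ J, coComp e A J (e q) * ∏ j, coframe e q (J j) (frame e0 q (I j)) :=
    fun I => co_expand he hq A _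
  simp only [fullContraction]
  simp_rw [h1, Finset.mul_sum]
  rw [Finset.sum_comm]
  refine Finset.sum_congr rfl fun I _ => ?_
  rw [h2, Finset.sum_mul]
  exact Finset.sum_congr rfl fun J _ => by ring

/-- The covariant tensor at `q` with components `c` in the chart `e`. -/
def coOfComponents (e : Chart n Q) (q : Q) {r : ℕ} (c : (Fin r → Fin n) → ℝ) :
    MultilinearMap ℝ (fun _ : Fin r => TangentSpace (𝓡 n) q) ℝ :=
  ∑ I : Fin r → Fin n, c I • (MultilinearMap.mkPiAlgebra ℝ (Fin r) ℝ).compLinearMap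
    (fun j => (coframe e q (I j)).toLinearMap)

theorem coOfComponents_apply (e : Chart n Q) (q : Q) {r : ℕ} (c : (Fin r → Fin n) → ℝ)
    (v : Fin r → TangentSpace (𝓡 n) q) :
    coOfComponents e q c v = ∑ I, c I * ∏ j, coframe e q (I j) (v j) := by
  simp [coOfComponents]

theorem ofComponents_apply (e : Chart n Q) (q : Q) {r : ℕ} (c : (Fin r → Fin n) → ℝ)
    (α : Fin r → Cotangent n q) :
    ofComponents e q c α = ∑ I, c I * ∏ j, α j (frame e q (I j)) := by
  simp [ofComponents]

theorem prod_delta {r : ℕ} (I J : Fin r → Fin n) :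
    ∏ j, (if I j = J j then (1 : ℝ) else 0) = if I = J then 1 else 0 := by
  rw [Finset.prod_ite_zero]
  simp [funext_iff]

theorem ofComponents_coframe {e : Chart n Q} (he : e ∈ IsManifold.maximalAtlas (𝓡 n) ∞ Q) {q : Q}
    (hq : q ∈ e.source) {r : ℕ} (c : (Fin r → Fin n) → ℝ) (I : Fin r → Fin n) :
    ofComponents e q c (fun j => coframe e q (I j)) = c I := by
  simp_rw [ofComponents_apply, coframe_frame he hq, prod_delta]
  simp

theorem coOfComponents_frame {e : Chart n Q} (he : e ∈ IsManifold.maximalAtlas (𝓡 n) ∞ Q) {q : Q}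
    (hq : q ∈ e.source) {r : ℕ} (c : (Fin r → Fin n) → ℝ) (I : Fin r → Fin n) :
    coOfComponents e q c (fun j => frame e q (I j)) = c I := by
  simp_rw [coOfComponents_apply, coframe_frame he hq, prod_delta]
  simp

theorem ofComponents_symm (e : Chart n Q) (q : Q) {r : ℕ} {c : (Fin r → Fin n) → ℝ}
    (hc : IsSymm c) (π : Equiv.Perm (Fin r)) (α : Fin r → Cotangent n q) :
    ofComponents e q c (α ∘ π) = ofComponents e q c α := by
  rw [ofComponents_apply, ofComponents_apply, ← sum_comp_perm π]
  refine Finset.sum_congr rfl fun I _ => ?_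
  rw [hc π]
  congr 1
  exact Equiv.prod_comp π (fun j => α j (frame e q (I j)))

theorem coOfComponents_symm (e : Chart n Q) (q : Q) {r : ℕ} {c : (Fin r → Fin n) → ℝ}
    (hc : IsSymm c) (π : Equiv.Perm (Fin r)) (v : Fin r → TangentSpace (𝓡 n) q) :
    coOfComponents e q c (v ∘ π) = coOfComponents e q c v := by
  rw [coOfComponents_apply, coOfComponents_apply, ← sum_comp_perm π]
  refine Finset.sum_congr rfl fun I _ => ?_
  rw [hc π]
  congr 1
  exact Equiv.prod_comp π (fun j => coframe e q (I j) (v j))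

theorem isSymm_contraComp (e : Chart n Q) {k : ℕ} (X : Contra n Q k) (y : Coord n) :
    IsSymm (fun I => contraComp e X.1 I y) :=
  fun π I => X.2.1 (e.symm y) π (fun j => coframe e (e.symm y) (I j))

theorem isSymm_coComp (e : Chart n Q) {k : ℕ} (A : Co n Q k) (y : Coord n) :
    IsSymm (fun I => coComp e A.1 I y) :=
  fun π I => A.2.1 (e.symm y) π (fun j => frame e (e.symm y) (I j))

end SymTensor
end

noncomputable section
namespace SymTensor

/-! ### The Schouten concomitant is independent of the chart -/

variable {n : ℕ}

/-- The partial derivative in the momentum `p_ℓ` of the polynomial `X^{i_1 … i_k} p_{i_1} … p_{i_k}`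
attached to a symmetric `X`. -/
def velC : {k : ℕ} → Comp n k → (Fin n → ℝ) → Fin n → Coord n → ℝ
  | 0, _, _, _, _ => 0
  | a + 1, X, p, ℓ, y => ((a + 1 : ℕ) : ℝ) *
      ∑ J : Fin a → Fin n, X (Fin.snoc (α := fun _ => Fin n) J ℓ) y * ∏ j, p (J j)

theorem sum_transportC_mul_prod {k m r : ℕ} (h : k + m = r + 1) (X : Comp n k) (Y : Comp n m)
    (p : Fin n → ℝ) (y : Coord n) :
    ∑ I, transportC r X Y I y * ∏ j, p (I j) =
      ∑ ℓ, velC X p ℓ y * ∑ I, partialD ℓ (Y I) y * ∏ j, p (I j) := by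
  cases k with
  | zero => simp [transportC, velC]
  | succ a =>
    obtain rfl : r = m + a := by omega
    simp only [transportC, velC, Fin.cast_eq_self, dite_true]
    rw [sum_append]
    simp only [Fin.append_left, Fin.append_right, Fin.prod_univ_add, Finset.mul_sum, Finset.sum_mul]
    rw [Finset.sum_comm]
    simp_rw [Finset.sum_comm (s := (Finset.univ : Finset (Fin m → Fin n)))]
    rw [Finset.sum_comm]
    refine Finset.sum_congr rfl fun ℓ _ => ?_
    exact Finset.sum_congr rfl fun I _ => Finset.sum_congr rfl fun J _ => by ring

theorem prod_erase_mul_eq {r : ℕ} (j : Fin r) (g : Fin r → ℝ) (d : ℝ) :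
    (∏ i ∈ Finset.univ.erase j, g i) * d = ∏ i, if i = j then d else g i := by
  rw [← Finset.prod_erase_mul _ _ (Finset.mem_univ j), if_pos rfl]
  congr 1
  exact Finset.prod_congr rfl fun i hi => by rw [if_neg (Finset.ne_of_mem_erase hi)]

/-- Replacing the factor `p` in one position by `d`: by symmetry the position may be taken last. -/
theorem sum_symm_mul_update {k : ℕ} {c : (Fin (k + 1) → Fin n) → ℝ} (hc : IsSymm c)
    (p d : Fin n → ℝ) (j : Fin (k + 1)) :
    ∑ I, c I * ∏ i, (if i = j then d (I j) else p (I i)) =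
      ∑ ℓ, (∑ J : Fin k → Fin n, c (Fin.snoc (α := fun _ => Fin n) J ℓ) * ∏ i, p (J i)) * d ℓ := by
  have h1 : ∑ I, c I * ∏ i, (if i = j then d (I j) else p (I i)) =
      ∑ I, c I * ∏ i, (if i = Fin.last k then d (I (Fin.last k)) else p (I i)) := by
    rw [← sum_comp_perm (Equiv.swap j (Fin.last k))]
    refine Finset.sum_congr rfl fun I _ => ?_
    rw [hc]
    congr 1
    rw [← Equiv.prod_comp (Equiv.swap j (Fin.last k))]
    refine Finset.prod_congr rfl fun i _ => ?_
    simp only [Function.comp_apply, Equiv.swap_apply_self, Equiv.swap_apply_left]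
    congr 1
    rw [eq_iff_iff, Equiv.swap_apply_eq_iff, Equiv.swap_apply_left]
  rw [h1, sum_snoc, Finset.sum_comm]
  refine Finset.sum_congr rfl fun ℓ _ => ?_
  rw [Finset.sum_mul]
  refine Finset.sum_congr rfl fun J _ => ?_
  rw [Fin.prod_univ_castSucc]
  simp [(Fin.castSucc_lt_last _).ne, mul_assoc]

theorem differentiableAt_and_partialD_prod {k : ℕ} {p : Fin n → Coord n → ℝ} {y : Coord n}
    (hp : ∀ i, DifferentiableAt ℝ (p i) y) (I : Fin k → Fin n) (ℓ : Fin n) :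
    DifferentiableAt ℝ (fun z => ∏ j, p (I j) z) y ∧
    partialD ℓ (fun z => ∏ j, p (I j) z) y =
      ∑ j, ∏ i, if i = j then partialD ℓ (p (I j)) y else p (I i) y := by
  have h := HasFDerivAt.finsetProd (u := Finset.univ) (g := fun j => p (I j))
    (fun j _ => (hp (I j)).hasFDerivAt)
  refine ⟨h.differentiableAt, ?_⟩
  rw [partialD, h.fderiv]
  simp only [sum_apply, smul_apply, smul_eq_mul]
  exact Finset.sum_congr rfl fun j _ => prod_erase_mul_eq j _ _

theorem partialD_sum {ι : Type*} (s : Finset ι) {f : ι → Coord n → ℝ} {y : Coord n}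
    (hf : ∀ i ∈ s, DifferentiableAt ℝ (f i) y) (ℓ : Fin n) :
    partialD ℓ (fun z => ∑ i ∈ s, f i z) y = ∑ i ∈ s, partialD ℓ (f i) y := by
  simp only [partialD]
  rw [fderiv_fun_sum hf, sum_apply]

theorem partialD_mul {f g : Coord n → ℝ} {y : Coord n} (hf : DifferentiableAt ℝ f y)
    (hg : DifferentiableAt ℝ g y) (ℓ : Fin n) :
    partialD ℓ (fun z => f z * g z) y = f y * partialD ℓ g y + g y * partialD ℓ f y := by
  simp only [partialD]
  rw [fderiv_fun_mul hf hg]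
  simp

/-- Chain rule for the polynomial of a symmetric tensor evaluated along a covector field `p`. -/
theorem partialD_sum_mul_prod {k : ℕ} {Y : Comp n k} {p : Fin n → Coord n → ℝ} {y : Coord n}
    (hY : ∀ I, DifferentiableAt ℝ (Y I) y) (hs : IsSymm (fun I => Y I y))
    (hp : ∀ i, DifferentiableAt ℝ (p i) y) (ℓ : Fin n) :
    partialD ℓ (fun z => ∑ I, Y I z * ∏ j, p (I j) z) y =
      ∑ I, partialD ℓ (Y I) y * ∏ j, p (I j) y +
        ∑ i, velC Y (fun i => p i y) i y * partialD ℓ (p i) y := by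
  rw [partialD_sum (f := fun I z => Y I z * ∏ j, p (I j) z) _
    fun I _ => (hY I).mul (differentiableAt_and_partialD_prod hp I ℓ).1]
  have h1 : ∀ I, partialD ℓ (fun z => Y I z * ∏ j, p (I j) z) y =
      partialD ℓ (Y I) y * ∏ j, p (I j) y +
        ∑ j, Y I y * ∏ i, if i = j then partialD ℓ (p (I j)) y else p (I i) y := fun I => by
    rw [partialD_mul (hY I) (differentiableAt_and_partialD_prod hp I ℓ).1, (differentiableAt_and_partialD_prod hp I ℓ).2,
      Finset.mul_sum]
    ring
  simp_rw [h1, Finset.sum_add_distrib]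
  congr 1
  rw [Finset.sum_comm]
  cases k with
  | zero => simp [velC]
  | succ a =>
    simp_rw [fun j => sum_symm_mul_update hs (fun i => p i y) (fun i => partialD ℓ (p i) y) j]
    rw [Finset.sum_const, Finset.card_univ, Fintype.card_fin, nsmul_eq_mul, Finset.mul_sum]
    exact Finset.sum_congr rfl fun i _ => by simp only [velC]; ring

theorem partialD_partialD_comm {u : Coord n → ℝ} {y : Coord n} (hu : ContDiffAt ℝ 2 u y)
    (i j : Fin n) : partialD i (partialD j u) y = partialD j (partialD i u) y := by
  have hs := hu.isSymmSndFDerivAt (by simp)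
  have hd : DifferentiableAt ℝ (fderiv ℝ u) y :=
    (hu.fderiv_right (m := 1) (by norm_num)).differentiableAt (by norm_num)
  have h : ∀ a b : Fin n, partialD a (partialD b u) y =
      fderiv ℝ (fderiv ℝ u) y (EuclideanSpace.single a 1) (EuclideanSpace.single b 1) := fun a b => by
    have h3 : partialD b u = fun z => fderiv ℝ u z (EuclideanSpace.single b 1) := rfl
    rw [h3, partialD, fderiv_clm_apply hd (differentiableAt_const _)]
    simp
  rw [h, h, hs.eq]

variable {Q : Type*} [TopologicalSpace Q] [ChartedSpace (EuclideanSpace ℝ (Fin n)) Q]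
  [IsManifold (𝓡 n) ∞ Q]

/-- The derivative of `α ↦ X(α, …, α)` in the direction `β`, for symmetric `X`. -/
def vel {V : Type*} [AddCommGroup V] [Module ℝ V] : {k : ℕ} →
    MultilinearMap ℝ (fun _ : Fin k => V) ℝ → V → V → ℝ
  | 0, _, _, _ => 0
  | a + 1, X, α, β => ((a + 1 : ℕ) : ℝ) * X (Fin.snoc (α := fun _ => V) (fun _ => α) β)

theorem vel_eq {e : Chart n Q} (he : e ∈ IsManifold.maximalAtlas (𝓡 n) ∞ Q) {q : Q}
    (hq : q ∈ e.source) {k : ℕ} (X : RawContra n Q k) (α β : Cotangent n q) :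
    vel (X q) α β =
      ∑ ℓ, velC (contraComp e X) (fun i => α (frame e q i)) ℓ (e q) * β (frame e q ℓ) := by
  cases k with
  | zero => simp [vel, velC]
  | succ a =>
    simp only [vel, velC]
    rw [contra_expand he hq X, sum_snoc, Finset.sum_comm, Finset.mul_sum]
    refine Finset.sum_congr rfl fun ℓ _ => ?_
    rw [mul_assoc, Finset.sum_mul]
    congr 1
    refine Finset.sum_congr rfl fun J _ => ?_
    rw [Fin.prod_univ_castSucc]
    simp [mul_assoc]

/-- The function `X(du, …, du)`. -/
def alongDiff {k : ℕ} (X : RawContra n Q k) (u : Q → ℝ) (q : Q) : ℝ := X q (fun _ => dFun u q)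

theorem alongDiff_eventuallyEq {e : Chart n Q} (he : e ∈ IsManifold.maximalAtlas (𝓡 n) ∞ Q) {q : Q}
    (hq : q ∈ e.source) {k : ℕ} (X : RawContra n Q k) {u : Q → ℝ}
    (hu : ContDiffAt ℝ 2 (u ∘ e.symm) (e q)) :
    alongDiff X u ∘ e.symm =ᶠ[nhds (e q)]
      fun z => ∑ I, contraComp e X I z * ∏ j, partialD (I j) (u ∘ e.symm) z := by
  filter_upwards [e.open_target.mem_nhds (e.map_source hq), hu.eventually (by norm_num)] with z hz huz
  rw [Function.comp_apply, alongDiff, contra_expand he (e.map_target hz)]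
  refine Finset.sum_congr rfl fun I _ => ?_
  rw [e.right_inv hz]
  congr 1
  refine Finset.prod_congr rfl fun j _ => ?_
  rw [dFun_frame he (e.map_target hz) (by
    rw [e.right_inv hz]; exact huz.differentiableAt (by norm_num)), e.right_inv hz]

theorem contraComp_differentiableAt {e : Chart n Q} (he : e ∈ IsManifold.maximalAtlas (𝓡 n) ∞ Q)
    {y : Coord n} (hy : y ∈ e.target) {k : ℕ} (X : Contra n Q k) (I : Fin k → Fin n) :
    DifferentiableAt ℝ (contraComp e X.1 I) y :=
  ((X.2.2 e he I).contDiffAt (e.open_target.mem_nhds hy)).differentiableAt (by norm_num)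

theorem dFun_alongDiff_frame {e : Chart n Q} (he : e ∈ IsManifold.maximalAtlas (𝓡 n) ∞ Q) {q : Q}
    (hq : q ∈ e.source) {k : ℕ} (X : Contra n Q k) {u : Q → ℝ}
    (hu : ContDiffAt ℝ 2 (u ∘ e.symm) (e q)) (ℓ : Fin n) :
    dFun (alongDiff X.1 u) q (frame e q ℓ) =
      ∑ I, partialD ℓ (contraComp e X.1 I) (e q) * ∏ j, partialD (I j) (u ∘ e.symm) (e q) +
        ∑ i, velC (contraComp e X.1) (fun i => partialD i (u ∘ e.symm) (e q)) i (e q) *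
          partialD ℓ (partialD i (u ∘ e.symm)) (e q) := by
  have hX := contraComp_differentiableAt he (e.map_source hq) X
  have hp : ∀ i, DifferentiableAt ℝ (partialD i (u ∘ e.symm)) (e q) := fun i =>
    (contDiffAt_partialD (m := 1) hu (by norm_num) i).differentiableAt (by norm_num)
  have hev := alongDiff_eventuallyEq he hq X.1 hu
  have hd : DifferentiableAt ℝ (alongDiff X.1 u ∘ e.symm) (e q) := by
    rw [hev.differentiableAt_iff]
    exact DifferentiableAt.fun_sum fun I _ => (hX I).mul (differentiableAt_and_partialD_prod hp I ℓ).1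
  rw [dFun_frame he hq hd, partialD, hev.fderiv_eq]
  exact partialD_sum_mul_prod hX (isSymm_contraComp e X _) hp ℓ

/-- On the differential of a function `u`, the Schouten concomitant is
`[X, Y](du, …, du) = k X(du, …, du, d(Y(du, …, du))) - m Y(du, …, du, d(X(du, …, du)))`: the second
derivatives of `u` cancel because the Hessian is symmetric. The right-hand side does not involve the
chart. -/
theorem schoutenC_along_diff {e : Chart n Q} (he : e ∈ IsManifold.maximalAtlas (𝓡 n) ∞ Q) {q : Q}
    (hq : q ∈ e.source) {k m r : ℕ} (h : k + m = r + 1) (X : Contra n Q k) (Y : Contra n Q m)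
    {u : Q → ℝ} (hu : ContDiffAt ℝ 2 (u ∘ e.symm) (e q)) :
    ofComponents e q (fun I => schoutenC r (contraComp e X.1) (contraComp e Y.1) I (e q))
        (fun _ => dFun u q) =
      vel (X.1 q) (dFun u q) (dFun (alongDiff Y.1 u) q) -
        vel (Y.1 q) (dFun u q) (dFun (alongDiff X.1 u) q) := by
  have hdu : ∀ i, dFun u q (frame e q i) = partialD i (u ∘ e.symm) (e q) :=
    dFun_frame he hq (hu.differentiableAt (by norm_num))
  set p : Fin n → ℝ := fun i => partialD i (u ∘ e.symm) (e q) with hp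
  rw [vel_eq he hq, vel_eq he hq, ofComponents_apply]
  simp_rw [dFun_alongDiff_frame he hq _ hu, hdu]
  simp only [schoutenC]
  simp_rw [mul_comm (symmetrize _ _ _)]
  rw [sum_mul_symmetrize _ _ _ (isSymm_prod p)]
  simp_rw [mul_sub, mul_comm (∏ j, p _), Finset.sum_sub_distrib]
  rw [sum_transportC_mul_prod h, sum_transportC_mul_prod (by omega)]
  simp_rw [mul_add, Finset.sum_add_distrib]
  -- the terms with second derivatives of `u` agree, hence cancel in the difference
  have hH : ∑ ℓ, velC (contraComp e X.1) p ℓ (e q) *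
        ∑ i, velC (contraComp e Y.1) p i (e q) * partialD ℓ (partialD i (u ∘ e.symm)) (e q) =
      ∑ ℓ, velC (contraComp e Y.1) p ℓ (e q) *
        ∑ i, velC (contraComp e X.1) p i (e q) * partialD ℓ (partialD i (u ∘ e.symm)) (e q) := by
    simp_rw [Finset.mul_sum]
    rw [Finset.sum_comm]
    refine Finset.sum_congr rfl fun i _ => Finset.sum_congr rfl fun ℓ _ => ?_
    rw [partialD_partialD_comm hu]
    ring
  rw [hH]
  ring

theorem isSymm_schoutenC {k m r : ℕ} (X : Comp n k) (Y : Comp n m) (y : Coord n) :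
    IsSymm (fun I : Fin r → Fin n => schoutenC r X Y I y) := isSymm_symmetrize _ _

/-- The Schouten components in two charts are components of the same tensor. -/
theorem schoutenC_tensor_eq {e e' : Chart n Q} (he : e ∈ IsManifold.maximalAtlas (𝓡 n) ∞ Q)
    (he' : e' ∈ IsManifold.maximalAtlas (𝓡 n) ∞ Q) {q : Q}
    (hq : q ∈ e.source) (hq' : q ∈ e'.source) {k m r : ℕ} (h : k + m = r + 1) (X : Contra n Q k)
    (Y : Contra n Q m) :
    ofComponents e q (fun I => schoutenC r (contraComp e X.1) (contraComp e Y.1) I (e q)) =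
      ofComponents e' q (fun I => schoutenC r (contraComp e' X.1) (contraComp e' Y.1) I (e' q)) := by
  rw [← sub_eq_zero]
  apply eq_zero_of_diagonal
  · intro π v
    rw [sub_apply, sub_apply,
      ofComponents_symm e q (isSymm_schoutenC _ _ _), ofComponents_symm e' q (isSymm_schoutenC _ _ _)]
  · intro α
    rw [sub_apply, sub_eq_zero]
    -- a function with differential `α` at `q`, linear in the chart `e`
    set u : Q → ℝ := fun x => ∑ i, α (frame e q i) * e x i with hu
    have hue : ∀ {c : Chart n Q}, c ∈ IsManifold.maximalAtlas (𝓡 n) ∞ Q → q ∈ c.source →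
        ContDiffAt ℝ 2 (u ∘ c.symm) (c q) := fun hc hqc =>
      ContDiffAt.sum fun i _ => contDiffAt_const.mul
        ((contDiffAt_transition_coord hc he hqc hq i).of_le (by norm_cast))
    have hdu : dFun u q = α := by
      rw [cotangent_expand he hq α, cotangent_expand he hq (dFun u q)]
      refine Finset.sum_congr rfl fun j _ => ?_
      congr 1
      rw [dFun_frame he hq ((hue he hq).differentiableAt (by norm_num))]
      have h1 : u ∘ e.symm =ᶠ[nhds (e q)] fun y => ∑ i, α (frame e q i) * y i := by
        filter_upwards [e.open_target.mem_nhds (e.map_source hq)] with y hy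
        simp [hu, e.right_inv hy]
      have h2 : HasFDerivAt (fun y : Coord n => ∑ i, α (frame e q i) * y i)
          (∑ i, α (frame e q i) • (EuclideanSpace.proj i : Coord n →L[ℝ] ℝ)) (e q) :=
        HasFDerivAt.fun_sum fun i _ =>
          (EuclideanSpace.proj i : Coord n →L[ℝ] ℝ).hasFDerivAt.const_mul _
      rw [partialD, h1.fderiv_eq, h2.fderiv]
      simp
    rw [← hdu, schoutenC_along_diff he hq h X Y (hue he hq),
      schoutenC_along_diff he' hq' h X Y (hue he' hq')]

theorem rawSchouten_comp {e : Chart n Q} (he : e ∈ IsManifold.maximalAtlas (𝓡 n) ∞ Q) {k m r : ℕ}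
    (h : k + m = r + 1) (X : Contra n Q k) (Y : Contra n Q m) {y : Coord n} (hy : y ∈ e.target)
    (I : Fin r → Fin n) :
    contraComp e (rawSchouten r X.1 Y.1) I y =
      schoutenC r (contraComp e X.1) (contraComp e Y.1) I y := by
  have hq := e.map_target hy
  rw [contraComp, rawSchouten, schoutenC_tensor_eq (IsManifold.chart_mem_maximalAtlas _) he
    (mem_chart_source _ _) hq h, ofComponents_coframe he hq, e.right_inv hy]

theorem contDiffOn_partialD {T : Set (Coord n)} (hT : IsOpen T) {f : Coord n → ℝ}
    (hf : ContDiffOn ℝ ∞ f T) (ℓ : Fin n) : ContDiffOn ℝ ∞ (partialD ℓ f) T := fun y hy =>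
  (contDiffAt_partialD (hf.contDiffAt (hT.mem_nhds hy)) (by simp) ℓ).contDiffWithinAt

theorem contDiffOn_symmetrize {r : ℕ} {T : Set (Coord n)} {c : Comp n r}
    (hc : ∀ I, ContDiffOn ℝ ∞ (c I) T) (I : Fin r → Fin n) : ContDiffOn ℝ ∞ (symmetrize c I) T :=
  contDiffOn_const.mul (ContDiffOn.sum fun π _ => hc (I ∘ π))

theorem contDiffOn_transportC {k m r : ℕ} {T : Set (Coord n)} (hT : IsOpen T) {X : Comp n k}
    {Y : Comp n m} (hX : ∀ I, ContDiffOn ℝ ∞ (X I) T) (hY : ∀ I, ContDiffOn ℝ ∞ (Y I) T)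
    (I : Fin r → Fin n) : ContDiffOn ℝ ∞ (transportC r X Y I) T := by
  cases k with
  | zero => exact contDiffOn_const
  | succ a =>
    by_cases h : m + a = r
    · simp only [transportC, h, dite_true]
      exact contDiffOn_const.mul (ContDiffOn.sum fun ℓ _ =>
        (hX _).mul (contDiffOn_partialD hT (hY _) ℓ))
    · simp only [transportC, h, dite_false]
      exact contDiffOn_const

theorem contDiffOn_schoutenC {k m r : ℕ} {T : Set (Coord n)} (hT : IsOpen T) {X : Comp n k}
    {Y : Comp n m} (hX : ∀ I, ContDiffOn ℝ ∞ (X I) T) (hY : ∀ I, ContDiffOn ℝ ∞ (Y I) T)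
    (I : Fin r → Fin n) : ContDiffOn ℝ ∞ (schoutenC r X Y I) T :=
  contDiffOn_symmetrize (fun I =>
    (contDiffOn_transportC hT hX hY I).sub (contDiffOn_transportC hT hY hX I)) I

theorem rawSchouten_mem {k m r : ℕ} (h : k + m = r + 1) (X : Contra n Q k) (Y : Contra n Q m) :
    rawSchouten r X.1 Y.1 ∈ Contra n Q r :=
  ⟨fun q => ofComponents_symm _ q (isSymm_symmetrize _ _), fun e he I =>
    (contDiffOn_schoutenC e.open_target (X.2.2 e he) (Y.2.2 e he) I).congr
      fun _ hy => rawSchouten_comp he h X Y hy I⟩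

theorem schouten_comp {e : Chart n Q} (he : e ∈ IsManifold.maximalAtlas (𝓡 n) ∞ Q) {k m r : ℕ}
    (h : k + m = r + 1) (X : Contra n Q k) (Y : Contra n Q m) {y : Coord n} (hy : y ∈ e.target)
    (I : Fin r → Fin n) :
    contraComp e (schouten r X Y).1 I y =
      schoutenC r (contraComp e X.1) (contraComp e Y.1) I y := by
  rw [schouten, dif_pos (rawSchouten_mem h X Y)]
  exact rawSchouten_comp he h X Y hy I

end SymTensor
end

noncomputable section
namespace SymTensor

/-! ### Integration by parts in a chart -/

variable {n : ℕ}

theorem eventually_not_mem_compact {T K : Set (Coord n)} (hT : IsOpen T) (hK : IsCompact K)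
    {y : Coord n} (hy : y ∈ T) (hyK : y ∉ K) : ∀ᶠ z in nhds y, z ∈ T ∧ z ∉ K :=
  Filter.inter_mem (hT.mem_nhds hy) (hK.isClosed.isOpen_compl.mem_nhds hyK)

/-- Extension by zero of a smooth function on an open set that vanishes off a compact subset. -/
theorem contDiff_indicator {T K : Set (Coord n)} (hT : IsOpen T) (hK : IsCompact K) (hKT : K ⊆ T)
    {f : Coord n → ℝ} (hf : ContDiffOn ℝ ∞ f T) (h0 : ∀ y ∈ T, y ∉ K → f y = 0) :
    ContDiff ℝ ∞ (T.indicator f) ∧ HasCompactSupport (T.indicator f) ∧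
      ∀ y ∉ K, T.indicator f y = 0 := by
  have hz : ∀ y ∉ K, T.indicator f y = 0 := fun y hy => by
    by_cases hyT : y ∈ T
    · rw [Set.indicator_of_mem hyT, h0 y hyT hy]
    · exact Set.indicator_of_notMem hyT f
  refine ⟨contDiff_iff_contDiffAt.2 fun y => ?_, HasCompactSupport.intro hK hz, hz⟩
  by_cases hy : y ∈ K
  · refine (hf.contDiffAt (hT.mem_nhds (hKT hy))).congr_of_eventuallyEq ?_
    filter_upwards [hT.mem_nhds (hKT hy)] with z hz using Set.indicator_of_mem hz f
  · refine (contDiffAt_const (c := (0 : ℝ))).congr_of_eventuallyEq ?_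
    filter_upwards [hK.isClosed.isOpen_compl.mem_nhds hy] with z h using hz z h

theorem partialD_eq_zero_of_eventually {f : Coord n → ℝ} {y : Coord n}
    (h : ∀ᶠ z in nhds y, f z = 0) (ℓ : Fin n) : partialD ℓ f y = 0 := by
  have h' : f =ᶠ[nhds y] fun _ => (0 : ℝ) := h
  rw [partialD, h'.fderiv_eq]
  simp

theorem integrableOn_of_zero_off_compact {T K : Set (Coord n)} (hT : IsOpen T) (hK : IsCompact K)
    (hKT : K ⊆ T) {f : Coord n → ℝ} (hf : ContinuousOn f T) (h0 : ∀ y ∈ T, y ∉ K → f y = 0) :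
    IntegrableOn f T :=
  IntegrableOn.of_forall_sdiff_eq_zero ((hf.mono hKT).integrableOn_compact hK) hT.measurableSet
    fun y hy => h0 y hy.1 hy.2

theorem integrableOn_partialD {T K : Set (Coord n)} (hT : IsOpen T) (hK : IsCompact K)
    (hKT : K ⊆ T) {f : Coord n → ℝ} (hf : ContDiffOn ℝ ∞ f T) (h0 : ∀ y ∈ T, y ∉ K → f y = 0)
    (ℓ : Fin n) : IntegrableOn (partialD ℓ f) T := by
  refine integrableOn_of_zero_off_compact hT hK hKT (contDiffOn_partialD hT hf ℓ).continuousOn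
    fun y hy hyK => partialD_eq_zero_of_eventually ?_ ℓ
  filter_upwards [eventually_not_mem_compact hT hK hy hyK] with z hz using h0 z hz.1 hz.2

/-- The integral of a partial derivative of a compactly supported function is zero. -/
theorem setIntegral_partialD {T K : Set (Coord n)} (hT : IsOpen T) (hK : IsCompact K) (hKT : K ⊆ T)
    {f : Coord n → ℝ} (hf : ContDiffOn ℝ ∞ f T) (h0 : ∀ y ∈ T, y ∉ K → f y = 0) (ℓ : Fin n) :
    ∫ y in T, partialD ℓ f y = 0 := by
  obtain ⟨h1, h2, h3⟩ := contDiff_indicator hT hK hKT hf h0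
  set g := T.indicator f with hg
  have e1 : ∀ y ∈ T, partialD ℓ f y = partialD ℓ g y := fun y hy => by
    have : g =ᶠ[nhds y] f := by
      filter_upwards [hT.mem_nhds hy] with z hz using Set.indicator_of_mem hz f
    rw [partialD, partialD, this.fderiv_eq]
  have e2 : ∀ y ∉ T, partialD ℓ g y = 0 := fun y hy => partialD_eq_zero_of_eventually (by
    filter_upwards [hK.isClosed.isOpen_compl.mem_nhds fun h => hy (hKT h)] with z h using h3 z h) ℓ
  have hd : Continuous (partialD ℓ g) :=
    (h1.continuous_fderiv (by norm_num)).clm_apply continuous_const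
  have hdc : HasCompactSupport (partialD ℓ g) := HasCompactSupport.intro hK fun y hy =>
    partialD_eq_zero_of_eventually (by
      filter_upwards [hK.isClosed.isOpen_compl.mem_nhds hy] with z h using h3 z h) ℓ
  rw [setIntegral_congr_fun hT.measurableSet e1, setIntegral_eq_integral_of_forall_compl_eq_zero e2]
  -- integration by parts against the constant function `1`
  have h := integral_mul_fderiv_eq_neg_fderiv_mul_of_integrable (μ := (volume : Measure (Coord n)))
    (f := fun _ => (1 : ℝ)) (g := g) (v := EuclideanSpace.single ℓ 1)
    (by simp) (by
      have h4 : Integrable (partialD ℓ g) volume := hd.integrable_of_hasCompactSupport hdc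
      simp only [one_mul]
      exact h4)
    (by simpa using h1.continuous.integrable_of_hasCompactSupport h2) (by simp)
    (fun x _ => h1.differentiable (by norm_num) x)
  simpa [partialD] using h

theorem append_comp_cast_comm {k b p : ℕ} {c : (Fin p → Fin n) → ℝ} (hc : IsSymm c)
    (h1 : p = k + b) (h2 : p = b + k) (I : Fin k → Fin n) (J : Fin b → Fin n) :
    c (Fin.append I J ∘ Fin.cast h1) = c (Fin.append J I ∘ Fin.cast h2) := by
  rw [← hc ((finCongr h2).trans (finAddFlip.trans (finCongr h1.symm)))]
  congr 1
  funext i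
  obtain ⟨i, rfl⟩ := (finCongr h2.symm).surjective i
  refine Fin.addCases (fun j => ?_) (fun j => ?_) i
  · simp
  · simp

theorem cons_eq_snoc {a : ℕ} {c : (Fin (a + 1) → Fin n) → ℝ} (hc : IsSymm c) (ℓ : Fin n)
    (J : Fin a → Fin n) : c (Fin.cons (α := fun _ => Fin n) ℓ J) =
      c (Fin.snoc (α := fun _ => Fin n) J ℓ) := by
  rw [Fin.snoc_eq_cons_rotate]
  exact (hc (finRotate (a + 1)) _).symm

/-- Duality of the zeroth-order terms: `A · (Y ∂X) = (A ⋆ X) · Y`. -/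
theorem sum_mul_transportC_eq_starC {m k p : ℕ} (h : p + 1 = m + k) {A : Comp n p} {X : Comp n k}
    {Y : Comp n m} {y : Coord n} (hA : IsSymm (fun I => A I y)) (hY : IsSymm (fun I => Y I y)) :
    ∑ K, A K y * transportC p Y X K y = ∑ I, starC m A X I y * Y I y := by
  cases m with
  | zero => simp [transportC, starC]
  | succ b =>
    obtain rfl : p = k + b := by omega
    simp only [starC, mul_comm (symmetrize _ _ _)]
    rw [sum_mul_symmetrize _ _ _ hY, sum_append, sum_snoc, Finset.sum_comm]
    refine Finset.sum_congr rfl fun J _ => ?_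
    simp only [transportC, Nat.add_comm k b, dite_true, Fin.cast_eq_self, Fin.append_left,
      Fin.append_right, Fin.init_snoc, Fin.snoc_last, Finset.mul_sum]
    rw [Finset.sum_comm]
    refine Finset.sum_congr rfl fun ℓ _ => Finset.sum_congr rfl fun I _ => ?_
    have := append_comp_cast_comm hA rfl (Nat.add_comm k b) I J
    simp only [Fin.cast_refl, Function.comp_id] at this
    rw [this]
    ring

/-- The pointwise identity behind integration by parts: `w A · [Y, X]` and
`w (L_X A + div X ⌟ A) · Y` differ by a divergence. -/
theorem exists_flux {m k p : ℕ} (h : p + 1 = m + k) {T : Set (Coord n)} (hT : IsOpen T)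
    {w : Coord n → ℝ} {A : Comp n p} {X : Comp n k} {Y : Comp n m}
    (hw : ContDiffOn ℝ ∞ w T) (hw0 : ∀ y ∈ T, 0 < w y)
    (hA : ∀ I, ContDiffOn ℝ ∞ (A I) T) (hX : ∀ I, ContDiffOn ℝ ∞ (X I) T)
    (hY : ∀ I, ContDiffOn ℝ ∞ (Y I) T) (hAs : ∀ y, IsSymm (fun I => A I y))
    (hXs : ∀ y, IsSymm (fun I => X I y)) (hYs : ∀ y, IsSymm (fun I => Y I y)) :
    ∃ Φ : Fin n → Coord n → ℝ, (∀ ℓ, ContDiffOn ℝ ∞ (Φ ℓ) T) ∧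
      (∀ ℓ y, (∀ I, A I y = 0) ∨ (∀ I, Y I y = 0) → Φ ℓ y = 0) ∧
      ∀ y ∈ T, w y * ∑ K, A K y * schoutenC p Y X K y =
        w y * ∑ I, lieDivC m w X A I y * Y I y - ∑ ℓ, partialD ℓ (Φ ℓ) y := by
  have h1 : ∀ y, ∑ K, A K y * schoutenC p Y X K y =
      ∑ I, starC m A X I y * Y I y - ∑ K, A K y * transportC p X Y K y := fun y => by
    simp only [schoutenC]
    rw [sum_mul_symmetrize _ _ _ (hAs y), ← sum_mul_transportC_eq_starC h (hAs y) (hYs y),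
      ← Finset.sum_sub_distrib]
    exact Finset.sum_congr rfl fun K _ => by ring
  cases k with
  | zero =>
    refine ⟨fun _ _ => 0, fun _ => contDiffOn_const, fun _ _ _ => rfl, fun y hy => ?_⟩
    rw [h1]
    have h2 : ∀ I, lieDivC m w X A I y = starC m A X I y := fun I => by
      simp [lieDivC, lieC, astC, divC, contractC]
    simp [h2, transportC, partialD]
  | succ a =>
    obtain rfl : p = m + a := by omega
    have dX : ∀ y ∈ T, ∀ I, DifferentiableAt ℝ (X I) y := fun y hy I =>
      ((hX I).contDiffAt (hT.mem_nhds hy)).differentiableAt (by norm_num)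
    have dA : ∀ y ∈ T, ∀ I, DifferentiableAt ℝ (A I) y := fun y hy I =>
      ((hA I).contDiffAt (hT.mem_nhds hy)).differentiableAt (by norm_num)
    have dY : ∀ y ∈ T, ∀ I, DifferentiableAt ℝ (Y I) y := fun y hy I =>
      ((hY I).contDiffAt (hT.mem_nhds hy)).differentiableAt (by norm_num)
    have dw : ∀ y ∈ T, DifferentiableAt ℝ w y := fun y hy =>
      (hw.contDiffAt (hT.mem_nhds hy)).differentiableAt (by norm_num)
    -- the flux `k w X^{ℓ J} A_{I J} Y^I`, with `k = a + 1`
    refine ⟨fun ℓ z => ∑ I : Fin m → Fin n, ∑ J : Fin a → Fin n, ((a + 1 : ℕ) : ℝ) *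
      ((w z * X (Fin.cons (α := fun _ => Fin n) ℓ J) z) * (A (Fin.append I J) z * Y I z)),
      fun ℓ => ContDiffOn.sum fun I _ => ContDiffOn.sum fun J _ => contDiffOn_const.mul
        ((hw.mul (hX _)).mul ((hA _).mul (hY _))), ?_, fun y hy => ?_⟩
    · rintro ℓ y (h0 | h0) <;> simp [h0]
    · have hd : ∀ ℓ, partialD ℓ (fun z => ∑ I : Fin m → Fin n, ∑ J : Fin a → Fin n,
          ((a + 1 : ℕ) : ℝ) * ((w z * X (Fin.cons (α := fun _ => Fin n) ℓ J) z) *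
            (A (Fin.append I J) z * Y I z))) y =
          ∑ I : Fin m → Fin n, ∑ J : Fin a → Fin n, ((a + 1 : ℕ) : ℝ) *
            ((w y * X (Fin.snoc (α := fun _ => Fin n) J ℓ) y) *
              (A (Fin.append I J) y * partialD ℓ (Y I) y +
                Y I y * partialD ℓ (A (Fin.append I J)) y) +
              (A (Fin.append I J) y * Y I y) *
                partialD ℓ (fun z => w z * X (Fin.cons (α := fun _ => Fin n) ℓ J) z) y) := by
        intro ℓ
        have d1 : ∀ (I : Fin m → Fin n) (J : Fin a → Fin n), DifferentiableAt ℝ (fun z =>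
            ((w z * X (Fin.cons (α := fun _ => Fin n) ℓ J) z) *
            (A (Fin.append I J) z * Y I z))) y := fun I J =>
          ((dw y hy).mul (dX y hy _)).mul ((dA y hy _).mul (dY y hy _))
        have d2 : ∀ (I : Fin m → Fin n) (J : Fin a → Fin n), DifferentiableAt ℝ (fun z =>
            ((a + 1 : ℕ) : ℝ) * ((w z * X (Fin.cons (α := fun _ => Fin n) ℓ J) z) *
            (A (Fin.append I J) z * Y I z))) y := fun I J =>
          (differentiableAt_const _).mul (d1 I J)
        rw [partialD_sum _ fun I _ => DifferentiableAt.fun_sum fun J _ => d2 I J]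
        refine Finset.sum_congr rfl fun I _ => ?_
        rw [partialD_sum _ fun J _ => d2 I J]
        refine Finset.sum_congr rfl fun J _ => ?_
        rw [partialD_mul (differentiableAt_const _) (d1 I J),
          partialD_mul (f := fun z => w z * X (Fin.cons (α := fun _ => Fin n) ℓ J) z)
            (g := fun z => A (Fin.append I J) z * Y I z)
            ((dw y hy).mul (dX y hy _)) ((dA y hy _).mul (dY y hy _)),
          partialD_mul (dA y hy _) (dY y hy _), cons_eq_snoc (hXs y)]
        simp [partialD]
      have hL : ∀ I, lieDivC m w X A I y * Y I y = starC m A X I y * Y I y +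
          ∑ ℓ, ∑ J : Fin a → Fin n, ((a + 1 : ℕ) : ℝ) *
            (X (Fin.snoc (α := fun _ => Fin n) J ℓ) y *
              (Y I y * partialD ℓ (A (Fin.append I J)) y) + (A (Fin.append I J) y * Y I y) *
                (partialD ℓ (fun z => w z * X (Fin.cons (α := fun _ => Fin n) ℓ J) z) y / w y)) := by
        intro I
        simp only [lieDivC, lieC, astC, contractC, divC, Nat.add_sub_cancel, dite_true,
          Fin.cast_refl, Function.comp_id]
        rw [add_assoc, add_mul]
        congr 1
        rw [add_mul, Finset.sum_comm]
        simp only [mul_add, Finset.sum_add_distrib, Finset.mul_sum, Finset.sum_mul]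
        congr 1
        · exact Finset.sum_congr rfl fun ℓ _ => Finset.sum_congr rfl fun J _ => by ring
        · rw [Finset.sum_comm]
          exact Finset.sum_congr rfl fun ℓ _ => Finset.sum_congr rfl fun J _ => by ring
      have hTr : ∑ K, A K y * transportC (m + a) X Y K y =
          ∑ I : Fin m → Fin n, ∑ ℓ, ∑ J : Fin a → Fin n, ((a + 1 : ℕ) : ℝ) *
            (X (Fin.snoc (α := fun _ => Fin n) J ℓ) y *
              (A (Fin.append I J) y * partialD ℓ (Y I) y)) := by
        rw [sum_append]
        refine Finset.sum_congr rfl fun I _ => ?_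
        rw [Finset.sum_comm]
        refine Finset.sum_congr rfl fun J _ => ?_
        simp only [transportC, dite_true, Fin.cast_eq_self, Fin.append_left, Fin.append_right,
          Finset.mul_sum]
        exact Finset.sum_congr rfl fun ℓ _ => by ring
      have hwy := (hw0 y hy).ne'
      simp_rw [hd, h1, hTr, hL]
      rw [Finset.sum_comm (s := (Finset.univ : Finset (Fin n))), Finset.sum_add_distrib, mul_sub,
        mul_add, add_sub_assoc, sub_eq_add_neg]
      congr 1
      rw [neg_eq_iff_add_eq_zero, add_sub, sub_eq_zero]
      simp only [Finset.mul_sum, ← Finset.sum_add_distrib]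
      refine Finset.sum_congr rfl fun I _ => Finset.sum_congr rfl fun ℓ _ =>
        Finset.sum_congr rfl fun J _ => ?_
      field_simp
      ring

/-- Integration by parts in a chart: `⟨A, [Y, X]⟩ = ⟨L_X A + div X ⌟ A, Y⟩` when `A` or `Y` is
supported in a compact subset of the chart. -/
theorem setIntegral_schoutenC {m k p : ℕ} (h : p + 1 = m + k) {T K : Set (Coord n)} (hT : IsOpen T)
    (hK : IsCompact K) (hKT : K ⊆ T) {w : Coord n → ℝ} {A : Comp n p} {X : Comp n k} {Y : Comp n m}
    (hw : ContDiffOn ℝ ∞ w T) (hw0 : ∀ y ∈ T, 0 < w y)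
    (hA : ∀ I, ContDiffOn ℝ ∞ (A I) T) (hX : ∀ I, ContDiffOn ℝ ∞ (X I) T)
    (hY : ∀ I, ContDiffOn ℝ ∞ (Y I) T) (hAs : ∀ y, IsSymm (fun I => A I y))
    (hXs : ∀ y, IsSymm (fun I => X I y)) (hYs : ∀ y, IsSymm (fun I => Y I y))
    (h0 : (∀ y ∈ T, y ∉ K → ∀ I, A I y = 0) ∨ (∀ y ∈ T, y ∉ K → ∀ I, Y I y = 0)) :
    ∫ y in T, w y * ∑ J, A J y * schoutenC p Y X J y =
      ∫ y in T, w y * ∑ I, lieDivC m w X A I y * Y I y := by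
  obtain ⟨Φ, hΦ, hΦ0, hid⟩ := exists_flux h hT hw hw0 hA hX hY hAs hXs hYs
  have hΦK : ∀ ℓ, ∀ y ∈ T, y ∉ K → Φ ℓ y = 0 := fun ℓ y hy hyK =>
    hΦ0 ℓ y (h0.imp (fun h => h y hy hyK) (fun h => h y hy hyK))
  have hdi : IntegrableOn (fun y => ∑ ℓ, partialD ℓ (Φ ℓ) y) T :=
    integrable_finsetSum _ fun ℓ _ => integrableOn_partialD hT hK hKT (hΦ ℓ) (hΦK ℓ) ℓ
  have hd0 : ∫ y in T, ∑ ℓ, partialD ℓ (Φ ℓ) y = 0 := by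
    rw [integral_finsetSum _ fun ℓ _ => integrableOn_partialD hT hK hKT (hΦ ℓ) (hΦK ℓ) ℓ]
    exact Finset.sum_eq_zero fun ℓ _ => setIntegral_partialD hT hK hKT (hΦ ℓ) (hΦK ℓ) ℓ
  have hS : ContDiffOn ℝ ∞ (fun y => w y * ∑ J, A J y * schoutenC p Y X J y) T :=
    hw.mul (ContDiffOn.sum fun J _ => (hA J).mul (contDiffOn_schoutenC hT hY hX J))
  have hdc : ContDiffOn ℝ ∞ (fun y => ∑ ℓ, partialD ℓ (Φ ℓ) y) T :=
    ContDiffOn.sum fun ℓ _ => contDiffOn_partialD hT (hΦ ℓ) ℓ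
  have hSi : IntegrableOn (fun y => w y * ∑ J, A J y * schoutenC p Y X J y) T := by
    rcases h0 with h0 | h0
    · exact integrableOn_of_zero_off_compact hT hK hKT hS.continuousOn
        fun y hy hyK => by simp [h0 y hy hyK]
    · have hL : IntegrableOn (fun y => w y * ∑ I, lieDivC m w X A I y * Y I y) T := by
        refine integrableOn_of_zero_off_compact hT hK hKT ?_ fun y hy hyK => by simp [h0 y hy hyK]
        refine (hS.add hdc).continuousOn.congr fun y hy => ?_
        simp [hid y hy]
      refine (hL.sub hdi).congr_fun (fun y hy => ?_) hT.measurableSet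
      simp [hid y hy]
  rw [← add_zero (∫ y in T, w y * ∑ J, A J y * schoutenC p Y X J y), ← hd0, ← integral_add hSi hdi]
  exact setIntegral_congr_fun hT.measurableSet fun y hy => by simp [hid y hy]

theorem append_comp_perm {m a : ℕ} {c : (Fin (m + a) → Fin n) → ℝ} (hc : IsSymm c)
    (π : Equiv.Perm (Fin m)) (I : Fin m → Fin n) (J : Fin a → Fin n) :
    c (Fin.append (I ∘ π) J) = c (Fin.append I J) := by
  rw [← hc (finSumFinEquiv.permCongr (Equiv.sumCongr π (Equiv.refl (Fin a)))) (Fin.append I J)]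
  congr 1
  funext i
  refine Fin.addCases (fun j => ?_) (fun j => ?_) i
  · simp [Equiv.permCongr_apply]
  · simp [Equiv.permCongr_apply]

theorem isSymm_starC {m k p : ℕ} (A : Comp n p) (X : Comp n k) (y : Coord n) :
    IsSymm (fun I => starC m A X I y) := by
  cases m with
  | zero => exact fun π I => rfl
  | succ b =>
    simp only [starC]
    exact isSymm_symmetrize _ _

theorem isSymm_lieDivC {m k p : ℕ} {w : Coord n → ℝ} {A : Comp n p} {X : Comp n k} {y : Coord n}
    (hA : ∀ y, IsSymm (fun I => A I y)) : IsSymm (fun I => lieDivC m w X A I y) := by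
  intro π I
  have h2 : astC m X A (I ∘ π) y = astC m X A I y := by
    cases k with
    | zero => rfl
    | succ a =>
      simp only [astC]
      split_ifs with h
      · subst h
        have : ∀ J, A (Fin.append (I ∘ π) J) = A (Fin.append I J) := fun J =>
          funext fun z => append_comp_perm (hA z) π I J
        simp [this]
      · rfl
  have h3 : contractC m (divC w X) A (I ∘ π) y = contractC m (divC w X) A I y := by
    simp only [contractC]
    split_ifs with h
    · subst h
      have : ∀ J, A (Fin.append (I ∘ π) J) = A (Fin.append I J) := fun J =>
        funext fun z => append_comp_perm (hA z) π I J
      simp [this]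
    · rfl
  simp only [lieDivC, lieC, h2, h3, isSymm_starC A X y π I]

theorem contDiffOn_lieDivC {m k p : ℕ} {T : Set (Coord n)} (hT : IsOpen T) {w : Coord n → ℝ}
    {A : Comp n p} {X : Comp n k} (hw : ContDiffOn ℝ ∞ w T) (hw0 : ∀ y ∈ T, 0 < w y)
    (hA : ∀ I, ContDiffOn ℝ ∞ (A I) T) (hX : ∀ I, ContDiffOn ℝ ∞ (X I) T) (I : Fin m → Fin n) :
    ContDiffOn ℝ ∞ (lieDivC m w X A I) T := by
  have h1 : ContDiffOn ℝ ∞ (starC m A X I) T := by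
    cases m with
    | zero => exact contDiffOn_const
    | succ b =>
      simp only [starC]
      refine contDiffOn_symmetrize (fun I => ?_) I
      by_cases h : p = b + k
      · simp only [h, dite_true]
        exact contDiffOn_const.mul (ContDiffOn.sum fun J _ =>
          (hA _).mul (contDiffOn_partialD hT (hX _) _))
      · simp only [h, dite_false]
        exact contDiffOn_const
  have h2 : ContDiffOn ℝ ∞ (astC m X A I) T := by
    cases k with
    | zero => exact contDiffOn_const
    | succ a =>
      by_cases h : p = m + a
      · simp only [astC, h, dite_true]
        exact contDiffOn_const.mul (ContDiffOn.sum fun J _ => ContDiffOn.sum fun ℓ _ =>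
          (hX _).mul (contDiffOn_partialD hT (hA _) _))
      · simp only [astC, h, dite_false]
        exact contDiffOn_const
  have h3 : ∀ J, ContDiffOn ℝ ∞ (divC w X J) T := by
    intro J
    cases k with
    | zero => exact contDiffOn_const
    | succ a =>
      exact contDiffOn_const.mul (ContDiffOn.sum fun ℓ _ =>
        (contDiffOn_partialD hT (hw.mul (hX _)) ℓ).div hw fun y hy => (hw0 y hy).ne')
  have h4 : ContDiffOn ℝ ∞ (contractC m (divC w X) A I) T := by
    change ContDiffOn ℝ ∞ (fun y => contractC m (divC w X) A I y) T
    by_cases h : p = m + (k - 1)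
    · simp only [contractC, h, dite_true]
      exact ContDiffOn.sum fun J _ => (h3 J).mul (hA _)
    · simp only [contractC, h, dite_false]
      exact contDiffOn_const
  exact (h1.add h2).add h4

/-- The operation `L_X A + div X ⌟ A` is local in `A`. -/
theorem lieDivC_congr {m k p : ℕ} {w : Coord n → ℝ} {A A' : Comp n p} {X : Comp n k} {y : Coord n}
    (h : ∀ᶠ z in nhds y, ∀ I, A I z = A' I z) (I : Fin m → Fin n) :
    lieDivC m w X A I y = lieDivC m w X A' I y := by
  have h0 : ∀ I, A I y = A' I y := h.self_of_nhds
  have hd : ∀ ℓ I, partialD ℓ (A I) y = partialD ℓ (A' I) y := fun ℓ I => by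
    have : A I =ᶠ[nhds y] A' I := h.mono fun z hz => hz I
    rw [partialD, partialD, this.fderiv_eq]
  cases m <;> cases k <;> simp [lieDivC, lieC, starC, symmetrize, astC, contractC, h0, hd]

theorem lieDivC_zero_right {m k p : ℕ} {w : Coord n → ℝ} {X : Comp n k} {y : Coord n}
    (I : Fin m → Fin n) : lieDivC m w X (0 : Comp n p) I y = 0 := by
  have hp : ∀ ℓ, partialD ℓ (0 : Coord n → ℝ) y = 0 := fun ℓ =>
    partialD_eq_zero_of_eventually (Filter.Eventually.of_forall fun _ => rfl) ℓ
  cases m <;> cases k <;> simp [lieDivC, lieC, starC, symmetrize, astC, contractC, hp]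

theorem lieDivC_zero_left {m k p : ℕ} {w : Coord n → ℝ} {A : Comp n p} {y : Coord n}
    (I : Fin m → Fin n) : lieDivC m w (0 : Comp n k) A I y = 0 := by
  have hp : ∀ ℓ, partialD ℓ (0 : Coord n → ℝ) y = 0 := fun ℓ =>
    partialD_eq_zero_of_eventually (Filter.Eventually.of_forall fun _ => rfl) ℓ
  have hp' : ∀ ℓ, partialD ℓ (fun _ : Coord n => (0 : ℝ)) y = 0 := hp
  cases m <;> cases k <;>
    simp [lieDivC, lieC, starC, symmetrize, astC, contractC, divC, hp, hp']

end SymTensor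
end

noncomputable section
namespace SymTensor

/-! ### Integration on the manifold -/

variable {n : ℕ} {Q : Type*} [TopologicalSpace Q] [ChartedSpace (EuclideanSpace ℝ (Fin n)) Q]
  [IsManifold (𝓡 n) ∞ Q] [MeasurableSpace Q] [BorelSpace Q] {μ : Measure Q}

theorem measurableSet_source_inter {e : Chart n Q} {s : Set (Coord n)} (hs : MeasurableSet s) :
    MeasurableSet (e.source ∩ e ⁻¹' s) := by
  have h : Measurable (e.source.domRestrict e) := e.continuousOn.domRestrict.measurable
  have := e.open_source.measurableSet.subtype_image (h hs)
  convert this using 1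
  ext x
  simp [and_comm]

/-- In a chart, the volume is the Lebesgue measure with density `w`. -/
theorem map_restrict_source {e : Chart n Q} {w : Coord n → ℝ} (hw : IsDensity μ e w) :
    Measure.map e (μ.restrict e.source) =
      (volume.restrict e.target).withDensity (fun y => ENNReal.ofReal (w y)) := by
  have hae : AEMeasurable e (μ.restrict e.source) :=
    e.continuousOn.aemeasurable e.open_source.measurableSet
  ext s hs
  rw [Measure.map_apply_of_aemeasurable hae hs, Measure.restrict_apply' e.open_source.measurableSet,
    withDensity_apply _ hs, Measure.restrict_restrict hs, Set.inter_comm,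
    hw.2.2 _ Set.inter_subset_left (measurableSet_source_inter hs), e.image_source_inter_eq',
    Set.inter_comm s]
  congr 2
  ext y
  simp only [Set.mem_inter_iff, Set.mem_preimage]
  exact and_congr_right fun hy => by rw [e.right_inv hy]

/-- The integral of a function supported in a chart. -/
theorem integral_eq_setIntegral_chart {e : Chart n Q} {w : Coord n → ℝ} (hw : IsDensity μ e w)
    {f : Q → ℝ} {g : Coord n → ℝ} (hg : ContinuousOn g e.target)
    (hfg : ∀ y ∈ e.target, f (e.symm y) = g y) (h0 : ∀ q ∉ e.source, f q = 0) :
    ∫ q, f q ∂μ = ∫ y in e.target, w y * g y := by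
  have hT := e.open_target.measurableSet
  have hae : AEMeasurable e (μ.restrict e.source) :=
    e.continuousOn.aemeasurable e.open_source.measurableSet
  have hwm : AEMeasurable w (volume.restrict e.target) := hw.1.continuousOn.aemeasurable hT
  have hgm : AEStronglyMeasurable g (volume.restrict e.target) := hg.aestronglyMeasurable hT
  have h1 : ∫ q, f q ∂μ = ∫ q in e.source, g (e q) ∂μ := by
    rw [← setIntegral_eq_integral_of_forall_compl_eq_zero h0]
    refine setIntegral_congr_fun e.open_source.measurableSet fun q hq => ?_
    rw [← hfg _ (e.map_source hq), e.left_inv hq]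
  rw [h1, ← integral_map hae (f := g)]
  · rw [map_restrict_source hw, integral_withDensity_eq_integral_toReal_smul₀ hwm.ennreal_ofReal
      (Filter.Eventually.of_forall fun _ => ENNReal.ofReal_lt_top)]
    refine setIntegral_congr_fun hT fun y hy => ?_
    simp [ENNReal.toReal_ofReal (hw.2.1 y hy).le]
  · rw [map_restrict_source hw]
    exact hgm.mono_ac (withDensity_absolutelyContinuous _ _)

theorem isLocallyFiniteMeasure (hμ : IsVolume n μ) : IsLocallyFiniteMeasure μ := by
  refine ⟨fun q => ?_⟩
  have he := IsManifold.chart_mem_maximalAtlas (I := 𝓡 n) (n := ∞) q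
  have hq := mem_chart_source (EuclideanSpace ℝ (Fin n)) q
  set e := chartAt (EuclideanSpace ℝ (Fin n)) q
  obtain ⟨w, hw⟩ := hμ e he
  obtain ⟨K, hK, hqK, hKT⟩ := exists_compact_subset e.open_target (e.map_source hq)
  refine ⟨e.source ∩ e ⁻¹' interior K, (e.isOpen_inter_preimage isOpen_interior).mem_nhds ⟨hq, hqK⟩, ?_⟩
  rw [hw.2.2 _ Set.inter_subset_left (measurableSet_source_inter isOpen_interior.measurableSet)]
  calc ∫⁻ y in e '' (e.source ∩ e ⁻¹' interior K), ENNReal.ofReal (w y)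
      ≤ ∫⁻ y in K, ENNReal.ofReal (w y) := by
        refine lintegral_mono_set ?_
        rintro _ ⟨x, hx, rfl⟩
        exact interior_subset hx.2
    _ < ⊤ := by
        have hi : IntegrableOn w K := (hw.1.continuousOn.mono hKT).integrableOn_compact hK
        have := hi.2
        rw [hasFiniteIntegral_iff_enorm] at this
        refine lt_of_le_of_lt (lintegral_mono fun y => ?_) this
        exact Real.ofReal_le_enorm (w y)

theorem continuous_fullContraction {k : ℕ} (A : Co n Q k) (X : Contra n Q k) :
    Continuous (fullContraction A.1 X.1) := by
  refine continuous_iff_continuousAt.2 fun q => ?_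
  have he := IsManifold.chart_mem_maximalAtlas (I := 𝓡 n) (n := ∞) q
  have hq := mem_chart_source (EuclideanSpace ℝ (Fin n)) q
  set e := chartAt (EuclideanSpace ℝ (Fin n)) q
  have h1 : ContinuousAt ((fun y => ∑ I, coComp e A.1 I y * contraComp e X.1 I y) ∘ e) q := by
    refine ContinuousAt.comp ?_ (e.continuousAt hq)
    have : ContinuousOn (fun y => ∑ I, coComp e A.1 I y * contraComp e X.1 I y) e.target :=
      (ContDiffOn.sum fun I _ => (A.2.2.1 e he I).mul (X.2.2 e he I)).continuousOn
    exact this.continuousAt (e.open_target.mem_nhds (e.map_source hq))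
  refine h1.congr ?_
  filter_upwards [e.open_source.mem_nhds hq] with x hx
  exact (fullContraction_eq he hx A.1 X.1).symm

theorem integrable_fullContraction [T2Space Q] (hμ : IsVolume n μ) {k : ℕ} (A : Co n Q k)
    (X : Contra n Q k) : Integrable (fullContraction A.1 X.1) μ := by
  have := isLocallyFiniteMeasure hμ
  obtain ⟨K, hK, hA⟩ := A.2.2.2
  refine (continuous_fullContraction A X).integrable_of_hasCompactSupport
    (HasCompactSupport.intro hK fun q hq => ?_)
  simp [fullContraction, hA q hq]

/-! ### Tensor fields with prescribed components in a chart -/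

/-- The contravariant field with given compactly supported components in a chart. -/
theorem exists_contra [T2Space Q] {e : Chart n Q} (he : e ∈ IsManifold.maximalAtlas (𝓡 n) ∞ Q)
    {k : ℕ} {c : Comp n k} (hc : ∀ I, ContDiffOn ℝ ∞ (c I) e.target)
    (hs : ∀ y ∈ e.target, IsSymm (fun I => c I y)) {K : Set (Coord n)} (hK : IsCompact K)
    (hKT : K ⊆ e.target) (h0 : ∀ y ∈ e.target, y ∉ K → ∀ I, c I y = 0) :
    ∃ Y : Contra n Q k, (∀ y ∈ e.target, ∀ I, contraComp e Y.1 I y = c I y) ∧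
      ∀ q ∉ e.symm '' K, Y.1 q = 0 := by
  classical
  let Y : RawContra n Q k := fun q => if q ∈ e.source then ofComponents e q (fun I => c I (e q)) else 0
  have hY : ∀ q ∈ e.source, Y q = ofComponents e q (fun I => c I (e q)) := fun q hq => if_pos hq
  have hYK : ∀ q ∉ e.symm '' K, Y q = 0 := fun q hqK => by
    by_cases hq : q ∈ e.source
    · rw [hY q hq]
      ext α
      have : e q ∉ K := fun h => hqK ⟨e q, h, e.left_inv hq⟩
      simp [ofComponents_apply, h0 _ (e.map_source hq) this]
    · exact if_neg hq
  have hcomp : ∀ y ∈ e.target, ∀ I, contraComp e Y I y = c I y := fun y hy I => by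
    rw [contraComp, hY _ (e.map_target hy), ofComponents_coframe he (e.map_target hy),
      e.right_inv hy]
  have hKc : IsClosed (e.symm '' K) := (hK.image_of_continuousOn (e.continuousOn_symm.mono hKT)).isClosed
  refine ⟨⟨Y, fun q π α => ?_, fun e' he' I => contDiffOn_contraComp_of_local (fun q => ?_) he' I⟩,
    hcomp, hYK⟩
  · by_cases hq : q ∈ e.source
    · rw [hY q hq]
      exact ofComponents_symm e q (hs _ (e.map_source hq)) π α
    · simp [Y, hq]
  · by_cases hq : q ∈ e.symm '' K
    · obtain ⟨y, hy, rfl⟩ := hq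
      refine ⟨e, he, e.map_target (hKT hy), fun I => ?_⟩
      rw [e.right_inv (hKT hy)]
      refine ((hc I).contDiffAt (e.open_target.mem_nhds (hKT hy))).congr_of_eventuallyEq ?_
      filter_upwards [e.open_target.mem_nhds (hKT hy)] with z hz using hcomp z hz I
    · have hq0 := mem_chart_source (EuclideanSpace ℝ (Fin n)) q
      refine ⟨_, IsManifold.chart_mem_maximalAtlas q, hq0, fun I => ?_⟩
      set e0 := chartAt (EuclideanSpace ℝ (Fin n)) q
      refine (contDiffAt_const (c := (0 : ℝ))).congr_of_eventuallyEq ?_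
      have := (e0.continuousAt_symm (e0.map_source hq0)).preimage_mem_nhds
        (hKc.isOpen_compl.mem_nhds (by rwa [Set.mem_compl_iff, e0.left_inv hq0]))
      filter_upwards [this] with z hz
      simp [contraComp, hYK _ hz]

/-- The covariant field with given compactly supported components in a chart. -/
theorem exists_co [T2Space Q] {e : Chart n Q} (he : e ∈ IsManifold.maximalAtlas (𝓡 n) ∞ Q)
    {k : ℕ} {c : Comp n k} (hc : ∀ I, ContDiffOn ℝ ∞ (c I) e.target)
    (hs : ∀ y ∈ e.target, IsSymm (fun I => c I y)) {K : Set (Coord n)} (hK : IsCompact K)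
    (hKT : K ⊆ e.target) (h0 : ∀ y ∈ e.target, y ∉ K → ∀ I, c I y = 0) :
    ∃ A : Co n Q k, (∀ y ∈ e.target, ∀ I, coComp e A.1 I y = c I y) ∧
      ∀ q ∉ e.symm '' K, A.1 q = 0 := by
  classical
  let A : RawCo n Q k := fun q => if q ∈ e.source then coOfComponents e q (fun I => c I (e q)) else 0
  have hA : ∀ q ∈ e.source, A q = coOfComponents e q (fun I => c I (e q)) := fun q hq => if_pos hq
  have hAK : ∀ q ∉ e.symm '' K, A q = 0 := fun q hqK => by
    by_cases hq : q ∈ e.source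
    · rw [hA q hq]
      ext α
      have : e q ∉ K := fun h => hqK ⟨e q, h, e.left_inv hq⟩
      simp [coOfComponents_apply, h0 _ (e.map_source hq) this]
    · exact if_neg hq
  have hcomp : ∀ y ∈ e.target, ∀ I, coComp e A I y = c I y := fun y hy I => by
    rw [coComp, hA _ (e.map_target hy), coOfComponents_frame he (e.map_target hy),
      e.right_inv hy]
  have hKcpt : IsCompact (e.symm '' K) := hK.image_of_continuousOn (e.continuousOn_symm.mono hKT)
  refine ⟨⟨A, fun q π v => ?_, fun e' he' I => contDiffOn_coComp_of_local (fun q => ?_) he' I,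
    _, hKcpt, hAK⟩, hcomp, hAK⟩
  · by_cases hq : q ∈ e.source
    · rw [hA q hq]
      exact coOfComponents_symm e q (hs _ (e.map_source hq)) π v
    · simp [A, hq]
  · by_cases hq : q ∈ e.symm '' K
    · obtain ⟨y, hy, rfl⟩ := hq
      refine ⟨e, he, e.map_target (hKT hy), fun I => ?_⟩
      rw [e.right_inv (hKT hy)]
      refine ((hc I).contDiffAt (e.open_target.mem_nhds (hKT hy))).congr_of_eventuallyEq ?_
      filter_upwards [e.open_target.mem_nhds (hKT hy)] with z hz using hcomp z hz I
    · have hq0 := mem_chart_source (EuclideanSpace ℝ (Fin n)) q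
      refine ⟨_, IsManifold.chart_mem_maximalAtlas q, hq0, fun I => ?_⟩
      set e0 := chartAt (EuclideanSpace ℝ (Fin n)) q
      refine (contDiffAt_const (c := (0 : ℝ))).congr_of_eventuallyEq ?_
      have := (e0.continuousAt_symm (e0.map_source hq0)).preimage_mem_nhds
        (hKcpt.isClosed.isOpen_compl.mem_nhds (by rwa [Set.mem_compl_iff, e0.left_inv hq0]))
      filter_upwards [this] with z hz
      simp [coComp, hAK _ hz]

/-- Nondegeneracy of the pairing in a chart: the test field is a bump function times the field to be
shown to vanish. -/
theorem eq_zero_of_forall_setIntegral [T2Space Q] {e : Chart n Q}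
    (he : e ∈ IsManifold.maximalAtlas (𝓡 n) ∞ Q) {w : Coord n → ℝ} (hw : IsDensity μ e w) {k : ℕ}
    {d : Comp n k} (hd : ∀ I, ContDiffOn ℝ ∞ (d I) e.target)
    (hs : ∀ y ∈ e.target, IsSymm (fun I => d I y))
    (h : ∀ (Y : Contra n Q k) (K : Set (Coord n)), IsCompact K → K ⊆ e.target →
      (∀ q ∉ e.symm '' K, Y.1 q = 0) →
      ∫ y in e.target, w y * ∑ I, d I y * contraComp e Y.1 I y = 0)
    {y : Coord n} (hy : y ∈ e.target) (I : Fin k → Fin n) : d I y = 0 := by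
  obtain ⟨r, hr, hrT⟩ := Metric.nhds_basis_closedBall.mem_iff.1 (e.open_target.mem_nhds hy)
  let χ : ContDiffBump y := ⟨r / 2, r, by positivity, by linarith⟩
  have hχ0 : ∀ z ∉ Metric.closedBall y r, χ z = 0 := fun z hz => by
    refine χ.zero_of_le_dist ?_
    rw [Metric.mem_closedBall, not_le] at hz
    exact hz.le
  have hχ : ContDiff ℝ ∞ χ := χ.contDiff
  have hK := isCompact_closedBall y r
  obtain ⟨Y, hYc, hYK⟩ := exists_contra he (c := fun I z => χ z * d I z)
    (fun I => hχ.contDiffOn.mul (hd I)) (fun z hz π I => by simp only [hs z hz π I]) hK hrT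
    (fun z _ hzK I => by simp [hχ0 z hzK])
  have h1 := h Y _ hK hrT hYK
  set f : Coord n → ℝ := fun z => w z * ∑ I, d I z * (χ z * d I z) with hf
  have h2 : ∫ z in e.target, f z = 0 := by
    rw [← h1]
    refine setIntegral_congr_fun e.open_target.measurableSet fun z hz => ?_
    simp only [hf, hYc z hz]
  have hfs : ContDiffOn ℝ ∞ f e.target :=
    hw.1.mul (ContDiffOn.sum fun I _ => (hd I).mul (hχ.contDiffOn.mul (hd I)))
  obtain ⟨g1, g2, g3⟩ := contDiff_indicator e.open_target hK hrT hfs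
    (fun z _ hzK => by simp [hf, hχ0 z hzK])
  rw [← integral_indicator e.open_target.measurableSet] at h2
  by_contra hne
  refine absurd h2 (ne_of_gt (g1.continuous.integral_pos_of_hasCompactSupport_nonneg_nonzero
    (x := y) g2 (fun z => Set.indicator_nonneg (fun z hz => ?_) z) ?_))
  · refine mul_nonneg (hw.2.1 z hz).le (Finset.sum_nonneg fun I _ => ?_)
    rw [mul_left_comm]
    exact mul_nonneg χ.nonneg (mul_self_nonneg _)
  · rw [Set.indicator_of_mem hy]
    have hχy : χ y = 1 := χ.one_of_mem_closedBall (Metric.mem_closedBall_self (by positivity))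
    simp only [hf, hχy, one_mul]
    refine mul_ne_zero (hw.2.1 y hy).ne' (ne_of_gt ?_)
    exact Finset.sum_pos' (fun I _ => mul_self_nonneg _)
      ⟨I, Finset.mem_univ _, mul_self_pos.2 hne⟩

end SymTensor
end

noncomputable section
namespace SymTensor

/-! ### The formal adjoint of the concomitant -/

variable {n : ℕ} {Q : Type*} [TopologicalSpace Q] [ChartedSpace (EuclideanSpace ℝ (Fin n)) Q]
  [IsManifold (𝓡 n) ∞ Q] [MeasurableSpace Q] [BorelSpace Q] {μ : Measure Q}

theorem schouten_eq_zero_of_eventually {k m r : ℕ} (h : k + m = r + 1) {Y : Contra n Q k}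
    {X : Contra n Q m} {q : Q} (h0 : ∀ᶠ x in nhds q, Y.1 x = 0) : (schouten r Y X).1 q = 0 := by
  have he := IsManifold.chart_mem_maximalAtlas (I := 𝓡 n) (n := ∞) q
  have hq := mem_chart_source (EuclideanSpace ℝ (Fin n)) q
  set e := chartAt (EuclideanSpace ℝ (Fin n)) q
  have hY : ∀ᶠ z in nhds (e q), ∀ I, contraComp e Y.1 I z = 0 := by
    have := (e.continuousAt_symm (e.map_source hq)).eventually (by rwa [e.left_inv hq])
    filter_upwards [this] with z hz I
    simp [contraComp, hz]
  have h1 : ∀ I, contraComp e Y.1 I (e q) = 0 := hY.self_of_nhds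
  have h2 : ∀ ℓ I, partialD ℓ (contraComp e Y.1 I) (e q) = 0 := fun ℓ I =>
    partialD_eq_zero_of_eventually (hY.mono fun z hz => hz I) ℓ
  have h3 : ∀ I, contraComp e (schouten r Y X).1 I (e q) = contraComp e (0 : RawContra n Q r) I (e q) := by
    intro I
    rw [schouten_comp he h Y X (e.map_source hq)]
    have h4 : ∀ J, transportC r (contraComp e Y.1) (contraComp e X.1) J (e q) = 0 := fun J => by
      cases k <;> simp [transportC, h1]
    have h5 : ∀ J, transportC r (contraComp e X.1) (contraComp e Y.1) J (e q) = 0 := fun J => by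
      cases m <;> simp [transportC, h2]
    simp [schoutenC, symmetrize, h4, h5, contraComp]
  exact contra_ext he hq h3

theorem integral_fullContraction_chart {e : Chart n Q}
    (he : e ∈ IsManifold.maximalAtlas (𝓡 n) ∞ Q) {w : Coord n → ℝ} (hw : IsDensity μ e w) {k : ℕ}
    (A : Co n Q k) (Y : Contra n Q k) (h0 : ∀ q ∉ e.source, A.1 q = 0 ∨ Y.1 q = 0) :
    ∫ q, fullContraction A.1 Y.1 q ∂μ =
      ∫ y in e.target, w y * ∑ I, coComp e A.1 I y * contraComp e Y.1 I y := by
  refine integral_eq_setIntegral_chart hw (ContDiffOn.sum fun I _ =>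
    (A.2.2.1 e he I).mul (Y.2.2 e he I)).continuousOn (fun y hy => ?_) (fun q hq => ?_)
  · rw [fullContraction_eq he (e.map_target hy), e.right_inv hy]
  · rcases h0 q hq with h | h <;> simp [fullContraction, h]

/-- Integration by parts for tensor fields, one of which is supported in a chart. -/
theorem integral_schouten_chart [T2Space Q] {e : Chart n Q}
    (he : e ∈ IsManifold.maximalAtlas (𝓡 n) ∞ Q) {w : Coord n → ℝ} (hw : IsDensity μ e w)
    {m k p : ℕ} (h : p + 1 = m + k) (A : Co n Q p) (X : Contra n Q k) (Y : Contra n Q m)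
    {K : Set (Coord n)} (hK : IsCompact K) (hKT : K ⊆ e.target)
    (h0 : (∀ q ∉ e.symm '' K, A.1 q = 0) ∨ (∀ q ∉ e.symm '' K, Y.1 q = 0)) :
    ∫ q, fullContraction A.1 (schouten p Y X).1 q ∂μ =
      ∫ y in e.target, w y * ∑ I, lieDivC m w (contraComp e X.1) (coComp e A.1) I y *
        contraComp e Y.1 I y := by
  have hKs : e.symm '' K ⊆ e.source := by
    rintro _ ⟨y, hy, rfl⟩
    exact e.map_target (hKT hy)
  have hKc : IsClosed (e.symm '' K) :=
    (hK.image_of_continuousOn (e.continuousOn_symm.mono hKT)).isClosed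
  have hnot : ∀ y ∈ e.target, y ∉ K → e.symm y ∉ e.symm '' K := by
    rintro y hy hyK ⟨z, hz, hzy⟩
    exact hyK (e.symm.injOn (hKT hz) hy hzy ▸ hz)
  rw [integral_fullContraction_chart he hw, ← setIntegral_schoutenC h e.open_target hK hKT hw.1 hw.2.1
    (A.2.2.1 e he) (X.2.2 e he) (Y.2.2 e he) (isSymm_coComp e A) (isSymm_contraComp e X)
    (isSymm_contraComp e Y)]
  · refine setIntegral_congr_fun e.open_target.measurableSet fun y hy => ?_
    simp only [schouten_comp he h.symm Y X hy]
  · refine h0.imp (fun h0 y hy hyK I => ?_) (fun h0 y hy hyK I => ?_)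
    · simp [coComp, h0 _ (hnot y hy hyK)]
    · simp [contraComp, h0 _ (hnot y hy hyK)]
  · intro q hq
    have hqK : q ∉ e.symm '' K := fun h => hq (hKs h)
    refine h0.imp (fun h0 => h0 q hqK) (fun h0 => schouten_eq_zero_of_eventually h.symm ?_)
    filter_upwards [hKc.isOpen_compl.mem_nhds hqK] with x hx using h0 x hx

/-- A field dual to the concomitant has the components `L_X A + div X ⌟ A` in every chart. -/
theorem coComp_eq_lieDivC_of_dual [T2Space Q] {e : Chart n Q}
    (he : e ∈ IsManifold.maximalAtlas (𝓡 n) ∞ Q) {w : Coord n → ℝ} (hw : IsDensity μ e w)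
    {m k p : ℕ} (h : p + 1 = m + k) {A : Co n Q p} {X : Contra n Q k} {D : Co n Q m}
    (hD : ∀ Y : Contra n Q m, ∫ q, fullContraction A.1 (schouten p Y X).1 q ∂μ =
      ∫ q, fullContraction D.1 Y.1 q ∂μ) {y : Coord n} (hy : y ∈ e.target) (I : Fin m → Fin n) :
    coComp e D.1 I y = lieDivC m w (contraComp e X.1) (coComp e A.1) I y := by
  have hL := contDiffOn_lieDivC (m := m) e.open_target hw.1 hw.2.1 (A.2.2.1 e he) (X.2.2 e he)
  rw [← sub_eq_zero]
  refine eq_zero_of_forall_setIntegral he hw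
    (d := fun I y => coComp e D.1 I y - lieDivC m w (contraComp e X.1) (coComp e A.1) I y)
    (fun I => (D.2.2.1 e he I).sub (hL I)) (fun y _ π I => ?_) (fun Y K hK hKT hYK => ?_) hy I
  · have h1 := isSymm_coComp e D y π I
    have h2 := isSymm_lieDivC (m := m) (w := w) (X := contraComp e X.1) (y := y) (isSymm_coComp e A) π I
    simp only at h1 h2
    simp only [h1, h2]
  · have h1 := hD Y
    have hKs : ∀ q ∉ e.source, q ∉ e.symm '' K := by
      rintro _ hq ⟨y, hy, rfl⟩
      exact hq (e.map_target (hKT hy))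
    rw [integral_schouten_chart he hw h A X Y hK hKT (Or.inr hYK),
      integral_fullContraction_chart he hw D Y (fun q hq => Or.inr (hYK q (hKs q hq)))] at h1
    have hY0 : ∀ y ∈ e.target, y ∉ K → ∀ I, contraComp e Y.1 I y = 0 := by
      intro y hy hyK I
      have : e.symm y ∉ e.symm '' K := by
        rintro ⟨z, hz, hzy⟩
        exact hyK (e.symm.injOn (hKT hz) hy hzy ▸ hz)
      simp [contraComp, hYK _ this]
    have hi : ∀ {c : Comp n m}, (∀ I, ContDiffOn ℝ ∞ (c I) e.target) → IntegrableOn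
        (fun y => w y * ∑ I, c I y * contraComp e Y.1 I y) e.target := fun hc =>
      integrableOn_of_zero_off_compact e.open_target hK hKT
        (hw.1.mul (ContDiffOn.sum fun I _ => (hc I).mul (Y.2.2 e he I))).continuousOn
        fun y hy hyK => by simp [hY0 y hy hyK]
    rw [← sub_eq_zero, ← integral_sub (hi hL) (hi (D.2.2.1 e he)), ← neg_eq_zero,
      ← integral_neg] at h1
    rw [← h1]
    congr 1
    funext y
    rw [neg_sub, ← mul_sub, ← Finset.sum_sub_distrib]
    simp_rw [sub_mul]

theorem eq_of_forall_integral_eq [T2Space Q] (hμ : IsVolume n μ) {m : ℕ} {D D' : Co n Q m}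
    (h : ∀ Y : Contra n Q m, ∫ q, fullContraction D.1 Y.1 q ∂μ = ∫ q, fullContraction D'.1 Y.1 q ∂μ) :
    D = D' := by
  ext1
  funext q
  have he := IsManifold.chart_mem_maximalAtlas (I := 𝓡 n) (n := ∞) q
  have hq := mem_chart_source (EuclideanSpace ℝ (Fin n)) q
  set e := chartAt (EuclideanSpace ℝ (Fin n)) q
  obtain ⟨w, hw⟩ := hμ e he
  refine co_ext he hq fun I => ?_
  rw [← sub_eq_zero]
  refine eq_zero_of_forall_setIntegral he hw
    (d := fun I y => coComp e (D - D').1 I y)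
    (fun I => (D - D').2.2.1 e he I) (fun y _ => isSymm_coComp e (D - D') y)
    (fun Y K hK hKT hYK => ?_) (e.map_source hq) I
  have hKs : ∀ q ∉ e.source, q ∉ e.symm '' K := by
    rintro _ hq ⟨y, hy, rfl⟩
    exact hq (e.map_target (hKT hy))
  rw [← integral_fullContraction_chart he hw (D - D') Y (fun q hq => Or.inr (hYK q (hKs q hq)))]
  have h1 : ∀ q, fullContraction (D - D').1 Y.1 q =
      fullContraction D.1 Y.1 q - fullContraction D'.1 Y.1 q := fun q => by
    simp [fullContraction, sub_mul]
  simp_rw [h1]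
  rw [integral_sub (integrable_fullContraction hμ D Y) (integrable_fullContraction hμ D' Y), h Y,
    sub_self]

/-- For `A` supported in a chart, the adjoint is the field with components `L_X A + div X ⌟ A` there. -/
theorem exists_dual_of_supported [T2Space Q] {e : Chart n Q}
    (he : e ∈ IsManifold.maximalAtlas (𝓡 n) ∞ Q) {w : Coord n → ℝ} (hw : IsDensity μ e w)
    {m k p : ℕ} (h : p + 1 = m + k) (A : Co n Q p) (X : Contra n Q k)
    {K : Set (Coord n)} (hK : IsCompact K) (hKT : K ⊆ e.target)
    (hA : ∀ q ∉ e.symm '' K, A.1 q = 0) :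
    ∃ D : Co n Q m, ∀ Y : Contra n Q m, ∫ q, fullContraction A.1 (schouten p Y X).1 q ∂μ =
      ∫ q, fullContraction D.1 Y.1 q ∂μ := by
  have hA0 : ∀ y ∈ e.target, y ∉ K → ∀ I, coComp e A.1 I y = 0 := by
    intro y hy hyK I
    have : e.symm y ∉ e.symm '' K := by
      rintro ⟨z, hz, hzy⟩
      exact hyK (e.symm.injOn (hKT hz) hy hzy ▸ hz)
    simp [coComp, hA _ this]
  obtain ⟨D, hDc, hDK⟩ := exists_co he (c := fun I y => lieDivC m w (contraComp e X.1) (coComp e A.1) I y)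
    (contDiffOn_lieDivC e.open_target hw.1 hw.2.1 (A.2.2.1 e he) (X.2.2 e he))
    (fun y _ => isSymm_lieDivC (isSymm_coComp e A)) hK hKT (fun y hy hyK I => by
      refine (lieDivC_congr (A' := 0) ?_ I).trans (lieDivC_zero_right I)
      filter_upwards [eventually_not_mem_compact e.open_target hK hy hyK] with z hz J
      exact hA0 z hz.1 hz.2 J)
  refine ⟨D, fun Y => ?_⟩
  have hKs : ∀ q ∉ e.source, q ∉ e.symm '' K := by
    rintro _ hq ⟨y, hy, rfl⟩
    exact hq (e.map_target (hKT hy))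
  rw [integral_schouten_chart he hw h A X Y hK hKT (Or.inl hA),
    integral_fullContraction_chart he hw D Y (fun q hq => Or.inl (hDK q (hKs q hq)))]
  refine setIntegral_congr_fun e.open_target.measurableSet fun y hy => ?_
  simp only [hDc y hy]

theorem exists_smul_co {f : Q → ℝ} (hf : ContMDiff (𝓡 n) 𝓘(ℝ, ℝ) ∞ f) {k : ℕ} (A : Co n Q k) :
    ∃ B : Co n Q k, ∀ q, B.1 q = f q • A.1 q := by
  obtain ⟨hA1, hA2, K, hK, hAK⟩ := A.2
  refine ⟨⟨fun q => f q • A.1 q, fun q π v => ?_, fun e he I => ?_, K, hK, fun q hq => ?_⟩,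
    fun q => rfl⟩
  · simp [hA1 q π v]
  · have h1 : ContDiffOn ℝ ∞ (f ∘ e.symm) e.target :=
      (hf.comp_contMDiffOn (contMDiffOn_symm_of_mem_maximalAtlas he)).contDiffOn
    exact h1.mul (hA2 e he I)
  · simp [hAK q hq]

theorem fullContraction_sum_left {ι : Type*} (s : Finset ι) {k : ℕ} (A : ι → Co n Q k)
    (X : RawContra n Q k) (q : Q) : fullContraction (∑ i ∈ s, A i).1 X q =
      ∑ i ∈ s, fullContraction (A i).1 X q := by
  simp only [fullContraction, Submodule.coe_sum, Finset.sum_apply, sum_apply, Finset.sum_mul]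
  exact Finset.sum_comm

theorem fullContraction_sum_right {ι : Type*} (s : Finset ι) {k : ℕ} (A : RawCo n Q k)
    (X : ι → Contra n Q k) (q : Q) : fullContraction A (∑ i ∈ s, X i).1 q =
      ∑ i ∈ s, fullContraction A (X i).1 q := by
  simp only [fullContraction, Submodule.coe_sum, Finset.sum_apply, sum_apply, Finset.mul_sum]
  exact Finset.sum_comm

/-- Existence of the adjoint: `A` is cut into pieces supported in charts by a partition of unity. -/
theorem exists_dual [T2Space Q] [SecondCountableTopology Q] (hμ : IsVolume n μ) {m k p : ℕ}
    (h : p + 1 = m + k) (A : Co n Q p) (X : Contra n Q k) :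
    ∃ D : Co n Q m, ∀ Y : Contra n Q m, ∫ q, fullContraction A.1 (schouten p Y X).1 q ∂μ =
      ∫ q, fullContraction D.1 Y.1 q ∂μ := by
  classical
  have : LocallyCompactSpace Q := ChartedSpace.locallyCompactSpace (EuclideanSpace ℝ (Fin n)) Q
  obtain ⟨f, hf⟩ := SmoothPartitionOfUnity.exists_isSubordinate_chartAt_source (𝓡 n) Q
  obtain ⟨K, hK, hAK⟩ := A.2.2.2
  have hfin : {i | (Function.support (f i) ∩ K).Nonempty}.Finite :=
    f.locallyFinite.finite_nonempty_inter_compact hK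
  choose B hB using fun i => exists_smul_co (n := n) (f i).contMDiff A
  have hsum : A = ∑ i ∈ hfin.toFinset, B i := by
    ext1
    funext q
    simp only [Submodule.coe_sum, Finset.sum_apply, hB]
    by_cases hq : q ∈ K
    · rw [← Finset.sum_smul, ← finsum_eq_sum_of_support_subset, f.sum_eq_one (Set.mem_univ q), one_smul]
      intro i hi
      simp only [Set.Finite.coe_toFinset, Set.mem_ofPred_eq]
      exact ⟨q, hi, hq⟩
    · simp [hAK q hq]
  have hex : ∀ i, ∃ D : Co n Q m, ∀ Y : Contra n Q m,
      ∫ q, fullContraction (B i).1 (schouten p Y X).1 q ∂μ = ∫ q, fullContraction D.1 Y.1 q ∂μ := by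
    intro i
    have he := IsManifold.chart_mem_maximalAtlas (I := 𝓡 n) (n := ∞) i
    have hsub : tsupport (f i) ∩ K ⊆ (chartAt (EuclideanSpace ℝ (Fin n)) i).source :=
      Set.inter_subset_left.trans (hf i)
    set e := chartAt (EuclideanSpace ℝ (Fin n)) i
    obtain ⟨w, hw⟩ := hμ e he
    refine exists_dual_of_supported he hw h (B i) X (K := e '' (tsupport (f i) ∩ K))
      ((hK.inter_left (isClosed_tsupport _)).image_of_continuousOn (e.continuousOn.mono hsub)) ?_ ?_
    · rintro _ ⟨x, hx, rfl⟩
      exact e.map_source (hsub hx)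
    · intro q hq
      rw [hB]
      by_cases h1 : q ∈ tsupport (f i)
      · by_cases h2 : q ∈ K
        · exact absurd ⟨e q, ⟨q, ⟨h1, h2⟩, rfl⟩, e.left_inv (hsub ⟨h1, h2⟩)⟩ hq
        · rw [hAK q h2, smul_zero]
      · rw [image_eq_zero_of_notMem_tsupport h1, zero_smul]
  choose D hD using hex
  refine ⟨∑ i ∈ hfin.toFinset, D i, fun Y => ?_⟩
  rw [hsum]
  simp_rw [fullContraction_sum_left]
  rw [integral_finsetSum _ fun i _ => integrable_fullContraction hμ (B i) (schouten p Y X),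
    integral_finsetSum _ fun i _ => integrable_fullContraction hμ (D i) Y]
  exact Finset.sum_congr rfl fun i _ => hD i Y

end SymTensor
end

noncomputable section
namespace SymTensor

/-! ### Algebra of the bracket -/

variable {n : ℕ} {Q : Type*} [TopologicalSpace Q] [ChartedSpace (EuclideanSpace ℝ (Fin n)) Q]
  [IsManifold (𝓡 n) ∞ Q]

theorem contra_eq_of_comp {k : ℕ} {X Y : Contra n Q k}
    (h : ∀ e ∈ IsManifold.maximalAtlas (𝓡 n) ∞ Q, ∀ y ∈ e.target, ∀ I,
      contraComp e X.1 I y = contraComp e Y.1 I y) : X = Y := by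
  ext1
  funext q
  have he := IsManifold.chart_mem_maximalAtlas (I := 𝓡 n) (n := ∞) q
  have hq := mem_chart_source (EuclideanSpace ℝ (Fin n)) q
  exact contra_ext he hq fun I => h _ he _ (OpenPartialHomeomorph.map_source _ hq) I

theorem co_eq_of_comp {k : ℕ} {A B : Co n Q k}
    (h : ∀ e ∈ IsManifold.maximalAtlas (𝓡 n) ∞ Q, ∀ y ∈ e.target, ∀ I,
      coComp e A.1 I y = coComp e B.1 I y) : A = B := by
  ext1
  funext q
  have he := IsManifold.chart_mem_maximalAtlas (I := 𝓡 n) (n := ∞) q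
  have hq := mem_chart_source (EuclideanSpace ℝ (Fin n)) q
  exact co_ext he hq fun I => h _ he _ (OpenPartialHomeomorph.map_source _ hq) I

theorem schouten_antisymm {k m r : ℕ} (h : k + m = r + 1) (X : Contra n Q k) (Y : Contra n Q m) :
    schouten r X Y = -schouten r Y X := by
  refine contra_eq_of_comp fun e he y hy I => ?_
  have h1 : contraComp e (-schouten r Y X).1 I y = -contraComp e (schouten r Y X).1 I y := rfl
  rw [h1, schouten_comp he h X Y hy, schouten_comp he (by omega) Y X hy]
  simp only [schoutenC, symmetrize, ← mul_neg, ← Finset.sum_neg_distrib, neg_sub]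

theorem schouten_add_left {k m r : ℕ} (h : k + m = r + 1) (X X' : Contra n Q k)
    (Y : Contra n Q m) : schouten r (X + X') Y = schouten r X Y + schouten r X' Y := by
  refine contra_eq_of_comp fun e he y hy I => ?_
  have h1 : contraComp e (schouten r X Y + schouten r X' Y).1 I y =
      contraComp e (schouten r X Y).1 I y + contraComp e (schouten r X' Y).1 I y := rfl
  have hv : ∀ J z, contraComp e (X + X').1 J z = contraComp e X.1 J z + contraComp e X'.1 J z :=
    fun _ _ => rfl
  have hd : ∀ ℓ J, partialD ℓ (contraComp e (X + X').1 J) y =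
      partialD ℓ (contraComp e X.1 J) y + partialD ℓ (contraComp e X'.1 J) y := fun ℓ J => by
    have h2 : contraComp e (X + X').1 J = fun z => contraComp e X.1 J z + contraComp e X'.1 J z := rfl
    rw [h2, partialD, fderiv_fun_add (contraComp_differentiableAt he hy X J)
      (contraComp_differentiableAt he hy X' J)]
    rfl
  have hl : ∀ J, transportC r (contraComp e (X + X').1) (contraComp e Y.1) J y =
      transportC r (contraComp e X.1) (contraComp e Y.1) J y +
        transportC r (contraComp e X'.1) (contraComp e Y.1) J y := fun J => by
    cases k with
    | zero => simp [transportC]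
    | succ a =>
      simp only [transportC]
      split_ifs
      · simp only [hv, add_mul, Finset.sum_add_distrib, mul_add]
      · simp
  have hr : ∀ J, transportC r (contraComp e Y.1) (contraComp e (X + X').1) J y =
      transportC r (contraComp e Y.1) (contraComp e X.1) J y +
        transportC r (contraComp e Y.1) (contraComp e X'.1) J y := fun J => by
    cases m with
    | zero => simp [transportC]
    | succ a =>
      simp only [transportC]
      split_ifs
      · simp only [hd, Finset.sum_add_distrib, mul_add]
      · simp
  rw [h1, schouten_comp he h _ Y hy, schouten_comp he h X Y hy, schouten_comp he h X' Y hy]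
  simp only [schoutenC, symmetrize, hl, hr, ← mul_add, ← Finset.sum_add_distrib]
  congr 1
  exact Finset.sum_congr rfl fun π _ => by ring

theorem schouten_zero_left {k m r : ℕ} (h : k + m = r + 1) (Y : Contra n Q m) :
    schouten r (0 : Contra n Q k) Y = 0 := by
  have := schouten_add_left h 0 0 Y
  rwa [add_zero, left_eq_add] at this

theorem schouten_zero_right {k m r : ℕ} (h : k + m = r + 1) (X : Contra n Q k) :
    schouten r X (0 : Contra n Q m) = 0 := by
  rw [schouten_antisymm h, schouten_zero_left (by omega)]
  exact neg_zero (G := Contra n Q r)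

theorem bracket_antisymm (X Y : TQ n Q) : bracket X Y = -bracket Y X := by
  funext r
  change ∑ p ∈ Finset.HasAntidiagonal.antidiagonal (r + 1), schouten r (X p.1) (Y p.2) =
    -∑ p ∈ Finset.HasAntidiagonal.antidiagonal (r + 1), schouten r (Y p.1) (X p.2)
  have hneg : ∀ (s : Finset (ℕ × ℕ)) (f : ℕ × ℕ → Contra n Q r), ∑ p ∈ s, -f p = -∑ p ∈ s, f p :=
    fun s f => Finset.sum_neg_distrib f
  rw [← Finset.Nat.sum_antidiagonal_swap]
  refine (Finset.sum_congr rfl fun p hp => ?_).trans (hneg _ _)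
  rw [Finset.HasAntidiagonal.mem_antidiagonal] at hp
  exact schouten_antisymm (by simpa [add_comm] using hp) _ _

theorem bracket_add_left (X X' Y : TQ n Q) : bracket (X + X') Y = bracket X Y + bracket X' Y := by
  funext r
  simp only [bracket, Pi.add_apply, ← Finset.sum_add_distrib]
  exact Finset.sum_congr rfl fun p hp =>
    schouten_add_left (Finset.HasAntidiagonal.mem_antidiagonal.1 hp) _ _ _

theorem bracket_add_right (X Y Y' : TQ n Q) : bracket X (Y + Y') = bracket X Y + bracket X Y' := by
  rw [bracket_antisymm X (Y + Y'), bracket_add_left, bracket_antisymm X Y, bracket_antisymm X Y']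
  exact neg_add (bracket Y X) (bracket Y' X)

theorem bracket_apply_eq_zero {X Y : TQ n Q} {r : ℕ}
    (h : ∀ k m, k + m = r + 1 → X k = 0 ∨ Y m = 0) : bracket X Y r = 0 := by
  refine Finset.sum_eq_zero fun p hp => ?_
  have hp' := Finset.HasAntidiagonal.mem_antidiagonal.1 hp
  rcases h _ _ hp' with h | h
  · rw [h, schouten_zero_left hp']
  · rw [h, schouten_zero_right hp']

theorem bracket_mem_sOrders {X Y : TQ n Q} (hX : X ∈ part sOrders) (hY : Y ∈ part sOrders) :
    bracket X Y ∈ part sOrders := by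
  intro r hr
  refine bracket_apply_eq_zero fun k m h => ?_
  simp only [sOrders, Set.mem_ofPred_eq] at hr
  by_cases hk : k ≤ 1
  · exact Or.inr (hY m (by simp only [sOrders, Set.mem_ofPred_eq]; omega))
  · exact Or.inl (hX k hk)

theorem bracket_mem_nOrders {X Y : TQ n Q} (hX : X ∈ part nOrders) (hY : Y ∈ part nOrders) :
    bracket X Y ∈ part nOrders := by
  intro r hr
  refine bracket_apply_eq_zero fun k m h => ?_
  simp only [nOrders, Set.mem_ofPred_eq] at hr
  by_cases hk : 2 ≤ k
  · exact Or.inr (hY m (by simp only [nOrders, Set.mem_ofPred_eq]; omega))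
  · exact Or.inl (hX k hk)

theorem TQ.proj_mem (S : Set ℕ) (X : TQ n Q) : X.proj S ∈ part S := fun _ hk => if_neg hk

theorem TQDual.proj_mem (S : Set ℕ) (A : TQDual n Q) : A.proj S ∈ dualPart S := fun _ hk => if_neg hk

theorem nOrders_iff_not_sOrders (k : ℕ) : k ∈ nOrders ↔ k ∉ sOrders := by
  simp only [nOrders, sOrders, Set.mem_ofPred_eq]
  omega

theorem TQ.eq_proj_add_proj (X : TQ n Q) : X = X.proj sOrders + X.proj nOrders := by
  funext k
  by_cases h : k ∈ sOrders <;> simp [TQ.proj, h, nOrders_iff_not_sOrders]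

theorem mixed_bracket {η ξ : TQ n Q} (hη : η ∈ part nOrders) (hξ : ξ ∈ part sOrders) :
    leftAct η ξ 0 = 0 ∧ leftAct η ξ 1 = schouten 1 (η 2) (ξ 0) ∧
      ∀ k, 2 ≤ k → rightAct η ξ k = schouten k (η (k + 1)) (ξ 0) - schouten k (ξ 1) (η k) := by
  have hη' : ∀ k, k ≤ 1 → η k = 0 := fun k hk => hη k (by
    simp only [nOrders, Set.mem_ofPred_eq]; omega)
  have hξ' : ∀ k, 2 ≤ k → ξ k = 0 := fun k hk => hξ k (by
    simp only [sOrders, Set.mem_ofPred_eq]; omega)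
  have hzero : ∀ {r : ℕ}, ∀ p ∈ Finset.HasAntidiagonal.antidiagonal (r + 1), p.1 ≤ 1 ∨ 2 ≤ p.2 →
      schouten r (η p.1) (ξ p.2) = 0 := by
    intro r p hp h
    have hp' := Finset.HasAntidiagonal.mem_antidiagonal.1 hp
    rcases h with h | h
    · rw [hη' _ h, schouten_zero_left hp']
    · rw [hξ' _ h, schouten_zero_right hp']
  refine ⟨?_, ?_, fun k hk => ?_⟩
  · rw [leftAct, TQ.proj, if_pos (by simp [sOrders])]
    refine bracket_apply_eq_zero fun k m h => Or.inl (hη' k (by omega))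
  · rw [leftAct, TQ.proj, if_pos (by simp [sOrders])]
    change ∑ p ∈ Finset.HasAntidiagonal.antidiagonal (1 + 1), schouten 1 (η p.1) (ξ p.2) = _
    rw [Finset.sum_eq_single_of_mem (2, 0) (by simp)]
    rintro ⟨a, b⟩ hp hne
    refine hzero _ hp ?_
    rw [Finset.HasAntidiagonal.mem_antidiagonal] at hp
    simp only [ne_eq, Prod.mk.injEq] at hne hp ⊢
    omega
  · rw [rightAct, TQ.proj, if_pos (by simpa [nOrders] using hk)]
    change ∑ p ∈ Finset.HasAntidiagonal.antidiagonal (k + 1), schouten k (η p.1) (ξ p.2) = _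
    rw [schouten_antisymm (by omega) (ξ 1) (η k),
      show ∀ a b : Contra n Q k, a - -b = a + b from fun a b => sub_neg_eq_add a b]
    have hne : ((k + 1, 0) : ℕ × ℕ) ≠ (k, 1) := by simp
    rw [← Finset.sum_pair (f := fun p : ℕ × ℕ => schouten k (η p.1) (ξ p.2)) hne]
    symm
    refine Finset.sum_subset (fun p hp => ?_) ?_
    · simp only [Finset.mem_insert, Finset.mem_singleton] at hp
      rcases hp with rfl | rfl <;> simp
    · rintro ⟨a, b⟩ hp hnp
      refine hzero _ hp ?_
      rw [Finset.HasAntidiagonal.mem_antidiagonal] at hp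
      simp only [Finset.mem_insert, Finset.mem_singleton, Prod.mk.injEq] at hnp hp ⊢
      omega

theorem bracket_eq_leftAct_add_rightAct (η ξ : TQ n Q) :
    bracket η ξ = leftAct η ξ + rightAct η ξ := TQ.eq_proj_add_proj _

theorem matched_bracket (ξ ξ' η η' : TQ n Q) : bracket (ξ + η) (ξ' + η') =
    (bracket ξ ξ' + leftAct η ξ' - leftAct η' ξ) +
      (bracket η η' + rightAct η ξ' - rightAct η' ξ) := by
  rw [bracket_add_left, bracket_add_right, bracket_add_right, bracket_antisymm ξ η',
    bracket_eq_leftAct_add_rightAct η' ξ, bracket_eq_leftAct_add_rightAct η ξ']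
  abel

end SymTensor
end

noncomputable section
namespace SymTensor

/-! ### The pairing and representing elements -/

variable {n : ℕ} {Q : Type*} [TopologicalSpace Q] [ChartedSpace (EuclideanSpace ℝ (Fin n)) Q]
  [IsManifold (𝓡 n) ∞ Q] [MeasurableSpace Q] [BorelSpace Q] {μ : Measure Q}

theorem integral_fullContraction_eq_zero {k : ℕ} {A : Co n Q k} {X : Contra n Q k}
    (h : A = 0 ∨ X = 0) : ∫ q, fullContraction A.1 X.1 q ∂μ = 0 := by
  rcases h with rfl | rfl <;> simp [fullContraction]

theorem pairing_eq_sum {A : TQDual n Q} {X : TQ n Q} {N : ℕ} (h : ∀ k, N ≤ k → A k = 0 ∨ X k = 0) :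
    pairing μ A X = ∑ k ∈ Finset.range N, ∫ q, fullContraction (A k).1 (X k).1 q ∂μ := by
  refine finsum_eq_sum_of_support_subset _ fun k hk => ?_
  by_contra hkN
  rw [Finset.mem_coe, Finset.mem_range, not_lt] at hkN
  exact hk (integral_fullContraction_eq_zero (h k hkN))

theorem pairing_neg_left (A : TQDual n Q) (X : TQ n Q) : pairing μ (-A) X = -pairing μ A X := by
  simp only [pairing]
  rw [← finsum_neg_distrib]
  refine finsum_congr fun k => ?_
  rw [← integral_neg]
  congr 1
  funext q
  simp [fullContraction]

theorem pairing_neg_right (A : TQDual n Q) (X : TQ n Q) : pairing μ A (-X) = -pairing μ A X := by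
  simp only [pairing]
  rw [← finsum_neg_distrib]
  refine finsum_congr fun k => ?_
  rw [← integral_neg]
  congr 1
  funext q
  simp [fullContraction]

theorem pairing_proj_right {S : Set ℕ} {A : TQDual n Q} (hA : A ∈ dualPart S) (X : TQ n Q) :
    pairing μ A (X.proj S) = pairing μ A X := by
  refine finsum_congr fun k => ?_
  by_cases hk : k ∈ S
  · simp [TQ.proj, hk]
  · rw [integral_fullContraction_eq_zero (Or.inl (hA k hk)),
      integral_fullContraction_eq_zero (Or.inl (hA k hk))]

theorem pairing_proj_left {S : Set ℕ} (A : TQDual n Q) {X : TQ n Q} (hX : X ∈ part S) :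
    pairing μ (A.proj S) X = pairing μ A X := by
  refine finsum_congr fun k => ?_
  by_cases hk : k ∈ S
  · simp [TQDual.proj, hk]
  · rw [integral_fullContraction_eq_zero (Or.inr (hX k hk)),
      integral_fullContraction_eq_zero (Or.inr (hX k hk))]

/-- The element of `𝔗Q` concentrated in the single order `m`. -/
theorem exists_single {m : ℕ} (Y : Contra n Q m) : ∃ Z : TQ n Q, Z m = Y ∧ ∀ k, k ≠ m → Z k = 0 :=
  ⟨fun k => if h : k = m then h ▸ Y else 0, dif_pos rfl, fun _ hk => dif_neg hk⟩

theorem TQ.isFinite_iff {X : TQ n Q} : X.IsFinite ↔ ∃ N, ∀ k, N ≤ k → X k = 0 := by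
  refine ⟨fun h => ?_, fun ⟨N, hN⟩ => (Set.finite_lt_nat N).subset fun k hk => ?_⟩
  · obtain ⟨N, hN⟩ := h.bddAbove
    refine ⟨N + 1, fun k hk => ?_⟩
    by_contra h0
    have := hN h0
    omega
  · by_contra h0
    exact hk (hN k (not_lt.1 h0))

theorem TQDual.isFinite_iff {A : TQDual n Q} : A.IsFinite ↔ ∃ N, ∀ k, N ≤ k → A k = 0 := by
  refine ⟨fun h => ?_, fun ⟨N, hN⟩ => (Set.finite_lt_nat N).subset fun k hk => ?_⟩
  · obtain ⟨N, hN⟩ := h.bddAbove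
    refine ⟨N + 1, fun k hk => ?_⟩
    by_contra h0
    have := hN h0
    omega
  · by_contra h0
    exact hk (hN k (not_lt.1 h0))

/-- Uniqueness is tested order by order, on fields concentrated in a single order. -/
theorem represents_unique [T2Space Q] (hμ : IsVolume n μ) {S : Set ℕ} {F : TQ n Q → ℝ}
    {D D' : TQDual n Q} (h : Represents μ S F D) (h' : Represents μ S F D') : D = D' := by
  funext m
  by_cases hm : m ∈ S
  · refine eq_of_forall_integral_eq hμ fun Y => ?_
    obtain ⟨Z, hZ, hZ0⟩ := exists_single Y
    have hZS : Z ∈ part S := fun k hk => hZ0 k fun h => hk (h ▸ hm)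
    have hZf : Z.IsFinite := TQ.isFinite_iff.2 ⟨m + 1, fun k hk => hZ0 k (by omega)⟩
    have key : ∀ B : TQDual n Q, pairing μ B Z = ∫ q, fullContraction (B m).1 Y.1 q ∂μ := by
      intro B
      rw [pairing, finsum_eq_single _ m fun k hk => integral_fullContraction_eq_zero
        (Or.inr (hZ0 k hk)), hZ]
    rw [← key, ← key, h.2 Z hZS hZf, h'.2 Z hZS hZf]
  · rw [h.1 m hm, h'.1 m hm]

theorem representer_eq [T2Space Q] (hμ : IsVolume n μ) {S : Set ℕ} {F : TQ n Q → ℝ}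
    {D : TQDual n Q} (h : Represents μ S F D) : representer μ S F = D := by
  have hex : ∃ B, Represents μ S F B := ⟨D, h⟩
  rw [representer, dif_pos hex]
  exact represents_unique hμ hex.choose_spec h

theorem Represents.neg {S : Set ℕ} {F G : TQ n Q → ℝ} {D : TQDual n Q} (h : Represents μ S F D)
    (hG : ∀ Y, G Y = -F Y) : Represents μ S G (-D) := by
  refine ⟨fun k hk => ?_, fun Y hY hYf => ?_⟩
  · have : (-D) k = -(D k) := rfl
    rw [this, h.1 k hk]
    exact neg_zero (G := Co n Q k)
  · rw [pairing_neg_left, h.2 Y hY hYf, hG]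

/-- Reindexing the sum over `m + k = r + 1`, `r ≥ 0`, by `(m, k)`: only `(0, 0)` is missed. -/
theorem sum_antidiagonal_eq_sum_rect {M N : ℕ} (g : ℕ × ℕ → ℝ) (h0 : g (0, 0) = 0)
    (h1 : ∀ m k, M ≤ m → g (m, k) = 0) (h2 : ∀ m k, N ≤ k → g (m, k) = 0) :
    ∑ r ∈ Finset.range (M + N), ∑ p ∈ Finset.HasAntidiagonal.antidiagonal (r + 1), g p =
      ∑ m ∈ Finset.range M, ∑ k ∈ Finset.range N, g (m, k) := by
  have hl : ∑ r ∈ Finset.range (M + N), ∑ p ∈ Finset.HasAntidiagonal.antidiagonal (r + 1), g p =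
      ∑ r ∈ Finset.range (M + N + 1), ∑ p ∈ Finset.HasAntidiagonal.antidiagonal r, g p := by
    rw [Finset.sum_range_succ' _ (M + N)]
    simp [h0]
  rw [hl, ← Finset.sum_product' (f := fun m k => g (m, k)),
    ← Finset.sum_fiberwise_of_maps_to (t := Finset.range (M + N + 1))
      (g := fun p : ℕ × ℕ => p.1 + p.2)]
  · refine Finset.sum_congr rfl fun r _ => ?_
    symm
    refine Finset.sum_subset (fun p hp => ?_) fun p hp hnp => ?_
    · rw [Finset.mem_filter] at hp
      exact Finset.HasAntidiagonal.mem_antidiagonal.2 hp.2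
    · rw [Finset.HasAntidiagonal.mem_antidiagonal] at hp
      by_cases hM : M ≤ p.1
      · exact h1 _ _ hM
      · refine h2 _ _ ?_
        by_contra hN
        exact hnp (Finset.mem_filter.2 ⟨Finset.mem_product.2
          ⟨Finset.mem_range.2 (by omega), Finset.mem_range.2 (by omega)⟩, hp⟩)
  · intro p hp
    have := Finset.mem_product.1 hp
    simp only [Finset.mem_range] at this ⊢
    omega

/-- The order `m` contribution of `X^k` and `A_{m + k - 1}` to the coadjoint action. For `m = k = 0`
the index is the truncated `0`, and the term vanishes (`coadTerm_zero_zero`). -/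
def coadTerm (X : TQ n Q) (A : TQDual n Q) (e : Chart n Q) (w : Coord n → ℝ) (m k : ℕ) : Comp n m :=
  lieDivC m w (X.comp e k) (A.comp e (m + k - 1))

theorem coadTerm_eq_zero {X : TQ n Q} {A : TQDual n Q} {e : Chart n Q} {w : Coord n → ℝ} {m k : ℕ}
    (h : X k = 0 ∨ A (m + k - 1) = 0) (I : Fin m → Fin n) (y : Coord n) :
    coadTerm X A e w m k I y = 0 := by
  rcases h with h | h
  · have : X.comp e k = 0 := by
      funext I y
      simp [TQ.comp, h, contraComp]
    rw [coadTerm, this, lieDivC_zero_left]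
  · have : A.comp e (m + k - 1) = 0 := by
      funext I y
      simp [TQDual.comp, h, coComp]
    rw [coadTerm, this, lieDivC_zero_right]

theorem coadTerm_zero_zero (X : TQ n Q) (A : TQDual n Q) (e : Chart n Q) (w : Coord n → ℝ)
    (I : Fin 0 → Fin n) (y : Coord n) : coadTerm X A e w 0 0 I y = 0 := by
  simp [coadTerm, lieDivC, lieC, starC, astC, contractC, divC]

theorem exists_bound_of_isFinite {X : TQ n Q} {A : TQDual n Q} (h : X.IsFinite ∨ A.IsFinite) :
    ∃ N, ∀ m k, N ≤ k → X k = 0 ∨ A (m + k - 1) = 0 := by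
  rcases h with h | h
  · obtain ⟨N, hN⟩ := TQ.isFinite_iff.1 h
    exact ⟨N, fun m k hk => Or.inl (hN k hk)⟩
  · obtain ⟨N, hN⟩ := TQDual.isFinite_iff.1 h
    exact ⟨N + 1, fun m k hk => Or.inr (hN _ (by omega))⟩

theorem coadTerm_support_finite {X : TQ n Q} {A : TQDual n Q} (h : X.IsFinite ∨ A.IsFinite)
    (e : Chart n Q) (w : Coord n → ℝ) (m : ℕ) (I : Fin m → Fin n) (y : Coord n) :
    (Function.support fun k => coadTerm X A e w m k I y).Finite := by
  obtain ⟨N, hN⟩ := exists_bound_of_isFinite h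
  refine (Set.finite_lt_nat N).subset fun k hk => ?_
  by_contra h0
  exact hk (coadTerm_eq_zero (hN m k (not_lt.1 h0)) I y)

/-- The homogeneous coadjoint field attached to `X^k` and `A_{m + k - 1}`. The case `m = k = 0`, where
`m + k - 1` is truncated and which no bracket produces, is given the value `0`. -/
theorem exists_coadTerm_field [T2Space Q] [SecondCountableTopology Q] (hμ : IsVolume n μ)
    (X : TQ n Q) (A : TQDual n Q) (m k : ℕ) :
    ∃ D : Co n Q m, (m + k ≠ 0 → ∀ Y : Contra n Q m,
      ∫ q, fullContraction (A (m + k - 1)).1 (schouten (m + k - 1) Y (X k)).1 q ∂μ =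
        ∫ q, fullContraction D.1 Y.1 q ∂μ) ∧ (m + k = 0 → D = 0) ∧
      ∀ e ∈ IsManifold.maximalAtlas (𝓡 n) ∞ Q, ∀ w, IsDensity μ e w → ∀ y ∈ e.target, ∀ I,
        coComp e D.1 I y = coadTerm X A e w m k I y := by
  by_cases h : m + k = 0
  · obtain ⟨rfl, rfl⟩ : m = 0 ∧ k = 0 := by omega
    refine ⟨0, fun h => absurd rfl h, fun _ => rfl, fun e he w hw y hy I => ?_⟩
    rw [coadTerm_zero_zero]
    simp [coComp]
  · have hp : (m + k - 1) + 1 = m + k := by omega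
    obtain ⟨D, hD⟩ := exists_dual hμ hp (A (m + k - 1)) (X k)
    exact ⟨D, fun _ => hD, fun h' => absurd h' h, fun e he w hw y hy I =>
      coComp_eq_lieDivC_of_dual he hw hp hD hy I⟩

/-- The functional `Y ↦ ⟨A, [Y, X]⟩` on `part S` is represented by a field whose order `m ∈ S` is
`∑_k (L_{X^k} A_{m+k-1} + div X^k ⌟ A_{m+k-1})` in every chart. -/
theorem exists_represents_coadFun [T2Space Q] [SecondCountableTopology Q] (hμ : IsVolume n μ)
    (S : Set ℕ) {X : TQ n Q} {A : TQDual n Q} (hfin : X.IsFinite ∨ A.IsFinite) :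
    ∃ D : TQDual n Q, Represents μ S (coadFun μ X A) D ∧
      ∀ e ∈ IsManifold.maximalAtlas (𝓡 n) ∞ Q, ∀ w, IsDensity μ e w → ∀ y ∈ e.target, ∀ m ∈ S, ∀ I,
        D.comp e m I y = ∑ᶠ k, coadTerm X A e w m k I y := by
  classical
  obtain ⟨N, hN⟩ := exists_bound_of_isFinite hfin
  choose E hE1 hE0 hE2 using exists_coadTerm_field hμ X A
  let D : TQDual n Q := fun m => if m ∈ S then ∑ k ∈ Finset.range N, E m k else 0
  have hDS : ∀ m ∈ S, D m = ∑ k ∈ Finset.range N, E m k := fun m hm => if_pos hm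
  have hDS0 : ∀ m ∉ S, D m = 0 := fun m hm => if_neg hm
  refine ⟨D, ⟨hDS0, fun Y hY hYf => ?_⟩, fun e he w hw y hy m hm I => ?_⟩
  · obtain ⟨M, hM⟩ := TQ.isFinite_iff.1 hYf
    set g : ℕ × ℕ → ℝ := fun p => ∫ q, fullContraction (E p.1 p.2).1 (Y p.1).1 q ∂μ with hg
    have h00 : g (0, 0) = 0 := integral_fullContraction_eq_zero (Or.inl (hE0 0 0 rfl))
    have hg1 : ∀ m k, M ≤ m → g (m, k) = 0 := fun m k hm =>
      integral_fullContraction_eq_zero (Or.inr (hM m hm))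
    have hg2 : ∀ m k, N ≤ k → g (m, k) = 0 := fun m k hk => by
      by_cases h : m + k = 0
      · exact integral_fullContraction_eq_zero (Or.inl (hE0 m k h))
      · simp only [hg]
        rw [← hE1 m k h]
        refine integral_fullContraction_eq_zero ((hN m k hk).symm.imp id fun h0 => ?_)
        rw [h0, schouten_zero_right (by omega)]
    have hA : ∀ r, M + N ≤ r → A r = 0 ∨ bracket Y X r = 0 := by
      intro r hr
      by_cases hAr : A r = 0
      · exact Or.inl hAr
      · refine Or.inr (bracket_apply_eq_zero fun m k hmk => ?_)
        by_cases hm : M ≤ m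
        · exact Or.inl (hM m hm)
        · refine Or.inr ((hN m k (by omega)).resolve_right ?_)
          rwa [show m + k - 1 = r by omega]
    rw [coadFun, pairing_eq_sum hA, pairing_eq_sum fun k hk => Or.inr (hM k hk)]
    have hl : ∀ r, ∫ q, fullContraction (A r).1 (bracket Y X r).1 q ∂μ =
        ∑ p ∈ Finset.HasAntidiagonal.antidiagonal (r + 1), g p := by
      intro r
      simp only [bracket, fullContraction_sum_right]
      rw [integral_finsetSum _ fun p _ => integrable_fullContraction hμ (A r) _]
      refine Finset.sum_congr rfl fun p hp => ?_
      rw [Finset.HasAntidiagonal.mem_antidiagonal] at hp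
      obtain rfl : r = p.1 + p.2 - 1 := by omega
      exact hE1 p.1 p.2 (by omega) (Y p.1)
    have hr : ∀ m, ∫ q, fullContraction (D m).1 (Y m).1 q ∂μ = ∑ k ∈ Finset.range N, g (m, k) := by
      intro m
      by_cases hm : m ∈ S
      · rw [hDS m hm]
        simp only [fullContraction_sum_left]
        rw [integral_finsetSum _ fun k _ => integrable_fullContraction hμ (E m k) (Y m)]
      · rw [integral_fullContraction_eq_zero (Or.inr (hY m hm))]
        exact (Finset.sum_eq_zero fun k _ =>
          integral_fullContraction_eq_zero (Or.inr (hY m hm))).symm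
    simp_rw [hl, hr]
    exact (sum_antidiagonal_eq_sum_rect g h00 hg1 hg2).symm
  · rw [finsum_eq_sum_of_support_subset (s := Finset.range N)]
    · rw [TQDual.comp, hDS m hm]
      simp only [coComp, Submodule.coe_sum, Finset.sum_apply, sum_apply]
      exact Finset.sum_congr rfl fun k _ => hE2 m k e he w hw y hy I
    · intro k hk
      by_contra h0
      rw [Finset.mem_coe, Finset.mem_range, not_lt] at h0
      exact hk (coadTerm_eq_zero (hN m k h0) I y)

end SymTensor
end

noncomputable section
namespace SymTensor

/-! ### The dual actions -/

variable {n : ℕ} {Q : Type*} [TopologicalSpace Q] [ChartedSpace (EuclideanSpace ℝ (Fin n)) Q]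
  [IsManifold (𝓡 n) ∞ Q] [MeasurableSpace Q] [BorelSpace Q] {μ : Measure Q}

theorem TQ.IsFinite.proj {X : TQ n Q} (h : X.IsFinite) (S : Set ℕ) : (X.proj S).IsFinite :=
  Set.Finite.subset h fun k hk h0 => hk (by simp [TQ.proj, h0])

theorem TQDual.IsFinite.proj {A : TQDual n Q} (h : A.IsFinite) (S : Set ℕ) : (A.proj S).IsFinite :=
  Set.Finite.subset h fun k hk h0 => hk (by simp [TQDual.proj, h0])

theorem dualLeftFun_eq {B : TQDual n Q} (hB : B ∈ dualPart sOrders) (η Y : TQ n Q) :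
    dualLeftFun μ B η Y = -coadFun μ η B Y := by
  rw [dualLeftFun, leftAct, pairing_proj_right hB, bracket_antisymm, pairing_neg_right, coadFun]

theorem crossBFun_eq {B : TQDual n Q} (hB : B ∈ dualPart sOrders) (ξ : TQ n Q) :
    crossBFun μ ξ B = coadFun μ ξ B := by
  funext Y
  rw [crossBFun, leftAct, pairing_proj_right hB, coadFun]

theorem dualRightFun_eq {C : TQDual n Q} (hC : C ∈ dualPart nOrders) (ξ : TQ n Q) :
    dualRightFun μ ξ C = coadFun μ ξ C := by
  funext Y
  rw [dualRightFun, rightAct, pairing_proj_right hC, coadFun]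

theorem crossAFun_eq {C : TQDual n Q} (hC : C ∈ dualPart nOrders) (η Y : TQ n Q) :
    crossAFun μ η C Y = -coadFun μ η C Y := by
  rw [crossAFun, rightAct, pairing_proj_right hC, bracket_antisymm, pairing_neg_right, coadFun]

/-- `D` has the components `c m` in the orders `m ∈ S`, in every chart, and no other orders. -/
def HasComponents (μ : Measure Q) (S : Set ℕ) (D : TQDual n Q)
    (c : Chart n Q → (Coord n → ℝ) → ∀ m : ℕ, Comp n m) : Prop :=
  D ∈ dualPart S ∧ ∀ e ∈ IsManifold.maximalAtlas (𝓡 n) ∞ Q, ∀ w, IsDensity μ e w →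
    ∀ y ∈ e.target, ∀ m ∈ S, ∀ I, D.comp e m I y = c e w m I y

theorem representer_coadFun [T2Space Q] [SecondCountableTopology Q] (hμ : IsVolume n μ)
    (S : Set ℕ) {X : TQ n Q} {A : TQDual n Q} (hfin : X.IsFinite ∨ A.IsFinite) {F : TQ n Q → ℝ}
    (hF : F = coadFun μ X A) :
    (∃! D, Represents μ S F D) ∧
      HasComponents μ S (representer μ S F) fun e w m I y => ∑ᶠ k, coadTerm X A e w m k I y := by
  subst hF
  obtain ⟨D, hD, hc⟩ := exists_represents_coadFun hμ S hfin
  refine ⟨⟨D, hD, fun D' hD' => represents_unique hμ hD' hD⟩, ?_⟩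
  rw [representer_eq hμ hD]
  exact ⟨hD.1, hc⟩

theorem representer_neg_coadFun [T2Space Q] [SecondCountableTopology Q] (hμ : IsVolume n μ)
    (S : Set ℕ) {X : TQ n Q} {A : TQDual n Q} (hfin : X.IsFinite ∨ A.IsFinite) {F : TQ n Q → ℝ}
    (hF : ∀ Y, F Y = -coadFun μ X A Y) :
    (∃! D, Represents μ S F D) ∧
      HasComponents μ S (representer μ S F) fun e w m I y => -∑ᶠ k, coadTerm X A e w m k I y := by
  obtain ⟨D, hD, hc⟩ := exists_represents_coadFun hμ S hfin
  have hD' := hD.neg hF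
  refine ⟨⟨-D, hD', fun D'' hD'' => represents_unique hμ hD'' hD'⟩, ?_⟩
  rw [representer_eq hμ hD']
  refine ⟨hD'.1, fun e he w hw y hy m hm I => ?_⟩
  have : (-D).comp e m I y = -(D.comp e m I y) := rfl
  rw [this, hc e he w hw y hy m hm I]

theorem coadTerm_proj (S S' : Set ℕ) [DecidablePred (· ∈ S)] [DecidablePred (· ∈ S')]
    (X : TQ n Q) (A : TQDual n Q) (e : Chart n Q) (w : Coord n → ℝ)
    (m k : ℕ) (I : Fin m → Fin n) (y : Coord n) :
    coadTerm (X.proj S) (A.proj S') e w m k I y =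
      if k ∈ S ∧ m + k - 1 ∈ S' then coadTerm X A e w m k I y else 0 := by
  split_ifs with h
  · have h1 : (X.proj S).comp e k = X.comp e k := by simp [TQ.comp, TQ.proj, h.1]
    have h2 : (A.proj S').comp e (m + k - 1) = A.comp e (m + k - 1) := by
      simp [TQDual.comp, TQDual.proj, h.2]
    rw [coadTerm, h1, h2, coadTerm]
  · refine coadTerm_eq_zero ?_ I y
    by_cases hk : k ∈ S
    · exact Or.inr (if_neg fun h' => h ⟨hk, h'⟩)
    · exact Or.inl (if_neg hk)

theorem finsum_eq_add_of_two {f : ℕ → ℝ} (h : ∀ k, 2 ≤ k → f k = 0) : ∑ᶠ k, f k = f 0 + f 1 := by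
  rw [finsum_eq_sum_of_support_subset (s := Finset.range 2)]
  · simp [Finset.sum_range_succ]
  · intro k hk
    by_contra h0
    rw [Finset.mem_coe, Finset.mem_range, not_lt] at h0
    exact hk (h k h0)

theorem finsum_eq_finsum_succ {f : ℕ → ℝ} (h : f 0 = 0) : ∑ᶠ k, f k = ∑ᶠ k, f (k + 1) := by
  rw [← finsum_mem_range (g := fun k => k + 1) (add_left_injective 1), ← finsum_mem_univ]
  refine finsum_mem_inter_support_eq f _ _ (Set.ext fun k => ?_)
  simp only [Set.mem_inter_iff, Set.mem_univ, true_and, Set.mem_range, Function.mem_support]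
  refine ⟨fun hk => ⟨⟨k - 1, Nat.sub_add_cancel (Nat.pos_of_ne_zero ?_)⟩, hk⟩, fun hk => hk.2⟩
  rintro rfl
  exact hk h

/-! ### Components of low order -/

theorem lieDivC_of_order_zero {m p : ℕ} (w : Coord n → ℝ) (X : Comp n 0) (A : Comp n p)
    (I : Fin m → Fin n) (y : Coord n) : lieDivC m w X A I y = starC m A X I y := by
  simp [lieDivC, lieC, astC, contractC, divC]

theorem lieDivC_of_order_one {m : ℕ} (w : Coord n → ℝ) (X : Comp n 1) (A : Comp n m)
    (I : Fin m → Fin n) (y : Coord n) :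
    lieDivC m w X A I y = lieC m X A I y + divC w X Fin.elim0 y * A I y := by
  have : contractC m (divC w X) A I y = divC w X Fin.elim0 y * A I y := by
    change (if h : m = m + 0 then ∑ J : Fin 0 → Fin n, divC w X J y *
      A (Fin.append I J ∘ Fin.cast h) y else 0) = _
    rw [dif_pos (Nat.add_zero m).symm, Fintype.sum_unique]
    have h1 : (Fin.append I default ∘ Fin.cast (Nat.add_zero m).symm : Fin m → Fin n) = I :=
      funext fun i => Fin.append_left I _ i
    have h2 : (default : Fin 0 → Fin n) = Fin.elim0 := Subsingleton.elim _ _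
    rw [h1, h2]
  rw [lieDivC, this]

theorem lieDivC_zero_covariant {k p : ℕ} (w : Coord n → ℝ) (X : Comp n k) (A : Comp n p)
    (I : Fin 0 → Fin n) (y : Coord n) :
    lieDivC 0 w X A I y = astC 0 X A I y + contractC 0 (divC w X) A I y := by
  simp [lieDivC, lieC, starC]

theorem starC_one (X A : Comp n 0) (I : Fin 1 → Fin n) (y : Coord n) :
    starC 1 A X I y = A Fin.elim0 y * partialD (I 0) (X Fin.elim0) y := by
  have h : ∀ J : Fin 0 → Fin n, J = Fin.elim0 := fun J => Subsingleton.elim _ _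
  simp [starC, symmetrize, h]

/-- The coadjoint action of `𝔗Q` splits according to the parts of `X` and `A` it involves. In the
orders of `𝔰` only the first three sums contribute: they are `ad*` of `𝔰` and, up to sign, the dual
action and the cross action of `𝔫`. In the orders of `𝔫` the second sum vanishes, and the others are
the cross action of `𝔰`, `ad*` of `𝔫` and the dual action of `𝔰`. -/
theorem finsum_coadTerm_split {X : TQ n Q} {A : TQDual n Q} (hfin : X.IsFinite ∨ A.IsFinite)
    (e : Chart n Q) (w : Coord n → ℝ) (m : ℕ) (I : Fin m → Fin n) (y : Coord n) :
    ∑ᶠ k, coadTerm X A e w m k I y =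
      ((∑ᶠ k, coadTerm (X.proj sOrders) (A.proj sOrders) e w m k I y +
        ∑ᶠ k, coadTerm (X.proj nOrders) (A.proj sOrders) e w m k I y) +
        ∑ᶠ k, coadTerm (X.proj nOrders) (A.proj nOrders) e w m k I y) +
        ∑ᶠ k, coadTerm (X.proj sOrders) (A.proj nOrders) e w m k I y := by
  classical
  have hf : ∀ S S' : Set ℕ,
      (Function.support fun k => coadTerm (X.proj S) (A.proj S') e w m k I y).Finite :=
    fun S S' => coadTerm_support_finite (hfin.imp (·.proj S) (·.proj S')) e w m I y
  rw [← finsum_add_distrib (hf _ _) (hf _ _), ← finsum_add_distrib _ (hf _ _),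
    ← finsum_add_distrib _ (hf _ _)]
  · refine finsum_congr fun k => ?_
    simp only [coadTerm_proj, nOrders_iff_not_sOrders]
    by_cases h1 : k ∈ sOrders <;> by_cases h2 : m + k - 1 ∈ sOrders <;> simp [h1, h2]
  · exact (((hf _ _).union (hf _ _)).subset (Function.support_add _ _)).union (hf _ _) |>.subset
      (Function.support_add _ _)
  · exact ((hf _ _).union (hf _ _)).subset (Function.support_add _ _)

theorem TQDual.ext_comp (hμ : IsVolume n μ) {A B : TQDual n Q} (h : ∀ e ∈ IsManifold.maximalAtlas (𝓡 n) ∞ Q,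
    ∀ w, IsDensity μ e w → ∀ y ∈ e.target, ∀ m I, A.comp e m I y = B.comp e m I y) : A = B := by
  funext m
  refine co_eq_of_comp fun e he y hy I => ?_
  obtain ⟨w, hw⟩ := hμ e he
  exact h e he w hw y hy m I

end SymTensor
end

noncomputable section
namespace SymTensor

/-! ### The matched Euler–Poincaré equations -/

variable {n : ℕ} {Q : Type*} [TopologicalSpace Q] [ChartedSpace (EuclideanSpace ℝ (Fin n)) Q]
  [IsManifold (𝓡 n) ∞ Q] [MeasurableSpace Q] [BorelSpace Q] {μ : Measure Q}

theorem mem_sOrders {k : ℕ} : k ∈ sOrders ↔ k ≤ 1 := Iff.rfl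

theorem mem_nOrders {k : ℕ} : k ∈ nOrders ↔ 2 ≤ k := Iff.rfl

/-- Components of the dual operations built from the parts of `X` and `A`. -/
theorem dual_components [T2Space Q] [SecondCountableTopology Q] (hμ : IsVolume n μ) {X : TQ n Q}
    {A : TQDual n Q} (hfin : X.IsFinite ∨ A.IsFinite) :
    HasComponents μ Set.univ (coad μ Set.univ X A)
      (fun e w m I y => ∑ᶠ k, coadTerm X A e w m k I y) ∧
    HasComponents μ sOrders (coad μ sOrders (X.proj sOrders) (A.proj sOrders))
      (fun e w m I y => ∑ᶠ k, coadTerm (X.proj sOrders) (A.proj sOrders) e w m k I y) ∧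
    HasComponents μ nOrders (coad μ nOrders (X.proj nOrders) (A.proj nOrders))
      (fun e w m I y => ∑ᶠ k, coadTerm (X.proj nOrders) (A.proj nOrders) e w m k I y) ∧
    HasComponents μ sOrders (dualLeft μ (A.proj sOrders) (X.proj nOrders))
      (fun e w m I y => -∑ᶠ k, coadTerm (X.proj nOrders) (A.proj sOrders) e w m k I y) ∧
    HasComponents μ nOrders (dualRight μ (X.proj sOrders) (A.proj nOrders))
      (fun e w m I y => ∑ᶠ k, coadTerm (X.proj sOrders) (A.proj nOrders) e w m k I y) ∧
    HasComponents μ sOrders (crossA μ (X.proj nOrders) (A.proj nOrders))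
      (fun e w m I y => -∑ᶠ k, coadTerm (X.proj nOrders) (A.proj nOrders) e w m k I y) ∧
    HasComponents μ nOrders (crossB μ (X.proj sOrders) (A.proj sOrders))
      (fun e w m I y => ∑ᶠ k, coadTerm (X.proj sOrders) (A.proj sOrders) e w m k I y) := by
  have hf : ∀ S S' : Set ℕ, (X.proj S).IsFinite ∨ (A.proj S').IsFinite := fun S S' =>
    hfin.imp (·.proj S) (·.proj S')
  exact ⟨(representer_coadFun hμ _ hfin rfl).2, (representer_coadFun hμ _ (hf _ _) rfl).2,
    (representer_coadFun hμ _ (hf _ _) rfl).2,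
    (representer_neg_coadFun hμ _ (hf _ _) (dualLeftFun_eq (A.proj_mem _) _)).2,
    (representer_coadFun hμ _ (hf _ _) (dualRightFun_eq (A.proj_mem _) _)).2,
    (representer_neg_coadFun hμ _ (hf _ _) (crossAFun_eq (A.proj_mem _) _)).2,
    (representer_coadFun hμ _ (hf _ _) (crossBFun_eq (A.proj_mem _) _)).2⟩

theorem HasComponents.comp_eq_zero {S : Set ℕ} {D : TQDual n Q}
    {c : Chart n Q → (Coord n → ℝ) → ∀ m : ℕ, Comp n m} (h : HasComponents μ S D c) {m : ℕ}
    (hm : m ∉ S) (e : Chart n Q) (I : Fin m → Fin n) (y : Coord n) : D.comp e m I y = 0 := by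
  simp [TQDual.comp, h.1 m hm, coComp]

theorem TQDual.proj_comp (S : Set ℕ) [DecidablePred (· ∈ S)] (A : TQDual n Q) (e : Chart n Q)
    (m : ℕ) (I : Fin m → Fin n) (y : Coord n) :
    (A.proj S).comp e m I y = if m ∈ S then A.comp e m I y else 0 := by
  by_cases h : m ∈ S
  · simp [TQDual.comp, TQDual.proj, h]
  · simp [TQDual.comp, TQDual.proj, h, coComp]

/-- The `𝔰*`-part of the coadjoint action of `𝔗Q`. -/
theorem coad_proj_sOrders [T2Space Q] [SecondCountableTopology Q] (hμ : IsVolume n μ) {X : TQ n Q}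
    {A : TQDual n Q} (hfin : X.IsFinite ∨ A.IsFinite) :
    -coad μ sOrders (X.proj sOrders) (A.proj sOrders) +
        dualLeft μ (A.proj sOrders) (X.proj nOrders) + crossA μ (X.proj nOrders) (A.proj nOrders) =
      (-coad μ Set.univ X A).proj sOrders := by
  classical
  obtain ⟨h, hs, hn, hl, hr, ha, hb⟩ := dual_components hμ hfin
  refine TQDual.ext_comp hμ fun e he w hw y hy m I => ?_
  rw [TQDual.proj_comp]
  change -(coad μ sOrders (X.proj sOrders) (A.proj sOrders)).comp e m I y +
    (dualLeft μ (A.proj sOrders) (X.proj nOrders)).comp e m I y +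
    (crossA μ (X.proj nOrders) (A.proj nOrders)).comp e m I y =
      if m ∈ sOrders then -(coad μ Set.univ X A).comp e m I y else 0
  split_ifs with hm
  · rw [hs.2 e he w hw y hy m hm, hl.2 e he w hw y hy m hm, ha.2 e he w hw y hy m hm,
      h.2 e he w hw y hy m (Set.mem_univ m)]
    beta_reduce
    rw [finsum_coadTerm_split hfin]
    have h0 : ∑ᶠ k, coadTerm (X.proj sOrders) (A.proj nOrders) e w m k I y = 0 := by
      rw [← finsum_zero (α := ℕ)]
      refine finsum_congr fun k => ?_
      rw [coadTerm_proj, if_neg]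
      rintro ⟨h1, h2⟩
      rw [mem_sOrders] at h1 hm
      rw [mem_nOrders] at h2
      omega
    rw [h0]
    ring
  · rw [hs.comp_eq_zero hm, hl.comp_eq_zero hm, ha.comp_eq_zero hm]
    simp

/-- The `𝔫*`-part of the coadjoint action of `𝔗Q`. -/
theorem coad_proj_nOrders [T2Space Q] [SecondCountableTopology Q] (hμ : IsVolume n μ) {X : TQ n Q}
    {A : TQDual n Q} (hfin : X.IsFinite ∨ A.IsFinite) :
    -coad μ nOrders (X.proj nOrders) (A.proj nOrders) -
        dualRight μ (X.proj sOrders) (A.proj nOrders) - crossB μ (X.proj sOrders) (A.proj sOrders) =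
      (-coad μ Set.univ X A).proj nOrders := by
  classical
  obtain ⟨h, hs, hn, hl, hr, ha, hb⟩ := dual_components hμ hfin
  refine TQDual.ext_comp hμ fun e he w hw y hy m I => ?_
  rw [TQDual.proj_comp]
  change -(coad μ nOrders (X.proj nOrders) (A.proj nOrders)).comp e m I y -
    (dualRight μ (X.proj sOrders) (A.proj nOrders)).comp e m I y -
    (crossB μ (X.proj sOrders) (A.proj sOrders)).comp e m I y =
      if m ∈ nOrders then -(coad μ Set.univ X A).comp e m I y else 0
  split_ifs with hm
  · rw [hn.2 e he w hw y hy m hm, hr.2 e he w hw y hy m hm, hb.2 e he w hw y hy m hm,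
      h.2 e he w hw y hy m (Set.mem_univ m)]
    beta_reduce
    rw [finsum_coadTerm_split hfin]
    have h0 : ∑ᶠ k, coadTerm (X.proj nOrders) (A.proj sOrders) e w m k I y = 0 := by
      rw [← finsum_zero (α := ℕ)]
      refine finsum_congr fun k => ?_
      rw [coadTerm_proj, if_neg]
      rintro ⟨h1, h2⟩
      rw [mem_nOrders] at h1 hm
      rw [mem_sOrders] at h2
      omega
    rw [h0]
    ring
  · rw [hn.comp_eq_zero hm, hr.comp_eq_zero hm, hb.comp_eq_zero hm]
    simp

theorem hasTimeDeriv_iff_proj {A : ℝ → TQDual n Q} {D : TQDual n Q} {t : ℝ} :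
    HasTimeDeriv A D t ↔
      HasTimeDeriv (fun s => (A s).proj sOrders) (D.proj sOrders) t ∧
        HasTimeDeriv (fun s => (A s).proj nOrders) (D.proj nOrders) t := by
  have key : ∀ S : Set ℕ, HasTimeDeriv (fun s => (A s).proj S) (D.proj S) t ↔
      ∀ m ∈ S, ∀ (q : Q) (v : Fin m → TangentSpace (𝓡 n) q),
        HasDerivAt (fun s => (A s m).1 q v) ((D m).1 q v) t := by
    intro S
    refine ⟨fun h m hm q v => ?_, fun h m q v => ?_⟩
    · simpa [TQDual.proj, hm] using h m q v
    · by_cases hm : m ∈ S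
      · simpa [TQDual.proj, hm] using h m hm q v
      · simpa [TQDual.proj, hm] using hasDerivAt_const t (0 : ℝ)
  rw [key, key]
  refine ⟨fun h => ⟨fun m _ => h m, fun m _ => h m⟩, fun h m => ?_⟩
  by_cases hm : m ∈ sOrders
  · exact h.1 m hm
  · exact h.2 m ((nOrders_iff_not_sOrders m).2 hm)

theorem IsVarDeriv.proj {𝔏 : TQ n Q → ℝ} {X : TQ n Q} {A : TQDual n Q}
    (h : IsVarDeriv μ Set.univ 𝔏 X A) (S : Set ℕ) : IsVarDeriv μ S 𝔏 X (A.proj S) := by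
  refine ⟨A.proj_mem S, fun δX hδ hf => ?_⟩
  rw [pairing_proj_left A hδ]
  exact h.2 δX (fun k hk => absurd (Set.mem_univ k) hk) hf

theorem eulerPoincare_iff_matched [T2Space Q] [SecondCountableTopology Q] (hμ : IsVolume n μ)
    {J : Set ℝ} {X : ℝ → TQ n Q} {A : ℝ → TQDual n Q}
    (hfin : ∀ t ∈ J, (X t).IsFinite ∨ (A t).IsFinite) :
    EulerPoincare μ J X A ↔
      MatchedEulerPoincare μ J (fun t => (X t).proj sOrders) (fun t => (X t).proj nOrders)
        (fun t => (A t).proj sOrders) (fun t => (A t).proj nOrders) := by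
  refine forall₂_congr fun t ht => ?_
  rw [coad_proj_sOrders hμ (hfin t ht), coad_proj_nOrders hμ (hfin t ht)]
  exact hasTimeDeriv_iff_proj

/-! ### Explicit formulas for the dual operations -/

theorem dual_comp_formulas [T2Space Q] [SecondCountableTopology Q] (hμ : IsVolume n μ) {X : TQ n Q}
    {A : TQDual n Q} (hfin : X.IsFinite ∨ A.IsFinite) {ξ η : TQ n Q} {B C : TQDual n Q}
    (hξ : ξ = X.proj sOrders) (hη : η = X.proj nOrders) (hB : B = A.proj sOrders)
    (hC : C = A.proj nOrders) {e : Chart n Q} (he : e ∈ IsManifold.maximalAtlas (𝓡 n) ∞ Q)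
    {w : Coord n → ℝ} (hw : IsDensity μ e w) {y : Coord n} (hy : y ∈ e.target) :
    (∀ I, (coad μ sOrders ξ B).comp e 0 I y =
      lieC 0 (X.comp e 1) (A.comp e 0) I y +
        divC w (X.comp e 1) Fin.elim0 y * A.comp e 0 I y) ∧
    (∀ I, (coad μ sOrders ξ B).comp e 1 I y =
      lieC 1 (X.comp e 1) (A.comp e 1) I y +
        divC w (X.comp e 1) Fin.elim0 y * A.comp e 1 I y +
        A.comp e 0 Fin.elim0 y * partialD (I 0) (X.comp e 0 Fin.elim0) y) ∧
    (∀ m, 2 ≤ m → ∀ I, (coad μ nOrders η C).comp e m I y =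
      ∑ᶠ (k : ℕ) (_ : 2 ≤ k), lieDivC m w (X.comp e k) (A.comp e (m + k - 1)) I y) ∧
    (∀ I, (dualLeft μ B η).comp e 0 I y =
      -astC 0 (X.comp e 2) (A.comp e 1) I y
        - contractC 0 (divC w (X.comp e 2)) (A.comp e 1) I y) ∧
    (∀ I, (dualLeft μ B η).comp e 1 I y = 0) ∧
    (∀ I, (dualRight μ ξ C).comp e 2 I y =
      lieC 2 (X.comp e 1) (A.comp e 2) I y +
        divC w (X.comp e 1) Fin.elim0 y * A.comp e 2 I y) ∧
    (∀ m, 3 ≤ m → ∀ I, (dualRight μ ξ C).comp e m I y =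
      lieC m (X.comp e 1) (A.comp e m) I y +
        divC w (X.comp e 1) Fin.elim0 y * A.comp e m I y +
        starC m (A.comp e (m - 1)) (X.comp e 0) I y) ∧
    (∀ I, (crossA μ η C).comp e 0 I y =
      -∑ᶠ (k : ℕ) (_ : 2 ≤ k), (astC 0 (X.comp e (k + 1)) (A.comp e k) I y +
        contractC 0 (divC w (X.comp e (k + 1))) (A.comp e k) I y)) ∧
    (∀ I, (crossA μ η C).comp e 1 I y =
      -∑ᶠ (k : ℕ) (_ : 2 ≤ k), lieDivC 1 w (X.comp e k) (A.comp e k) I y) ∧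
    (∀ I, (crossB μ ξ B).comp e 2 I y = starC 2 (A.comp e 1) (X.comp e 0) I y) ∧
    (∀ m, 3 ≤ m → ∀ I, (crossB μ ξ B).comp e m I y = 0) := by
  classical
  subst hξ hη hB hC
  obtain ⟨-, hs, hn, hl, hr, ha, hb⟩ := dual_components hμ hfin
  replace hs := hs.2 e he w hw y hy
  replace hn := hn.2 e he w hw y hy
  replace hl := hl.2 e he w hw y hy
  replace hr := hr.2 e he w hw y hy
  replace ha := ha.2 e he w hw y hy
  replace hb := hb.2 e he w hw y hy
  simp only [coadTerm_proj, mem_sOrders, mem_nOrders] at hs hn hl hr ha hb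
  have hcong : ∀ {m k p : ℕ} (_ : m + k - 1 = p) (I : Fin m → Fin n),
      coadTerm X A e w m k I y = lieDivC m w (X.comp e k) (A.comp e p) I y := by
    rintro m k _ rfl I
    rfl
  -- terms with `k ≥ 2` do not occur when the field has only the orders of `𝔰`
  have htwo : ∀ (m : ℕ) (P : ℕ → Prop) [DecidablePred P] (I : Fin m → Fin n),
      ∑ᶠ k, (if k ≤ 1 ∧ P (m + k - 1) then coadTerm X A e w m k I y else 0) =
        (if P (m + 0 - 1) then coadTerm X A e w m 0 I y else 0) +
          if P (m + 1 - 1) then coadTerm X A e w m 1 I y else 0 := by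
    intro m P _ I
    rw [finsum_eq_add_of_two fun k hk => if_neg fun h => by omega]
    simp
  refine ⟨fun I => ?_, fun I => ?_, fun m hm I => ?_, fun I => ?_, fun I => ?_, fun I => ?_,
    fun m hm I => ?_, fun I => ?_, fun I => ?_, fun I => ?_, fun m hm I => ?_⟩
  · rw [hs 0 (by omega), htwo 0 (· ≤ 1), if_pos (by omega), if_pos (by omega), coadTerm_zero_zero,
      zero_add, hcong (p := 0) rfl, lieDivC_of_order_one]
  · rw [hs 1 le_rfl, htwo 1 (· ≤ 1), if_pos (by omega), if_pos (by omega), hcong (p := 0) rfl,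
      hcong (p := 1) rfl, lieDivC_of_order_zero, lieDivC_of_order_one, starC_one, add_comm]
  · rw [hn m hm]
    refine finsum_congr fun k => ?_
    by_cases hk : 2 ≤ k
    · rw [if_pos ⟨hk, by omega⟩, finsum_eq_if, if_pos hk, coadTerm]
    · rw [if_neg fun h => hk h.1, finsum_eq_if, if_neg hk]
  · rw [hl 0 (by omega), finsum_eq_single _ 2, if_pos (by omega), hcong (p := 1) rfl,
      lieDivC_zero_covariant]
    · ring
    · intro k hk
      exact if_neg fun h => by omega
  · rw [hl 1 le_rfl, finsum_eq_single _ 0, if_neg (by omega), neg_zero]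
    intro k hk
    exact if_neg fun h => by omega
  · rw [hr 2 le_rfl, htwo 2 (2 ≤ ·), if_neg (by omega), if_pos (by omega), zero_add,
      hcong (p := 2) rfl, lieDivC_of_order_one]
  · rw [hr m (by omega), htwo m (2 ≤ ·), if_pos (by omega), if_pos (by omega),
      hcong (p := m - 1) rfl, hcong (p := m) rfl, lieDivC_of_order_zero, lieDivC_of_order_one,
      add_comm]
  · rw [ha 0 (by omega), finsum_eq_finsum_succ (if_neg (by omega))]
    congr 1
    refine finsum_congr fun k => ?_
    by_cases hk : 2 ≤ k
    · rw [if_pos (by omega), finsum_eq_if, if_pos hk, hcong (p := k) (by omega),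
        lieDivC_zero_covariant]
    · rw [if_neg (by omega), finsum_eq_if, if_neg hk]
  · rw [ha 1 le_rfl]
    congr 1
    refine finsum_congr fun k => ?_
    by_cases hk : 2 ≤ k
    · rw [if_pos (by omega), finsum_eq_if, if_pos hk, hcong (p := k) (by omega)]
    · rw [if_neg (by omega), finsum_eq_if, if_neg hk]
  · rw [hb 2 le_rfl, htwo 2 (· ≤ 1), if_pos (by omega), if_neg (by omega), add_zero,
      hcong (p := 1) rfl, lieDivC_of_order_zero]
  · rw [hb m (by omega), htwo m (· ≤ 1), if_neg (by omega), if_neg (by omega), add_zero]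

end SymTensor
end

theorem mainTheorem6 (n : ℕ) (Q : Type*) [TopologicalSpace Q]
    [ChartedSpace (EuclideanSpace ℝ (Fin n)) Q] [IsManifold (𝓡 n) ∞ Q] [T2Space Q]
    [SecondCountableTopology Q] [MeasurableSpace Q] [BorelSpace Q]
    (μ : Measure Q) (hμ : IsVolume n μ) :
    -- the concomitant of homogeneous fields has the Schouten components in every chart
    (∀ (k m r : ℕ), k + m = r + 1 → ∀ (X : Contra n Q k) (Y : Contra n Q m),
      ∀ e ∈ IsManifold.maximalAtlas (𝓡 n) ∞ Q, ∀ y ∈ e.target, ∀ I : Fin r → Fin n,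
        contraComp e (schouten r X Y).1 I y =
          schoutenC r (contraComp e X.1) (contraComp e Y.1) I y) ∧
    -- `𝔗Q` is the direct sum of the subalgebras `𝔰` and `𝔫`, with the stated mutual actions
    (∀ X : TQ n Q, X.proj sOrders ∈ part sOrders ∧ X.proj nOrders ∈ part nOrders ∧
      X = X.proj sOrders + X.proj nOrders) ∧
    (∀ X ∈ part (n := n) (Q := Q) sOrders, ∀ Y ∈ part sOrders, bracket X Y ∈ part sOrders) ∧
    (∀ X ∈ part (n := n) (Q := Q) nOrders, ∀ Y ∈ part nOrders, bracket X Y ∈ part nOrders) ∧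
    (∀ η ∈ part (n := n) (Q := Q) nOrders, ∀ ξ ∈ part sOrders,
      bracket η ξ = leftAct η ξ + rightAct η ξ ∧
      leftAct η ξ 0 = 0 ∧ leftAct η ξ 1 = schouten 1 (η 2) (ξ 0) ∧
      ∀ k, 2 ≤ k → rightAct η ξ k = schouten k (η (k + 1)) (ξ 0) - schouten k (ξ 1) (η k)) ∧
    (∀ ξ ∈ part (n := n) (Q := Q) sOrders, ∀ ξ' ∈ part sOrders, ∀ η ∈ part nOrders,
      ∀ η' ∈ part nOrders, bracket (ξ + η) (ξ' + η') =
        (bracket ξ ξ' + leftAct η ξ' - leftAct η' ξ) +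
          (bracket η η' + rightAct η ξ' - rightAct η' ξ)) ∧
    -- the dual objects exist, are unique, and are given by the explicit formulas
    (∀ (X : TQ n Q) (A : TQDual n Q), X.IsFinite ∨ A.IsFinite →
      ∀ (ξ η : TQ n Q) (B C : TQDual n Q),
        ξ = X.proj sOrders → η = X.proj nOrders → B = A.proj sOrders → C = A.proj nOrders →
      (∃! D, Represents μ Set.univ (coadFun μ X A) D) ∧
      (∃! D, Represents μ sOrders (coadFun μ ξ B) D) ∧
      (∃! D, Represents μ nOrders (coadFun μ η C) D) ∧
      (∃! D, Represents μ sOrders (dualLeftFun μ B η) D) ∧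
      (∃! D, Represents μ nOrders (dualRightFun μ ξ C) D) ∧
      (∃! D, Represents μ sOrders (crossAFun μ η C) D) ∧
      (∃! D, Represents μ nOrders (crossBFun μ ξ B) D) ∧
      ∀ e ∈ IsManifold.maximalAtlas (𝓡 n) ∞ Q, ∀ w : Coord n → ℝ, IsDensity μ e w →
        ∀ y ∈ e.target,
        -- the isentropic fluid: `ad*` on `𝔰`
        (∀ I, (coad μ sOrders ξ B).comp e 0 I y =
          lieC 0 (X.comp e 1) (A.comp e 0) I y +
            divC w (X.comp e 1) Fin.elim0 y * A.comp e 0 I y) ∧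
        (∀ I, (coad μ sOrders ξ B).comp e 1 I y =
          lieC 1 (X.comp e 1) (A.comp e 1) I y +
            divC w (X.comp e 1) Fin.elim0 y * A.comp e 1 I y +
            A.comp e 0 Fin.elim0 y * partialD (I 0) (X.comp e 0 Fin.elim0) y) ∧
        -- `ad*` on `𝔫`
        (∀ m, 2 ≤ m → ∀ I, (coad μ nOrders η C).comp e m I y =
          ∑ᶠ (k : ℕ) (_ : 2 ≤ k), lieDivC m w (X.comp e k) (A.comp e (m + k - 1)) I y) ∧
        -- the dual action of `𝔫` on `𝔰*`
        (∀ I, (dualLeft μ B η).comp e 0 I y =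
          -astC 0 (X.comp e 2) (A.comp e 1) I y
            - contractC 0 (divC w (X.comp e 2)) (A.comp e 1) I y) ∧
        (∀ I, (dualLeft μ B η).comp e 1 I y = 0) ∧
        -- the dual action of `𝔰` on `𝔫*`
        (∀ I, (dualRight μ ξ C).comp e 2 I y =
          lieC 2 (X.comp e 1) (A.comp e 2) I y +
            divC w (X.comp e 1) Fin.elim0 y * A.comp e 2 I y) ∧
        (∀ m, 3 ≤ m → ∀ I, (dualRight μ ξ C).comp e m I y =
          lieC m (X.comp e 1) (A.comp e m) I y +
            divC w (X.comp e 1) Fin.elim0 y * A.comp e m I y +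
            starC m (A.comp e (m - 1)) (X.comp e 0) I y) ∧
        -- the cross action of `𝔫` from `𝔫*` to `𝔰*`
        (∀ I, (crossA μ η C).comp e 0 I y =
          -∑ᶠ (k : ℕ) (_ : 2 ≤ k), (astC 0 (X.comp e (k + 1)) (A.comp e k) I y +
            contractC 0 (divC w (X.comp e (k + 1))) (A.comp e k) I y)) ∧
        (∀ I, (crossA μ η C).comp e 1 I y =
          -∑ᶠ (k : ℕ) (_ : 2 ≤ k), lieDivC 1 w (X.comp e k) (A.comp e k) I y) ∧
        -- the cross action of `𝔰` from `𝔰*` to `𝔫*`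
        (∀ I, (crossB μ ξ B).comp e 2 I y = starC 2 (A.comp e 1) (X.comp e 0) I y) ∧
        (∀ m, 3 ≤ m → ∀ I, (crossB μ ξ B).comp e m I y = 0)) ∧
    -- the Euler–Poincaré equations on `𝔗Q` are the matched Euler–Poincaré equations
    (∀ (𝔏 : TQ n Q → ℝ) (J : Set ℝ) (X : ℝ → TQ n Q) (A : ℝ → TQDual n Q), IsOpen J →
      (∀ t ∈ J, IsVarDeriv μ Set.univ 𝔏 (X t) (A t)) →
      (∀ t ∈ J, (X t).IsFinite ∨ (A t).IsFinite) →
      (∀ t ∈ J, IsVarDeriv μ sOrders 𝔏 (X t) ((A t).proj sOrders) ∧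
        IsVarDeriv μ nOrders 𝔏 (X t) ((A t).proj nOrders)) ∧
      (EulerPoincare μ J X A ↔
        MatchedEulerPoincare μ J (fun t => (X t).proj sOrders) (fun t => (X t).proj nOrders)
          (fun t => (A t).proj sOrders) (fun t => (A t).proj nOrders))) := by
  refine ⟨fun k m r h X Y e he y hy I => schouten_comp he h X Y hy I,
    fun X => ⟨X.proj_mem _, X.proj_mem _, X.eq_proj_add_proj⟩,
    fun X hX Y hY => bracket_mem_sOrders hX hY, fun X hX Y hY => bracket_mem_nOrders hX hY,
    fun η hη ξ hξ => ⟨bracket_eq_leftAct_add_rightAct η ξ, mixed_bracket hη hξ⟩,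
    fun ξ _ ξ' _ η _ η' _ => matched_bracket ξ ξ' η η', ?_, ?_⟩
  · intro X A hfin ξ η B C hξ hη hB hC
    have hB' : B ∈ dualPart sOrders := hB ▸ A.proj_mem _
    have hC' : C ∈ dualPart nOrders := hC ▸ A.proj_mem _
    have hfξB : ξ.IsFinite ∨ B.IsFinite := hξ ▸ hB ▸ hfin.imp (·.proj _) (·.proj _)
    have hfξC : ξ.IsFinite ∨ C.IsFinite := hξ ▸ hC ▸ hfin.imp (·.proj _) (·.proj _)
    have hfηB : η.IsFinite ∨ B.IsFinite := hη ▸ hB ▸ hfin.imp (·.proj _) (·.proj _)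
    have hfηC : η.IsFinite ∨ C.IsFinite := hη ▸ hC ▸ hfin.imp (·.proj _) (·.proj _)
    exact ⟨(representer_coadFun hμ _ hfin rfl).1, (representer_coadFun hμ _ hfξB rfl).1,
      (representer_coadFun hμ _ hfηC rfl).1,
      (representer_neg_coadFun hμ _ hfηB (dualLeftFun_eq hB' η)).1,
      (representer_coadFun hμ _ hfξC (dualRightFun_eq hC' ξ)).1,
      (representer_neg_coadFun hμ _ hfηC (crossAFun_eq hC' η)).1,
      (representer_coadFun hμ _ hfξB (crossBFun_eq hB' ξ)).1,
      fun e he w hw y hy => dual_comp_formulas hμ hfin hξ hη hB hC he hw hy⟩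
  · intro 𝔏 J X A _ hvar hfin
    exact ⟨fun t ht => ⟨(hvar t ht).proj _, (hvar t ht).proj _⟩, eulerPoincare_iff_matched hμ hfin⟩
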